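/- **Setting.** Let $d\ge 1$, $p\ge 0$; $\|\cdot\|$ is the Euclidean norm and $\overline B_r=\{x\in\mathbb R^d:|x_i|\le r\ \forall i\}$ ($\overline B_\infty=\mathbb R^d$). Let $S\subseteq\mathbb R^d$ be closed, $0<\beta\le\infty$, $\kappa\in[0,\infty]$, and let $\xi\in\mathbb R^p$ be a random vector with law $P_\xi$. Let $F:\overline B_\kappa\times\mathbb R^p\to\mathbb R$ be Borel measurable, continuous in $w\in\overline B_\kappa$ for each $\xi$, with $F(w,\cdot)$ integrable for each $w\in\overline B_\kappa$, and for $P_\xi$-almost every $\xi$, $|F(w,\xi)-F(w',\xi)|\le L_0(\xi)\|w-w'\|$ for all $w,w'\in\overline B_\kappa$, where $L_0(\cdot)$ is measurable, $Q:=\mathbb E[L_0(\xi)^2]<\infty$ and $L_0:=\mathbb E[L_0(\xi)]>0$. Put $f(w)=\mathbb E[F(w,\xi)]$ and, for $\alpha>0$, $f_\alpha(w)=\mathbb E[f(w+u)]$ with $u$ uniformly distributed on $\overline B_{\alpha/2}$ (law $P_u$). Below, "$\kappa>\beta+a$" is also regarded as satisfied if $\beta=\kappa=\infty$. Let $X=S\cap\overline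 B_\beta$, and let $N(w,X)$ be the Mordukhovich normal cone: the set of limits of $y_k\in\widehat N(x_k,X)$ with $x_k\to w$, $x_k\in X$, where $\widehat N(x,X)=\{y:\limsup_{x'\to x,\,x'\in X}\langle y,x'-x\rangle/\|x'-x\|\le 0\}$ is the Fréchet normal cone. Let $\overline\partial f$ be the Clarke subdifferential and $\overline\partial_\epsilon f(w)=\mathrm{co}\bigcup_{\|x-w\|\le\epsilon}\overline\partial f(x)$. Given $\alpha$, and $\widehat\alpha=\sqrt d\,\alpha/2$, a point $\overline w$ is * an $(\epsilon_1,\epsilon_2)$-stationary point if $|f_\alpha(w)-f(w)|\le\epsilon_1$ for all $w\in\overline B_\beta$ and $\mathrm{dist}(0,\nabla f_\alpha(\overline w)+N(\overline w,X))\le\epsilon_2$ (with $f_\alpha$ differentiable at $\overline w$); * an $(\epsilon_3,\epsilon_4)$-stationary point if $\widehat\alpha\le\epsilon_3$ and $\mathrm{dist}(0,\overline\partial_{\widehat\alpha}f(\overline w)+N(\overline w,X))\le\epsilon_4$. **Algorithm (SPA).** Fix an initial point $x_1\in X$ and a Borel measurable selection $\Pi$ of the Euclidean projection onto $X$. One of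 two stochastic gradients $g(w,u,\xi)$ is used: (1) $g=\alpha^{-1}dF(w,u,\xi)$, where $dF_i$ is the difference of the values of $F(\cdot,\xi)$ at the two points obtained from $w+u$ by replacing its $i$-th coordinate by $w_i+\frac\alpha2$ and by $w_i-\frac\alpha2$; put $\upsilon=d$; or (2) $g=\widetilde\nabla F(w+u,\xi)$, where $\widetilde\nabla F$ is Borel measurable on $\overline B_{\beta+\alpha/2}\times\mathbb R^p$ and for each $w\in\overline B_\beta$ equals the gradient of $F(\cdot,\xi)$ at $w+u$ for $P_u\times P_\xi$-almost every $(u,\xi)$; put $\upsilon=1$. Given $\eta,K,M$, a run of SPA draws $R$ uniformly from $\{2,\dots,K+1\}$, starts at $w^1=x_1$, makes the steps $w^{k+1}=\Pi\big(w^k-\frac\eta M\sum_{i=1}^M g(w^k,u^{k,i},\xi^{k,i})\big)$, $k=1,\dots,R-1$, with independent samples, independent of $R$, and outputs $w^R$. **Parameters.** Let $c,\gamma\in(0,1)$, $\phi>1$, $\rho>1$, $C_1=\frac{2(1+3\rho)}{\rho-1}+3\rho$, $C_2=\frac{2(1+3\rho)}{\rho-1}+3$, $\eta=\frac{\alpha}{3\rho\sqrt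 d L_0}$, and let $\Delta>0$ satisfy $f_\alpha(x_1)-f_\alpha(w)\le\Delta$ for all $w\in X$. Let $r=\lceil-\ln(c\gamma)\rceil$ and $\psi=\frac{r}{(1-c)\gamma}$. For $\epsilon>0$ let $T=\lceil 6\phi\psi\frac{\upsilon Q}{\epsilon^2}\rceil$, $\epsilon'=\sqrt{\frac{\epsilon^2-6\psi\upsilon Q/T}{4e}}$ and $M=\lceil C_2\frac{2\upsilon Q}{(\epsilon')^2}\rceil$. * Case A ($\epsilon_1,\epsilon_2>0$): $\epsilon=\epsilon_2$, $\alpha=\frac{\epsilon_1}{L_0\sqrt{d/12}}$, $K=\Big\lceil C_1\sqrt{\tfrac43}\frac{dL_0^2\Delta}{\epsilon_1(\epsilon_2')^2}\Big\rceil$, assuming $\kappa>\beta+\frac\alpha2$. * Case B ($\epsilon_3,\epsilon_4>0$): $\epsilon=\epsilon_4$, $\alpha=\frac{2\epsilon_3}{\sqrt d}$, $K=\Big\lceil C_1\frac{2dL_0\Delta}{\epsilon_3(\epsilon_4')^2}\Big\rceil$, assuming $\kappa>\beta+\epsilon_3$. **Method.** Run SPA $r$ times independently, with set of outputs $W$.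 Draw samples $\{u^i\}_{i=1}^T$, $\{\xi^i\}_{i=1}^T$, independent of each other and of the runs, put $G(w)=\frac1T\sum_{i=1}^T g(w,u^i,\xi^i)$ and choose any $w^*\in\operatorname{argmin}_{w\in W}\mathrm{dist}(0,G(w)+N(w,X))$. **Claim.** With probability at least $1-\gamma$, $w^*$ is an $(\epsilon_1,\epsilon_2)$-stationary point in Case A, and an $(\epsilon_3,\epsilon_4)$-stationary point in Case B. The method makes $\tilde O(\epsilon_1^{-1}\epsilon_2^{-4}+\gamma^{-1}\epsilon_2^{-2})$ (resp. $\tilde O(\epsilon_3^{-1}\epsilon_4^{-4}+\gamma^{-1}\epsilon_4^{-2})$) gradient calls, i.e. evaluations of $g$, and $\tilde O(\epsilon_1^{-1}\epsilon_2^{-2})$ (resp. $\tilde O(\epsilon_3^{-1}\epsilon_4^{-2})$) projections. Here $\tilde O(h)$ means: for all bounds $\bar\Delta,\bar\epsilon>0$ there are $C,k$ such that almost surely the number is at most $C(1+\ln\frac1\gamma)^k h$ for all $\gamma\in(0,1)$, all accuracies in $(0,\bar\epsilon]$ and all $\Delta\in(0,\bar\Delta]$. -/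

import Mathlib

open MeasureTheory Filter Topology
open scoped Pointwise ENNReal

namespace SPA

noncomputable section

/-- `ℝⁿ` with the Euclidean norm. -/
abbrev Vec (n : ℕ) := EuclideanSpace ℝ (Fin n)

/-! ### Variational analysis -/

/-- Fréchet normal cone: `limsup ⟪y, x - w⟫ / ‖x - w‖ ≤ 0` as `x → w`, `x ∈ S`, `x ≠ w`.
The limsup is taken in the extended reals, so it is `-∞` at an isolated point of `S`.
The cone is empty when `w ∉ S`. -/
def frechetNormalCone {d : ℕ} (w : Vec d) (S : Set (Vec d)) : Set (Vec d) :=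
  {y | w ∈ S ∧
    limsup (fun x : Vec d => ((inner ℝ y (x - w) / ‖x - w‖ : ℝ) : EReal)) (𝓝[S \ {w}] w) ≤ 0}

/-- Mordukhovich (limiting) normal cone, empty when `w ∉ S`. -/
def normalCone {d : ℕ} (w : Vec d) (S : Set (Vec d)) : Set (Vec d) :=
  {y | w ∈ S ∧ ∃ (x v : ℕ → Vec d), Tendsto x atTop (𝓝 w) ∧ Tendsto v atTop (𝓝 y) ∧
    ∀ k, x k ∈ S ∧ v k ∈ frechetNormalCone (x k) S}

/-- Clarke generalized directional derivative
`f°(w; v) = limsup_{y → w, t ↓ 0} (f (y + t v) - f y) / t`, as an extended real. -/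
def clarkeDirDeriv {d : ℕ} (f : Vec d → ℝ) (w v : Vec d) : EReal :=
  limsup (fun q : Vec d × ℝ => (((f (q.1 + q.2 • v) - f q.1) / q.2 : ℝ) : EReal))
    (𝓝 w ×ˢ 𝓝[>] (0 : ℝ))

/-- Clarke subdifferential (used where `f` is Lipschitz near `w`). -/
def clarkeSubdiff {d : ℕ} (f : Vec d → ℝ) (w : Vec d) : Set (Vec d) :=
  {g | ∀ v : Vec d, ((inner ℝ g v : ℝ) : EReal) ≤ clarkeDirDeriv f w v}

/-- Clarke `ε`-subdifferential: the convex hull of the Clarke subdifferentials over the closed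
Euclidean ball of radius `ε`. -/
def clarkeEpsSubdiff {d : ℕ} (ε : ℝ) (f : Vec d → ℝ) (w : Vec d) : Set (Vec d) :=
  convexHull ℝ (⋃ x ∈ Metric.closedBall w ε, clarkeSubdiff f x)

/-- `dist (0, A)`, equal to `∞` when `A` is empty. -/
def distZero {d : ℕ} (A : Set (Vec d)) : ℝ≥0∞ := Metric.infEDist 0 A

/-- The closed `ℓ_∞`-ball of radius `r` around `0`; all of `ℝᵈ` when `r = ∞`. -/
def cube (d : ℕ) (r : ℝ≥0∞) : Set (Vec d) := {x | ∀ i, ENNReal.ofReal |x i| ≤ r}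

/-- The law `P_u`: uniform on the `ℓ_∞`-ball of radius `α / 2`. -/
def unifCube (d : ℕ) (α : ℝ) : Measure (Vec d) :=
  ProbabilityTheory.cond volume (cube d (ENNReal.ofReal (α / 2)))

/-! ### The optimization problem -/

/-- A stochastic loss `F(w, ξ)` with the law of `ξ`, a closed constraint set `S`, the radius `β`
of the additional box constraint and the radius `κ` of the box on which `F(·, ξ)` is Lipschitz
with constant `lip ξ`. Radii may be infinite. Values of `F` outside the box of radius `κ` are
irrelevant. -/
structure Problem (d p : ℕ) where
  F : Vec d → Vec p → ℝ
  law : Measure (Vec p)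
  law_prob : IsProbabilityMeasure law
  S : Set (Vec d)
  closed_S : IsClosed S
  β : ℝ≥0∞
  κ : ℝ≥0∞
  β_pos : 0 < β
  lip : Vec p → ℝ
  measurable_F : Measurable
    ((cube d κ ×ˢ (Set.univ : Set (Vec p))).domRestrict (fun z : Vec d × Vec p => F z.1 z.2))
  continuous_F : ∀ ξ, ContinuousOn (fun w => F w ξ) (cube d κ)
  integrable_F : ∀ w ∈ cube d κ, Integrable (F w) law
  measurable_lip : Measurable lip
  lipschitz_F : ∀ᵐ ξ ∂law, ∀ w ∈ cube d κ, ∀ w' ∈ cube d κ, |F w ξ - F w' ξ| ≤ lip ξ * ‖w - w'‖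
  sq_integrable_lip : Integrable (fun ξ => lip ξ ^ 2) law

namespace Problem

variable {d p : ℕ} (pb : Problem d p)

/-- `f(w) = E[F(w, ξ)]`. -/
def f (w : Vec d) : ℝ := ∫ ξ, pb.F w ξ ∂pb.law

/-- `f_α(w) = E[f(w + u)]`. -/
def fSmooth (α : ℝ) (w : Vec d) : ℝ := ∫ u, pb.f (w + u) ∂(unifCube d α)

/-- `L₀ = E[L₀(ξ)]`. -/
def L₀ : ℝ := ∫ ξ, pb.lip ξ ∂pb.law

/-- `Q = E[L₀(ξ)²]`. -/
def Q : ℝ := ∫ ξ, pb.lip ξ ^ 2 ∂pb.law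

/-- The feasible set: `S` intersected with the box of radius `β`. -/
def feasible : Set (Vec d) := pb.S ∩ cube d pb.β

/-- `κ > β + a`, or no box constraint at all (`β = κ = ∞`). -/
def Margin (a : ℝ) : Prop :=
  pb.β + ENNReal.ofReal a < pb.κ ∨ (pb.β = ⊤ ∧ pb.κ = ⊤)

/-- `proj` is a Borel measurable selection of the Euclidean projection onto the feasible set. -/
def IsProjection (proj : Vec d → Vec d) : Prop :=
  Measurable proj ∧ ∀ x, proj x ∈ pb.feasible ∧ ∀ y ∈ pb.feasible, ‖proj x - x‖ ≤ ‖y - x‖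

/-- `(ε₁, ε₂)`-stationary point for the smoothing parameter `α`. -/
def IsStationary₁₂ (α ε₁ ε₂ : ℝ) (w : Vec d) : Prop :=
  (∀ x ∈ cube d pb.β, |pb.fSmooth α x - pb.f x| ≤ ε₁) ∧
  ∃ g, HasGradientAt (pb.fSmooth α) g w ∧
    distZero ({g} + normalCone w pb.feasible) ≤ ENNReal.ofReal ε₂

/-- `(ε₃, ε₄)`-stationary point for the smoothing parameter `α`. -/
def IsStationary₃₄ (α ε₃ ε₄ : ℝ) (w : Vec d) : Prop :=
  √(d : ℝ) * (α / 2) ≤ ε₃ ∧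
  distZero (clarkeEpsSubdiff (√(d : ℝ) * (α / 2)) pb.f w + normalCone w pb.feasible)
    ≤ ENNReal.ofReal ε₄

end Problem

/-! ### Gradient estimators -/

/-- The two versions of the algorithm: zeroth-order, through finite differences `dF`, and
first-order, through a given function `G(w, ξ)` that stands for the gradient of `F(·, ξ)`. -/
inductive Oracle (d p : ℕ)
  | zeroth : Oracle d p
  | first (G : Vec d → Vec p → Vec d) : Oracle d p

/-- `dF(w, u, ξ)`: in component `i`, the `i`-th coordinate of `w + u` is replaced by
`w i + α / 2` and by `w i - α / 2`. -/
def finiteDiff {d p : ℕ} (F : Vec d → Vec p → ℝ) (α : ℝ) (w u : Vec d) (ξ : Vec p) : Vec d :=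
  WithLp.toLp 2 fun i =>
    F (WithLp.toLp 2 (Function.update (fun j => w j + u j) i (w i + α / 2))) ξ -
    F (WithLp.toLp 2 (Function.update (fun j => w j + u j) i (w i - α / 2))) ξ

namespace Oracle

variable {d p : ℕ}

/-- For the first-order version: `G` is Borel measurable on (box of radius `β + α / 2`) `× ℝᵖ`,
and for each `w` in the box of radius `β` it gives the gradient of `F(·, ξ)` at `w + u` for almost
every `(u, ξ)`. -/
def Valid (pb : Problem d p) (α : ℝ) : Oracle d p → Prop
  | zeroth => True
  | first G =>
      Measurable ((cube d (pb.β + ENNReal.ofReal (α / 2)) ×ˢ (Set.univ : Set (Vec p))).domRestrict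
        (fun z : Vec d × Vec p => G z.1 z.2)) ∧
      ∀ w ∈ cube d pb.β, ∀ᵐ z ∂((unifCube d α).prod pb.law),
        HasGradientAt (fun x => pb.F x z.2) (G (w + z.1) z.2) (w + z.1)

/-- One gradient call: the stochastic gradient at `w` with the sample `z = (u, ξ)`. -/
def call (O : Oracle d p) (pb : Problem d p) (α : ℝ) (w : Vec d) (z : Vec d × Vec p) : Vec d :=
  match O with
  | zeroth => α⁻¹ • finiteDiff pb.F α w z.1 z.2
  | first G => G (w + z.1) z.2

/-- Mean of `m` gradient calls at `w`. -/
def batch (O : Oracle d p) (pb : Problem d p) (α : ℝ) {m : ℕ} (w : Vec d)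
    (z : Fin m → Vec d × Vec p) : Vec d :=
  (m : ℝ)⁻¹ • ∑ i, O.call pb α w (z i)

/-- `υ = d` for the zeroth-order and `υ = 1` for the first-order version. -/
def υ : Oracle d p → ℝ
  | zeroth => d
  | first _ => 1

end Oracle

/-! ### The algorithm -/

/-- Smoothing parameter `α`, step size `η`, iteration bound `K`, batch size `M`, number `r` of
runs and number `T` of samples of the selection phase. -/
structure Config where
  α : ℝ
  η : ℝ
  K : ℕ
  M : ℕ
  r : ℕ
  T : ℕ

/-- Current iterate, with the gradient calls and projections made so far. -/
structure State (d : ℕ) where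
  point : Vec d
  gradCalls : ℕ
  projections : ℕ

section Algorithm

variable {d p : ℕ} (pb : Problem d p) (O : Oracle d p) (proj : Vec d → Vec d) (x₁ : Vec d)
  (cfg : Config)

/-- One iteration with a batch of `M` samples. -/
def step (s : State d) (z : Fin cfg.M → Vec d × Vec p) : State d where
  point := proj (s.point - cfg.η • O.batch pb cfg.α s.point z)
  gradCalls := s.gradCalls + cfg.M
  projections := s.projections + 1

/-- The state after `n ≤ K` iterations from `x₁`; its point is the iterate `w^{n+1}`. -/
def iterates (z : Fin cfg.K → Fin cfg.M → Vec d × Vec p) : ℕ → State d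
  | 0 => ⟨x₁, 0, 0⟩
  | n + 1 =>
      if h : n < cfg.K then step pb O proj cfg (iterates z n) (z ⟨n, h⟩) else iterates z n

/-- Randomness of one run: the random index `R` and the samples `(u^{k,i}, ξ^{k,i})`. -/
abbrev RunSeed (d p : ℕ) (cfg : Config) := ℕ × (Fin cfg.K → Fin cfg.M → Vec d × Vec p)

/-- Randomness of the whole method: `r` runs and the `T` samples of the selection phase. -/
abbrev Seed (d p : ℕ) (cfg : Config) := (Fin cfg.r → RunSeed d p cfg) × (Fin cfg.T → Vec d × Vec p)

/-- Joint law of an independent pair `(u, ξ)`. -/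
def sampleLaw (α : ℝ) : Measure (Vec d × Vec p) := (unifCube d α).prod pb.law

/-- `R` is uniform on `{2, …, K + 1}`, independent of the samples, which are i.i.d. -/
def runLaw : Measure (RunSeed d p cfg) :=
  (ProbabilityTheory.uniformOn (Set.Icc 2 (cfg.K + 1))).prod
    (Measure.pi fun _ => Measure.pi fun _ => sampleLaw pb cfg.α)

/-- The runs are independent of each other and of the samples of the selection phase. -/
def seedLaw : Measure (Seed d p cfg) :=
  (Measure.pi fun _ => runLaw pb cfg).prod (Measure.pi fun _ => sampleLaw pb cfg.α)

/-- Final state of a run: `R - 1` iterations are made and `w^R` is returned. -/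
def run (ω : RunSeed d p cfg) : State d := iterates pb O proj x₁ cfg ω.2 (ω.1 - 1)

/-- Output of the `j`-th run. -/
def output (ω : Seed d p cfg) (j : Fin cfg.r) : Vec d := (run pb O proj x₁ cfg (ω.1 j)).point

/-- `dist (0, G(w) + N(w, feasible set))` for the output `w` of the `j`-th run, where `G(w)` is the
sample mean over the `T` samples of the selection phase. -/
def score (ω : Seed d p cfg) (j : Fin cfg.r) : ℝ≥0∞ :=
  distZero ({O.batch pb cfg.α (output pb O proj x₁ cfg ω j) ω.2} +
    normalCone (output pb O proj x₁ cfg ω j) pb.feasible)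

/-- The output of run `j` is a permissible choice: it minimizes the score. -/
def IsChosen (ω : Seed d p cfg) (j : Fin cfg.r) : Prop :=
  ∀ i, score pb O proj x₁ cfg ω j ≤ score pb O proj x₁ cfg ω i

/-- All gradient calls: those of the runs, and `T` for each candidate in the selection phase. -/
def totalGradCalls (ω : Seed d p cfg) : ℕ :=
  ∑ j, ((run pb O proj x₁ cfg (ω.1 j)).gradCalls + cfg.T)

/-- All projections. -/
def totalProjections (ω : Seed d p cfg) : ℕ := ∑ j, (run pb O proj x₁ cfg (ω.1 j)).projections

end Algorithm

/-- With probability at least `1 - γ`, every permissible choice `w*` satisfies `good`. -/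
def ChosenWithProb {d p : ℕ} (pb : Problem d p) (O : Oracle d p) (proj : Vec d → Vec d)
    (x₁ : Vec d) (cfg : Config) (γ : ℝ) (good : Vec d → Prop) : Prop :=
  ∃ A : Set (Seed d p cfg), MeasurableSet A ∧ ENNReal.ofReal (1 - γ) ≤ seedLaw pb cfg A ∧
    ∀ ω ∈ A, ∀ j, IsChosen pb O proj x₁ cfg ω j → good (output pb O proj x₁ cfg ω j)

/-! ### Parameter choices -/

/-- `C₁` with `τ = 0`. -/
def C₁ (ρ : ℝ) : ℝ := 2 * (1 + 3 * ρ) / (ρ - 1) + 3 * ρ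

/-- `C₂` with `τ = 0`. -/
def C₂ (ρ : ℝ) : ℝ := 4 * (1 + 3 * ρ) / (ρ - 1) * (1 / 2) + 3

/-- `r = ⌈-ln (c γ)⌉`. -/
def numRuns (c γ : ℝ) : ℕ := ⌈-Real.log (c * γ)⌉₊

/-- `ψ = r / ((1 - c) γ)`. -/
def ψ (c γ : ℝ) : ℝ := numRuns c γ / ((1 - c) * γ)

/-- `T = ⌈6 φ ψ υQ / ε²⌉`, where `q` is `υQ`. -/
def numSel (q c φ γ ε : ℝ) : ℕ := ⌈6 * φ * ψ c γ * (q / ε ^ 2)⌉₊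

/-- `ε' = √((ε² - 6 ψ υQ / T) / (4 e))`, where `q` is `υQ`. -/
def εPrime (q c φ γ ε : ℝ) : ℝ :=
  √((ε ^ 2 - 6 * ψ c γ * (q / numSel q c φ γ ε)) / (4 * Real.exp 1))

/-- `M = ⌈C₂ 2 υQ / ε'²⌉`, where `q` is `υQ`. -/
def batchSize (q ρ c φ γ ε : ℝ) : ℕ := ⌈C₂ ρ * (2 * q / εPrime q c φ γ ε ^ 2)⌉₊

/-- Step size `η = α / (3 ρ √d L₀)`. -/
def stepSize {d p : ℕ} (pb : Problem d p) (ρ α : ℝ) : ℝ := α / (3 * ρ * √(d : ℝ) * pb.L₀)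

/-- `α = ε₁ / (L₀ √(d / 12))`. -/
def α₁₂ {d p : ℕ} (pb : Problem d p) (ε₁ : ℝ) : ℝ := ε₁ / (pb.L₀ * √((d : ℝ) / 12))

/-- `α = 2 ε₃ / √d`. -/
def α₃₄ (d : ℕ) (ε₃ : ℝ) : ℝ := 2 * ε₃ / √(d : ℝ)

/-- Parameters for an `(ε₁, ε₂)`-stationary point. -/
def config₁₂ {d p : ℕ} (pb : Problem d p) (O : Oracle d p) (ρ c φ Δ γ ε₁ ε₂ : ℝ) : Config where
  α := α₁₂ pb ε₁
  η := stepSize pb ρ (α₁₂ pb ε₁)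
  K := ⌈C₁ ρ * √(4 / 3) * (d * pb.L₀ ^ 2 * Δ / (ε₁ * εPrime (O.υ * pb.Q) c φ γ ε₂ ^ 2))⌉₊
  M := batchSize (O.υ * pb.Q) ρ c φ γ ε₂
  r := numRuns c γ
  T := numSel (O.υ * pb.Q) c φ γ ε₂

/-- Parameters for an `(ε₃, ε₄)`-stationary point. -/
def config₃₄ {d p : ℕ} (pb : Problem d p) (O : Oracle d p) (ρ c φ Δ γ ε₃ ε₄ : ℝ) : Config where
  α := α₃₄ d ε₃
  η := stepSize pb ρ (α₃₄ d ε₃)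
  K := ⌈C₁ ρ * (2 * d * pb.L₀ * Δ / (ε₃ * εPrime (O.υ * pb.Q) c φ γ ε₄ ^ 2))⌉₊
  M := batchSize (O.υ * pb.Q) ρ c φ γ ε₄
  r := numRuns c γ
  T := numSel (O.υ * pb.Q) c φ γ ε₄

/-- The cost of the method with parameters `cfg O Δ γ ε ε'` is almost surely
`Õ(ε⁻¹ ε'⁻⁴ + γ⁻¹ ε'⁻²)` gradient calls and `Õ(ε⁻¹ ε'⁻²)` projections, for `ε`, `ε'` bounded
above and `γ ∈ (0, 1)`, with only powers of `log (1 / γ)` hidden and constants uniform over all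
bounded `Δ`. -/
def HasComplexity {d p : ℕ} (pb : Problem d p) (proj : Vec d → Vec d) (x₁ : Vec d)
    (cfg : Oracle d p → ℝ → ℝ → ℝ → ℝ → Config) : Prop :=
  ∀ Δmax εmax : ℝ, 0 < Δmax → 0 < εmax →
    ∃ (C : ℝ) (k : ℕ), ∀ (O : Oracle d p) (Δ γ ε ε' : ℝ),
      Δ ∈ Set.Ioc 0 Δmax → γ ∈ Set.Ioo (0 : ℝ) 1 → ε ∈ Set.Ioc 0 εmax → ε' ∈ Set.Ioc 0 εmax →
      ∀ᵐ ω ∂(seedLaw pb (cfg O Δ γ ε ε')),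
        (totalGradCalls pb O proj x₁ (cfg O Δ γ ε ε') ω : ℝ)
          ≤ C * (1 + Real.log (1 / γ)) ^ k * (1 / (ε * ε' ^ 4) + 1 / (γ * ε' ^ 2)) ∧
        (totalProjections pb O proj x₁ (cfg O Δ γ ε ε') ω : ℝ)
          ≤ C * (1 + Real.log (1 / γ)) ^ k * (1 / (ε * ε' ^ 2))

end

end SPA

namespace SPA

noncomputable section

/-! ### Product measures -/

/-! Smoothing makes the problem accessible to a projected stochastic gradient argument. With `ℓ = √d
L₀ / α`, averaging an `L₀`-Lipschitz function over the box gives a differentiable function. The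
components of its gradient are expected central difference quotients (`hasGradientAt_smoothing`), so
the gradient is `2ℓ`-Lipschitz (`smoothGrad_sub_le`). Both stochastic gradients are unbiased for it,
with second moment at most `υQ` (`isGradientModel_extend`). Since `F` is controlled only on the
`κ`-box, the analysis uses its extension by clamping; the margin condition ensures that this changes
nothing near the points that matter.

The feasible set need not be convex, so the projection is used in only two ways: the new point is at
least as close to the target as the old one, and the vector from it to the target is a limiting
normal. Hence, for a step `x → x'` with stochastic gradient `g`, the vector `∇h(x') - g - η⁻¹(x' -
x)` lies in `∇h(x') + N(x', X)`. The choice `η = (3ρℓ)⁻¹` bounds its square by a multiple of `h(x) -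
h(x')` plus a multiple of the squared gradient error (`sq_residual_le`). Along a path the decreases
telescope. The choices of `K` and `M` then make the mean square at a uniformly random index at most
`ε'²` (`lintegral_runResidual_le`).

Two applications of Markov's inequality turn this into high probability
(`measure_all_lt_or_exists_lt_le`). A run has squared residual above `exp(1) ε'²` with probability
at most `exp(-1)`, so all `r` independent runs fail with probability at most `cγ`. A selection mean
has squared error above `ψ υQ / T` with probability at most `1/ψ`, and the union over the candidates
costs `r/ψ = (1 - c)γ`. Otherwise comparison with a good candidate costs two selection errors, and
the definition of `ε'` makes the total at most `ε` (`distZero_chosen_le`).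

In Case A the approximation error is at most `L₀ E‖u‖`. In Case B the smoothed gradient is an
average of Clarke subgradients at nearby points, hence in the closure of the `ε`-subdifferential,
and distances ignore closures. The cost bound is deterministic: `φ > 1` keeps `ε'` comparable to
`ε`, and the counts never exceed `r (K M + T)` and `r K`. -/

theorem measurePreserving_update {ι : Type*} [Fintype ι] [DecidableEq ι] {X : ι → Type*}
    [∀ i, MeasurableSpace (X i)] (μ : ∀ i, Measure (X i)) [∀ i, IsProbabilityMeasure (μ i)]
    (i : ι) :
    MeasurePreserving (fun q : (∀ j, X j) × X i => Function.update q.1 i q.2)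
      ((Measure.pi μ).prod (μ i)) (Measure.pi μ) := by
  have hm : Measurable (fun q : (∀ j, X j) × X i => Function.update q.1 i q.2) := by
    refine measurable_pi_lambda _ fun j => ?_
    by_cases h : j = i
    · subst h; simpa using measurable_snd
    · simp only [Function.update_of_ne h]; fun_prop
  refine ⟨hm, (Measure.pi_eq fun s hs => ?_).symm⟩
  rw [Measure.map_apply hm (MeasurableSet.univ_pi hs)]
  have : (fun q : (∀ j, X j) × X i => Function.update q.1 i q.2) ⁻¹' Set.univ.pi s
      = (Set.univ.pi (Function.update s i Set.univ)) ×ˢ s i := by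
    ext ⟨x, y⟩
    simp only [Set.mem_preimage, Set.mem_pi, Set.mem_univ, true_implies, Set.mem_prod]
    constructor
    · intro h
      refine ⟨fun j => ?_, by simpa using h i⟩
      by_cases hj : j = i
      · subst hj; simp
      · simpa [hj] using h j
    · rintro ⟨h1, h2⟩ j
      by_cases hj : j = i
      · subst hj; simpa using h2
      · simpa [hj] using h1 j
  rw [this, Measure.prod_prod, Measure.pi_pi, ← Finset.mul_prod_erase _ _ (Finset.mem_univ i),
    ← Finset.mul_prod_erase (Finset.univ) (fun j => μ j (s j)) (Finset.mem_univ i)]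
  simp only [Function.update_self, measure_univ, one_mul]
  rw [mul_comm]
  congr 1
  exact Finset.prod_congr rfl fun j hj => by rw [Function.update_of_ne (Finset.ne_of_mem_erase hj)]

/-- Redrawing one coordinate independently preserves the product law. This replaces conditioning on
the past: the inner integral averages over one fresh coordinate while the others stay fixed. -/
theorem lintegral_pi_eq_lintegral_update {ι : Type*} [Fintype ι] [DecidableEq ι] {X : ι → Type*}
    [∀ i, MeasurableSpace (X i)] (μ : ∀ i, Measure (X i)) [∀ i, IsProbabilityMeasure (μ i)]
    (i : ι) {φ : (∀ j, X j) → ℝ≥0∞} (hφ : Measurable φ) :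
    ∫⁻ x, φ x ∂(Measure.pi μ) = ∫⁻ x, ∫⁻ y, φ (Function.update x i y) ∂(μ i) ∂(Measure.pi μ) := by
  have h := measurePreserving_update μ i
  rw [← h.lintegral_comp hφ]
  exact lintegral_prod _ (hφ.comp h.measurable).aemeasurable

/-! ### Smooth functions on a convex set -/

section Descent

variable {E : Type*} [NormedAddCommGroup E] [InnerProductSpace ℝ E] [CompleteSpace E]
  {B : Set E} {h : E → ℝ} {grad : E → E} {L : ℝ}

theorem le_add_inner_add_sq (hB : Convex ℝ B) (hg : ∀ x ∈ B, HasGradientAt h (grad x) x)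
    (hL : ∀ x ∈ B, ∀ y ∈ B, ‖grad x - grad y‖ ≤ L * ‖x - y‖) {x y : E} (hx : x ∈ B)
    (hy : y ∈ B) : h y ≤ h x + inner ℝ (grad x) (y - x) + L / 2 * ‖y - x‖ ^ 2 := by
  -- This is `h` along the segment minus the linear and quadratic terms of the claimed bound. Its
  -- derivative is nonpositive, so comparing `t = 1` with `t = 0` gives the claim.
  set φ : ℝ → ℝ := fun t => h (x + t • (y - x)) - t * inner ℝ (grad x) (y - x)
    - t ^ 2 * (L / 2 * ‖y - x‖ ^ 2) with hφ
  have hmem : ∀ t ∈ Set.Icc (0 : ℝ) 1, x + t • (y - x) ∈ B := fun t ht =>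
    hB.add_smul_sub_mem hx hy ht
  have hd : ∀ t ∈ Set.Icc (0 : ℝ) 1, HasDerivAt φ
      (inner ℝ (grad (x + t • (y - x))) (y - x) - inner ℝ (grad x) (y - x)
        - 2 * t * (L / 2 * ‖y - x‖ ^ 2)) t := by
    intro t ht
    have h1 : HasDerivAt (fun t : ℝ => x + t • (y - x)) (y - x) t := by
      simpa using ((hasDerivAt_id t).smul_const (y - x)).const_add x
    have h2 := (hg _ (hmem t ht)).hasFDerivAt.comp_hasDerivAt t h1
    have h3 := (hasDerivAt_id t).mul_const (inner ℝ (grad x) (y - x))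
    have h4 := ((hasDerivAt_id t).pow 2).mul_const (L / 2 * ‖y - x‖ ^ 2)
    have := (h2.sub h3).sub h4
    simp only [InnerProductSpace.toDual_apply_apply] at this
    exact this.congr_deriv (by simp)
  have hanti : AntitoneOn φ (Set.Icc 0 1) := by
    refine antitoneOn_of_deriv_nonpos (convex_Icc 0 1)
      (fun t ht => (hd t ht).continuousAt.continuousWithinAt) ?_ ?_
    · intro t ht
      exact (hd t (interior_subset ht)).differentiableAt.differentiableWithinAt
    · intro t ht
      have ht' := interior_subset ht
      rw [(hd t ht').deriv, ← inner_sub_left]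
      have h1 := hL _ (hmem t ht') _ hx
      have h2 := real_inner_le_norm (grad (x + t • (y - x)) - grad x) (y - x)
      have h3 : ‖x + t • (y - x) - x‖ = t * ‖y - x‖ := by
        rw [add_sub_cancel_left, norm_smul, Real.norm_of_nonneg ht'.1]
      rw [h3] at h1
      nlinarith [mul_le_mul_of_nonneg_right h1 (norm_nonneg (y - x))]
  have := hanti (Set.left_mem_Icc.2 zero_le_one) (Set.right_mem_Icc.2 zero_le_one) zero_le_one
  simp only [hφ, one_smul, add_sub_cancel, zero_smul, add_zero] at this
  linarith

theorem add_inner_sub_sq_le (hB : Convex ℝ B) (hg : ∀ x ∈ B, HasGradientAt h (grad x) x)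
    (hL : ∀ x ∈ B, ∀ y ∈ B, ‖grad x - grad y‖ ≤ L * ‖x - y‖) {x y : E} (hx : x ∈ B)
    (hy : y ∈ B) : h x + inner ℝ (grad x) (y - x) - L / 2 * ‖y - x‖ ^ 2 ≤ h y := by
  have hg' : ∀ x ∈ B, HasGradientAt (fun z => -h z) (-grad x) x := fun x hx => by
    rw [hasGradientAt_iff_hasFDerivAt, map_neg]
    exact (hg x hx).hasFDerivAt.neg
  have := le_add_inner_add_sq hB hg' (L := L) (fun a ha b hb => by
    rw [← norm_neg]; simpa [add_comm, sub_eq_add_neg] using hL a ha b hb) hx hy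
  rw [inner_neg_left] at this
  linarith

/-- One projected gradient step: the squared stationarity residual is controlled by the decrease
of the objective and the squared error of the stochastic gradient. -/
theorem sq_residual_le {ρ ℓ : ℝ} (hρ : 1 < ρ) (hℓ : 0 < ℓ) (hB : Convex ℝ B)
    (hg : ∀ x ∈ B, HasGradientAt h (grad x) x)
    (hL : ∀ x ∈ B, ∀ y ∈ B, ‖grad x - grad y‖ ≤ 2 * ℓ * ‖x - y‖) {x x' g : E} (hx : x ∈ B)
    (hx' : x' ∈ B)
    (hp : ‖x' - (x - (3 * ρ * ℓ)⁻¹ • g)‖ ≤ ‖x - (x - (3 * ρ * ℓ)⁻¹ • g)‖) :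
    ‖grad x' - g - (3 * ρ * ℓ) • (x' - x)‖ ^ 2
      ≤ (6 * ρ * ℓ + ℓ * (16 + 12 * ρ) / (3 * (ρ - 1))) * (h x - h x')
        + (2 + (8 + 6 * ρ) / (3 * (ρ - 1))) * ‖g - grad x‖ ^ 2 := by
  have hρ1 : 0 < ρ - 1 := by linarith
  have hs : 0 < 3 * ρ * ℓ := by positivity
  set s := 3 * ρ * ℓ with hsdef
  set δ := x' - x with hδ
  -- projection inequality
  have h1 : inner ℝ g δ + s / 2 * ‖δ‖ ^ 2 ≤ 0 := by
    have e1 : x' - (x - s⁻¹ • g) = δ + s⁻¹ • g := by rw [hδ]; abel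
    have e2 : x - (x - s⁻¹ • g) = s⁻¹ • g := by abel
    rw [e1, e2] at hp
    have h2 := pow_le_pow_left₀ (norm_nonneg _) hp 2
    rw [norm_add_sq_real, inner_smul_right, real_inner_comm] at h2
    have h3 : ‖δ‖ ^ 2 + 2 * (s⁻¹ * inner ℝ g δ) ≤ 0 := by linarith
    have h4 := mul_le_mul_of_nonneg_left h3 hs.le
    have h5 : s * (s⁻¹ * inner ℝ g δ) = inner ℝ g δ := by field_simp
    nlinarith
  have h2 := le_add_inner_add_sq hB hg hL hx hx'
  have h3 := add_inner_sub_sq_le hB hg hL hx' hx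
  have h4 : inner ℝ (grad x') (x - x') = -inner ℝ (grad x') δ := by
    rw [← inner_neg_right, hδ, neg_sub]
  have h5 : ‖x - x'‖ = ‖δ‖ := by rw [hδ, norm_sub_rev]
  rw [h4, h5] at h3
  rw [← hδ] at h2
  -- error term
  have h6 : -inner ℝ (g - grad x) δ ≤ ‖g - grad x‖ ^ 2 / (2 * ℓ) + ℓ / 2 * ‖δ‖ ^ 2 := by
    have := neg_le_of_abs_le (abs_real_inner_le_norm (g - grad x) δ)
    have h7 : ‖g - grad x‖ * ‖δ‖ ≤ ‖g - grad x‖ ^ 2 / (2 * ℓ) + ℓ / 2 * ‖δ‖ ^ 2 := by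
      have : 0 ≤ (‖g - grad x‖ - ℓ * ‖δ‖) ^ 2 / (2 * ℓ) := by positivity
      have e : (‖g - grad x‖ - ℓ * ‖δ‖) ^ 2 / (2 * ℓ) = ‖g - grad x‖ ^ 2 / (2 * ℓ)
        + ℓ / 2 * ‖δ‖ ^ 2 - ‖g - grad x‖ * ‖δ‖ := by field_simp; ring
      linarith
    linarith
  rw [inner_sub_left] at h6
  -- The coefficient is `s/2 - ℓ - ℓ/2` with `s = 3ρℓ`: projection gain, minus curvature, minus the
  -- share of Young's inequality. It is positive exactly because `ρ > 1`.
  have h8 : 3 * ℓ * (ρ - 1) / 2 * ‖δ‖ ^ 2 ≤ h x - h x' + ‖g - grad x‖ ^ 2 / (2 * ℓ) := by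
    rw [hsdef] at h1
    nlinarith
  -- residual
  have h9 : ‖grad x' - g - s • δ‖ ^ 2 = ‖grad x' - g‖ ^ 2 - 2 * s * inner ℝ (grad x') δ
      + 2 * s * inner ℝ g δ + s ^ 2 * ‖δ‖ ^ 2 := by
    rw [norm_sub_sq_real, inner_smul_right, inner_sub_left, norm_smul, mul_pow, Real.norm_eq_abs,
      sq_abs]
    ring
  have h10 : ‖grad x' - g‖ ^ 2 ≤ 2 * ‖g - grad x‖ ^ 2 + 8 * ℓ ^ 2 * ‖δ‖ ^ 2 := by
    have e : ‖grad x' - g‖ ≤ 2 * ℓ * ‖δ‖ + ‖g - grad x‖ := by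
      calc ‖grad x' - g‖ = ‖(grad x' - grad x) - (g - grad x)‖ := by congr 1; abel
        _ ≤ ‖grad x' - grad x‖ + ‖g - grad x‖ := norm_sub_le _ _
        _ ≤ _ := by gcongr; exact hL _ hx' _ hx
    have := pow_le_pow_left₀ (norm_nonneg _) e 2
    nlinarith [sq_nonneg (2 * ℓ * ‖δ‖ - ‖g - grad x‖)]
  -- By `h1`, the terms `2s⟪g, δ⟫ + s²‖δ‖²` of the expansion are nonpositive together. The lower
  -- quadratic bound `h3` at `x'` handles the remaining inner product.
  have h11 : ‖grad x' - g - s • δ‖ ^ 2 ≤ 2 * ‖g - grad x‖ ^ 2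
      + (8 + 6 * ρ) * ℓ ^ 2 * ‖δ‖ ^ 2 + 6 * ρ * ℓ * (h x - h x') := by
    have e3 := mul_le_mul_of_nonneg_left h3 (by positivity : 0 ≤ 2 * s)
    have e1 := mul_le_mul_of_nonneg_left h1 (by positivity : 0 ≤ 2 * s)
    have es : 2 * s = 6 * ρ * ℓ := by rw [hsdef]; ring
    have es2 : s * ℓ = 3 * ρ * ℓ ^ 2 := by rw [hsdef]; ring
    have es3 : s * ℓ * ‖δ‖ ^ 2 = 3 * ρ * ℓ ^ 2 * ‖δ‖ ^ 2 := by rw [es2]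
    rw [h9, ← es]
    nlinarith
  have h12 := mul_le_mul_of_nonneg_left h8
    (by positivity : 0 ≤ (8 + 6 * ρ) * ℓ * (2 / (3 * (ρ - 1))))
  have e1 : (8 + 6 * ρ) * ℓ * (2 / (3 * (ρ - 1))) * (3 * ℓ * (ρ - 1) / 2 * ‖δ‖ ^ 2)
      = (8 + 6 * ρ) * ℓ ^ 2 * ‖δ‖ ^ 2 := by field_simp
  have e2 : (8 + 6 * ρ) * ℓ * (2 / (3 * (ρ - 1))) * (h x - h x' + ‖g - grad x‖ ^ 2 / (2 * ℓ))
      = ℓ * (16 + 12 * ρ) / (3 * (ρ - 1)) * (h x - h x')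
        + (8 + 6 * ρ) / (3 * (ρ - 1)) * ‖g - grad x‖ ^ 2 := by field_simp; ring
  rw [e1, e2] at h12
  linarith

end Descent

/-! ### Normal cones -/

/-- The displacement from a nearest point is a proximal, hence a limiting, normal. -/
theorem smul_sub_mem_normalCone {d : ℕ} {X : Set (Vec d)} {x z : Vec d} (hz : z ∈ X)
    (hp : ∀ y ∈ X, ‖z - x‖ ≤ ‖y - x‖) {s : ℝ} (hs : 0 ≤ s) : s • (x - z) ∈ normalCone z X := by
  suffices h : s • (x - z) ∈ frechetNormalCone z X from
    ⟨hz, fun _ => z, fun _ => s • (x - z), tendsto_const_nhds, tendsto_const_nhds,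
      fun _ => ⟨hz, h⟩⟩
  refine ⟨hz, ?_⟩
  have hb : ∀ᶠ y in 𝓝[X \ {z}] z, inner ℝ (s • (x - z)) (y - z) / ‖y - z‖
      ≤ s / 2 * ‖y - z‖ := by
    filter_upwards [self_mem_nhdsWithin] with y hy
    have hne : 0 < ‖y - z‖ := norm_pos_iff.2 (sub_ne_zero.2 hy.2)
    rw [div_le_iff₀ hne, inner_smul_left]
    have h1 := pow_le_pow_left₀ (norm_nonneg _) (hp y hy.1) 2
    have e : y - x = (y - z) - (x - z) := by abel
    rw [e, norm_sub_sq_real (y - z), norm_sub_rev z x, real_inner_comm] at h1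
    simp only [conj_trivial]
    nlinarith
  have ht : Tendsto (fun y : Vec d => ((s / 2 * ‖y - z‖ : ℝ) : EReal)) (𝓝[X \ {z}] z)
      (𝓝 ((0 : ℝ) : EReal)) := by
    refine (continuous_coe_real_ereal.tendsto _).comp ?_
    have : Continuous (fun y : Vec d => s / 2 * ‖y - z‖) := by fun_prop
    have h := this.tendsto z
    simp only [sub_self, norm_zero, mul_zero] at h
    exact h.mono_left nhdsWithin_le_nhds
  -- At an isolated point the punctured filter is trivial and the extended-real limsup is `-∞`.
  rcases eq_or_neBot (𝓝[X \ {z}] z) with h0 | h0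
  · rw [h0]; simp
  · rw [← EReal.coe_zero, ← ht.limsup_eq]
    exact limsup_le_limsup (hb.mono fun y hy => EReal.coe_le_coe_iff.2 hy)

/-! ### Mini-batches -/

/-- In each coordinate the variance of a sum of `n` independent copies is `n` times that of one
copy, and a variance is at most the second moment. Summing the coordinates gives `q / n`. -/
theorem lintegral_sq_batch_sub_le {Z : Type*} [MeasurableSpace Z] {ν : Measure Z}
    [IsProbabilityMeasure ν] {d n : ℕ} {g : Z → Vec d} {m : Vec d} {q : ℝ} (hg : MemLp g 2 ν)
    (hm : ∫ z, g z ∂ν = m) (hq : ∫ z, ‖g z‖ ^ 2 ∂ν ≤ q) (hn : 0 < n) :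
    ∫⁻ z, ENNReal.ofReal (‖(n : ℝ)⁻¹ • ∑ i, g (z i) - m‖ ^ 2) ∂(Measure.pi fun _ : Fin n => ν)
      ≤ ENNReal.ofReal (q / n) := by
  set μ : Measure (Fin n → Z) := Measure.pi fun _ : Fin n => ν
  have hn0 : (n : ℝ) ≠ 0 := by positivity
  have hgj : ∀ j, MemLp (fun z => g z j) 2 ν := fun j =>
    hg.of_le ((EuclideanSpace.proj (𝕜 := ℝ) j).continuous.comp_aestronglyMeasurable hg.1)
      (Eventually.of_forall fun z => PiLp.norm_apply_le (g z) j)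
  have hmj : ∀ j, ∫ z, g z j ∂ν = m j := fun j => by
    rw [← hm]
    exact ((EuclideanSpace.proj (𝕜 := ℝ) j).integral_comp_comm (hg.integrable one_le_two))
  have hev : ∀ (j : Fin d) (i : Fin n), MemLp (fun z : Fin n → Z => g (z i) j) 2 μ := fun j i =>
    (hgj j).comp_measurePreserving (measurePreserving_eval (fun _ : Fin n => ν) i)
  have hY : ∀ j : Fin d, MemLp (∑ i, fun z : Fin n → Z => g (z i) j) 2 μ := fun j =>
    memLp_finsetSum' _ fun i _ => hev j i
  have hEY : ∀ j, ∫ z, (∑ i, fun z : Fin n → Z => g (z i) j) z ∂μ = n * m j := fun j => by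
    simp only [Finset.sum_apply]
    rw [integral_finsetSum _ fun i _ => (hev j i).integrable one_le_two]
    have : ∀ i : Fin n, ∫ z, g (z i) j ∂μ = m j := fun i => by
      rw [← hmj j]
      exact integral_comp_eval (μ := fun _ : Fin n => ν) (hgj j).1
    simp [this]
  have hVar : ∀ j, ∫ z, ((∑ i, fun z : Fin n → Z => g (z i) j) z - n * m j) ^ 2 ∂μ
      ≤ n * ∫ z, g z j ^ 2 ∂ν := fun j => by
    have h1 := ProbabilityTheory.variance_sum_pi (μ := fun _ : Fin n => ν)
      (X := fun _ z => g z j) (fun _ => hgj j)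
    rw [ProbabilityTheory.variance_eq_integral (hY j).1.aemeasurable, hEY j] at h1
    rw [h1, Finset.sum_const, Finset.card_univ, Fintype.card_fin, nsmul_eq_mul]
    gcongr
    exact ProbabilityTheory.variance_le_expectation_sq (hgj j).1
  have hpt : ∀ z : Fin n → Z, ‖(n : ℝ)⁻¹ • ∑ i, g (z i) - m‖ ^ 2
      = ∑ j, ((n : ℝ) ^ 2)⁻¹ * ((∑ i, fun z : Fin n → Z => g (z i) j) z - n * m j) ^ 2 := by
    intro z
    rw [EuclideanSpace.real_norm_sq_eq]
    refine Finset.sum_congr rfl fun j _ => ?_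
    simp only [PiLp.sub_apply, PiLp.smul_apply, WithLp.ofLp_sum, Finset.sum_apply, smul_eq_mul]
    field_simp
  have hint : ∀ j, Integrable (fun z => ((n : ℝ) ^ 2)⁻¹ *
      ((∑ i, fun z : Fin n → Z => g (z i) j) z - n * m j) ^ 2) μ := fun j =>
    (((hY j).sub (memLp_const (n * m j))).integrable_sq).const_mul _
  simp only [hpt]
  rw [← ofReal_integral_eq_lintegral_ofReal (integrable_finsetSum _ fun j _ => hint j)
    (Eventually.of_forall fun z => Finset.sum_nonneg fun j _ => by positivity)]
  refine ENNReal.ofReal_le_ofReal ?_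
  rw [integral_finsetSum _ fun j _ => hint j]
  have hsq : ∑ j, ∫ z, g z j ^ 2 ∂ν ≤ q := by
    rw [← integral_finsetSum _ fun j _ => (hgj j).integrable_sq]
    refine le_trans (le_of_eq ?_) hq
    congr with z
    rw [EuclideanSpace.real_norm_sq_eq]
  calc ∑ j, ∫ z, ((n : ℝ) ^ 2)⁻¹ * ((∑ i, fun z : Fin n → Z => g (z i) j) z - n * m j) ^ 2 ∂μ
      ≤ ∑ j, ((n : ℝ) ^ 2)⁻¹ * (n * ∫ z, g z j ^ 2 ∂ν) := by
        refine Finset.sum_le_sum fun j _ => ?_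
        rw [integral_const_mul]
        gcongr
        exact hVar j
    _ = (∑ j, ∫ z, g z j ^ 2 ∂ν) / n := by
        rw [← Finset.mul_sum, ← Finset.mul_sum]; field_simp
    _ ≤ q / n := by gcongr

/-! ### The projected stochastic gradient process of a measurable oracle -/

section Iteration

variable {Z : Type*} {d K M : ℕ}

/-- Mean of a batch of stochastic gradients. -/
def batchMean (g : Vec d → Z → Vec d) (w : Vec d) (z : Fin M → Z) : Vec d :=
  (M : ℝ)⁻¹ • ∑ i, g w (z i)

/-- The iterate after `n` steps (at most `K` steps are made). -/
def sgdPoint (g : Vec d → Z → Vec d) (proj : Vec d → Vec d) (η : ℝ) (x₁ : Vec d)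
    (z : Fin K → Fin M → Z) : ℕ → Vec d
  | 0 => x₁
  | n + 1 =>
      if h : n < K then
        proj (sgdPoint g proj η x₁ z n - η • batchMean g (sgdPoint g proj η x₁ z n) (z ⟨n, h⟩))
      else sgdPoint g proj η x₁ z n

/-- An element of `∇h(w) + N(w, X)` at the iterate `w` after `n + 1` steps. -/
def residual (g : Vec d → Z → Vec d) (grad proj : Vec d → Vec d) (η : ℝ) (x₁ : Vec d)
    (z : Fin K → Fin M → Z) (n : Fin K) : Vec d :=
  grad (sgdPoint g proj η x₁ z (n + 1)) - batchMean g (sgdPoint g proj η x₁ z n) (z n)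
    - η⁻¹ • (sgdPoint g proj η x₁ z (n + 1) - sgdPoint g proj η x₁ z n)

variable {g : Vec d → Z → Vec d} {grad proj : Vec d → Vec d} {η : ℝ} {x₁ : Vec d}

theorem sgdPoint_succ (z : Fin K → Fin M → Z) (n : Fin K) :
    sgdPoint g proj η x₁ z (n + 1)
      = proj (sgdPoint g proj η x₁ z n - η • batchMean g (sgdPoint g proj η x₁ z n) (z n)) := by
  rw [sgdPoint]; simp

theorem sgdPoint_mem {X : Set (Vec d)} (hx₁ : x₁ ∈ X) (hp : ∀ x, proj x ∈ X)
    (z : Fin K → Fin M → Z) (n : ℕ) : sgdPoint g proj η x₁ z n ∈ X := by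
  induction n with
  | zero => exact hx₁
  | succ n ih =>
    rw [sgdPoint]
    split_ifs
    · exact hp _
    · exact ih

/-- An iterate depends only on the batches already consumed. Together with resampling of batch `k`,
this expresses its independence from the current iterate. -/
theorem sgdPoint_update (z : Fin K → Fin M → Z) (k : Fin K) (y : Fin M → Z) {n : ℕ}
    (hn : n ≤ k) :
    sgdPoint g proj η x₁ (Function.update z k y) n = sgdPoint g proj η x₁ z n := by
  induction n with
  | zero => rfl
  | succ n ih =>
    rw [sgdPoint, sgdPoint, ih (by omega)]
    split_ifs with h
    · rw [Function.update_of_ne]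
      intro e
      have := congrArg Fin.val e
      simp only at this
      omega
    · rfl

variable [MeasurableSpace Z]

theorem measurable_batchMean (hg : Measurable (Function.uncurry g)) :
    Measurable (fun q : Vec d × (Fin M → Z) => batchMean g q.1 q.2) := by
  unfold batchMean
  have h : ∀ i, Measurable (fun q : Vec d × (Fin M → Z) => g q.1 (q.2 i)) := fun i =>
    hg.comp (measurable_fst.prodMk ((measurable_pi_apply i).comp measurable_snd))
  fun_prop

theorem measurable_sgdPoint (hg : Measurable (Function.uncurry g)) (hp : Measurable proj)
    (n : ℕ) : Measurable (fun z : Fin K → Fin M → Z => sgdPoint g proj η x₁ z n) := by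
  induction n with
  | zero => exact measurable_const
  | succ n ih =>
    simp only [sgdPoint]
    split_ifs with h
    · have hb : Measurable (fun z : Fin K → Fin M → Z =>
          batchMean g (sgdPoint g proj η x₁ z n) (z ⟨n, h⟩)) :=
        (measurable_batchMean hg).comp (ih.prodMk (measurable_pi_apply _))
      fun_prop
    · exact ih

theorem measurable_residual (hg : Measurable (Function.uncurry g)) (hgrad : Measurable grad)
    (hp : Measurable proj) (n : Fin K) :
    Measurable (fun z : Fin K → Fin M → Z => residual g grad proj η x₁ z n) := by
  have h1 := measurable_sgdPoint (K := K) (M := M) (η := η) (x₁ := x₁) hg hp (n + 1)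
  have h0 := measurable_sgdPoint (K := K) (M := M) (η := η) (x₁ := x₁) hg hp n
  have hb : Measurable (fun z : Fin K → Fin M → Z =>
      batchMean g (sgdPoint g proj η x₁ z n) (z n)) :=
    (measurable_batchMean hg).comp (h0.prodMk (measurable_pi_apply n))
  unfold residual
  fun_prop

/-- `g` is an unbiased oracle on `B`, with second moment at most `q`, for the gradient of a
function `h` whose gradient is `2ℓ`-Lipschitz. -/
structure IsGradientModel (ν : Measure Z) (B : Set (Vec d)) (h : Vec d → ℝ)
    (g : Vec d → Z → Vec d) (grad : Vec d → Vec d) (ℓ q : ℝ) : Prop where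
  measurable_oracle : Measurable (Function.uncurry g)
  hasGradientAt : ∀ w ∈ B, HasGradientAt h (grad w) w
  lipschitz : ∀ x y, ‖grad x - grad y‖ ≤ 2 * ℓ * ‖x - y‖
  memLp : ∀ w ∈ B, MemLp (g w) 2 ν
  integral_eq : ∀ w ∈ B, ∫ z, g w z ∂ν = grad w
  sq_le : ∀ w ∈ B, ∫ z, ‖g w z‖ ^ 2 ∂ν ≤ q

variable {ν : Measure Z} {B : Set (Vec d)} {h : Vec d → ℝ} {ℓ q : ℝ}

theorem IsGradientModel.continuous_grad (H : IsGradientModel ν B h g grad ℓ q) :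
    Continuous grad := by
  have : LipschitzWith (2 * ℓ).toNNReal grad := LipschitzWith.of_dist_le_mul fun x y => by
    rw [dist_eq_norm, dist_eq_norm]
    exact (H.lipschitz x y).trans (by gcongr; exact Real.le_coe_toNNReal _)
  exact this.continuous

theorem IsGradientModel.lintegral_sq_batchMean_sub_le [IsProbabilityMeasure ν]
    (H : IsGradientModel ν B h g grad ℓ q) (hM : 0 < M) {w : Vec d} (hw : w ∈ B) :
    ∫⁻ z, ENNReal.ofReal (‖batchMean g w z - grad w‖ ^ 2) ∂(Measure.pi fun _ : Fin M => ν)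
      ≤ ENNReal.ofReal (q / M) :=
  lintegral_sq_batch_sub_le (H.memLp w hw) (H.integral_eq w hw) (H.sq_le w hw) hM

theorem IsGradientModel.measurable_sgdError (H : IsGradientModel ν B h g grad ℓ q)
    (hpm : Measurable proj) (n : Fin K) :
    Measurable (fun z : Fin K → Fin M → Z => ENNReal.ofReal
      (‖batchMean g (sgdPoint g proj η x₁ z n) (z n) - grad (sgdPoint g proj η x₁ z n)‖ ^ 2)) := by
  have h0 := measurable_sgdPoint (K := K) (M := M) (η := η) (x₁ := x₁) H.measurable_oracle hpm n
  have hb : Measurable (fun z : Fin K → Fin M → Z =>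
      batchMean g (sgdPoint g proj η x₁ z n) (z n)) :=
    (measurable_batchMean H.measurable_oracle).comp (h0.prodMk (measurable_pi_apply n))
  have hc := H.continuous_grad.measurable.comp h0
  exact ((hb.sub hc).norm.pow_const 2).ennreal_ofReal

/-- Resampling batch `n` leaves the `n`-th iterate unchanged, so the inner integral is the batch
error at a fixed point of `B`. -/
theorem IsGradientModel.lintegral_sq_error_le [IsProbabilityMeasure ν]
    (H : IsGradientModel ν B h g grad ℓ q) (hM : 0 < M) (hx₁ : x₁ ∈ B) (hp : ∀ x, proj x ∈ B)
    (hpm : Measurable proj) (n : Fin K) :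
    ∫⁻ z : Fin K → Fin M → Z, ENNReal.ofReal
        (‖batchMean g (sgdPoint g proj η x₁ z n) (z n) - grad (sgdPoint g proj η x₁ z n)‖ ^ 2)
        ∂(Measure.pi fun _ : Fin K => Measure.pi fun _ : Fin M => ν)
      ≤ ENNReal.ofReal (q / M) := by
  rw [lintegral_pi_eq_lintegral_update (fun _ : Fin K => Measure.pi fun _ : Fin M => ν) n
    (H.measurable_sgdError hpm n)]
  refine (lintegral_mono (g := fun _ => ENNReal.ofReal (q / M)) fun z => ?_).trans (by simp)
  simp only [sgdPoint_update z n _ le_rfl, Function.update_self]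
  exact H.lintegral_sq_batchMean_sub_le hM (sgdPoint_mem hx₁ hp z n)

variable {X : Set (Vec d)} {ρ Δ : ℝ}

/-- A pathwise bound: the one-step decreases telescope and their sum is at most `Δ`. Randomness
enters only through the error terms. -/
theorem IsGradientModel.sum_sq_residual_le (H : IsGradientModel ν B h g grad ℓ q)
    (hB : Convex ℝ B) (hXB : X ⊆ B) (hx₁ : x₁ ∈ X)
    (hp : ∀ x, proj x ∈ X ∧ ∀ y ∈ X, ‖proj x - x‖ ≤ ‖y - x‖) (hρ : 1 < ρ) (hℓ : 0 < ℓ)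
    (hη : η = (3 * ρ * ℓ)⁻¹) (hΔ : ∀ w ∈ X, h x₁ - h w ≤ Δ) (z : Fin K → Fin M → Z) :
    ∑ n : Fin K, ‖residual g grad proj η x₁ z n‖ ^ 2
      ≤ (6 * ρ * ℓ + ℓ * (16 + 12 * ρ) / (3 * (ρ - 1))) * Δ
        + (2 + (8 + 6 * ρ) / (3 * (ρ - 1))) * ∑ n : Fin K,
          ‖batchMean g (sgdPoint g proj η x₁ z n) (z n)
            - grad (sgdPoint g proj η x₁ z n)‖ ^ 2 := by
  have hmem := sgdPoint_mem (g := g) (η := η) hx₁ (fun x => (hp x).1) z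
  have hρ1 : 0 < ρ - 1 := by linarith
  have hstep : ∀ n : Fin K, ‖residual g grad proj η x₁ z n‖ ^ 2
      ≤ (6 * ρ * ℓ + ℓ * (16 + 12 * ρ) / (3 * (ρ - 1))) *
        (h (sgdPoint g proj η x₁ z n) - h (sgdPoint g proj η x₁ z (n + 1)))
        + (2 + (8 + 6 * ρ) / (3 * (ρ - 1))) * ‖batchMean g (sgdPoint g proj η x₁ z n) (z n)
            - grad (sgdPoint g proj η x₁ z n)‖ ^ 2 := by
    intro n
    have := sq_residual_le (g := batchMean g (sgdPoint g proj η x₁ z n) (z n)) hρ hℓ hB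
      H.hasGradientAt (fun x _ y _ => H.lipschitz x y)
      (hXB (hmem n)) (hXB (hmem (n + 1))) (by
        rw [← hη, sgdPoint_succ]
        exact (hp _).2 _ (hmem n))
    rwa [residual, hη, inv_inv, ← hη]
  refine (Finset.sum_le_sum fun n _ => hstep n).trans ?_
  rw [Finset.sum_add_distrib, ← Finset.mul_sum, ← Finset.mul_sum,
    Fin.sum_univ_eq_sum_range (fun n => h (sgdPoint g proj η x₁ z n)
      - h (sgdPoint g proj η x₁ z (n + 1))) K, Finset.sum_range_sub']
  gcongr
  exact hΔ _ (hmem K)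

theorem IsGradientModel.sum_lintegral_sq_residual_le [IsProbabilityMeasure ν]
    (H : IsGradientModel ν B h g grad ℓ q)
    (hB : Convex ℝ B) (hXB : X ⊆ B) (hx₁ : x₁ ∈ X)
    (hp : ∀ x, proj x ∈ X ∧ ∀ y ∈ X, ‖proj x - x‖ ≤ ‖y - x‖) (hpm : Measurable proj)
    (hρ : 1 < ρ) (hℓ : 0 < ℓ) (hq : 0 ≤ q) (hM : 0 < M)
    (hη : η = (3 * ρ * ℓ)⁻¹) (hΔ : ∀ w ∈ X, h x₁ - h w ≤ Δ) :
    ∑ n : Fin K, ∫⁻ z : Fin K → Fin M → Z, ENNReal.ofReal (‖residual g grad proj η x₁ z n‖ ^ 2)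
        ∂(Measure.pi fun _ : Fin K => Measure.pi fun _ : Fin M => ν)
      ≤ ENNReal.ofReal ((6 * ρ * ℓ + ℓ * (16 + 12 * ρ) / (3 * (ρ - 1))) * Δ
        + (2 + (8 + 6 * ρ) / (3 * (ρ - 1))) * (K * (q / M))) := by
  have hρ1 : 0 < ρ - 1 := by linarith
  have hΔ0 : 0 ≤ Δ := by simpa using hΔ x₁ hx₁
  have hb : 0 ≤ 2 + (8 + 6 * ρ) / (3 * (ρ - 1)) := by positivity
  set A := (6 * ρ * ℓ + ℓ * (16 + 12 * ρ) / (3 * (ρ - 1))) * Δ with hA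
  have hA0 : 0 ≤ A := by positivity
  set b := 2 + (8 + 6 * ρ) / (3 * (ρ - 1)) with hbdef
  set μ : Measure (Fin K → Fin M → Z) := Measure.pi fun _ : Fin K => Measure.pi fun _ : Fin M => ν
    with hμ
  have : IsProbabilityMeasure μ := by rw [hμ]; infer_instance
  let e : Fin K → (Fin K → Fin M → Z) → ℝ := fun n z =>
    ‖batchMean g (sgdPoint g proj η x₁ z n) (z n) - grad (sgdPoint g proj η x₁ z n)‖ ^ 2
  have he0 : ∀ n z, 0 ≤ e n z := fun n z => by positivity
  have hme : ∀ n, Measurable fun z => ENNReal.ofReal (e n z) := fun n =>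
    H.measurable_sgdError hpm n
  have hmr : ∀ n : Fin K, Measurable fun z : Fin K → Fin M → Z =>
      ENNReal.ofReal (‖residual g grad proj η x₁ z n‖ ^ 2) := fun n =>
    ((measurable_residual H.measurable_oracle
      H.continuous_grad.measurable hpm n).norm.pow_const 2).ennreal_ofReal
  have hpt : ∀ z : Fin K → Fin M → Z,
      ∑ n : Fin K, ENNReal.ofReal (‖residual g grad proj η x₁ z n‖ ^ 2)
        ≤ ENNReal.ofReal A + ENNReal.ofReal b * ∑ n : Fin K, ENNReal.ofReal (e n z) := fun z => by
    rw [← ENNReal.ofReal_sum_of_nonneg fun _ _ => by positivity,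
      ← ENNReal.ofReal_sum_of_nonneg fun _ _ => he0 _ _, ← ENNReal.ofReal_mul hb,
      ← ENNReal.ofReal_add hA0 (mul_nonneg hb (Finset.sum_nonneg fun _ _ => he0 _ _))]
    exact ENNReal.ofReal_le_ofReal (H.sum_sq_residual_le hB hXB hx₁ hp hρ hℓ hη hΔ z)
  have hE : ∀ n, ∫⁻ z, ENNReal.ofReal (e n z) ∂μ ≤ ENNReal.ofReal (q / M) := fun n =>
    H.lintegral_sq_error_le hM (hXB hx₁) (fun x => hXB (hp x).1) hpm n
  rw [← lintegral_finsetSum _ fun n _ => hmr n]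
  refine (lintegral_mono hpt).trans ?_
  rw [lintegral_add_left measurable_const, lintegral_const_mul _
    (Finset.measurable_sum _ fun n _ => hme n), lintegral_finsetSum _ fun n _ => hme n]
  have hqM : 0 ≤ q / M := by positivity
  rw [ENNReal.ofReal_add hA0 (by positivity), ENNReal.ofReal_mul hb,
    ENNReal.ofReal_mul (p := (K : ℝ)) (by positivity), ENNReal.ofReal_natCast]
  simp only [lintegral_const, measure_univ, mul_one]
  gcongr
  exact (Finset.sum_le_sum fun n _ => hE n).trans (by simp)

end Iteration

/-! ### A uniformly chosen index -/

/-- The shift by `2` matches the indexing of residuals: index `R` means `R - 1` steps, the last of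
which has number `R - 2` when counted from zero. -/
theorem lintegral_uniformOn_Icc (K : ℕ) (φ : ℕ → ℝ≥0∞) :
    ∫⁻ R, φ R ∂(ProbabilityTheory.uniformOn (Set.Icc 2 (K + 1)))
      = (K : ℝ≥0∞)⁻¹ * ∑ n : Fin K, φ (n + 2) := by
  have hs : (Set.Icc 2 (K + 1) : Set ℕ) = ((Finset.Icc 2 (K + 1) : Finset ℕ) : Set ℕ) := by simp
  rw [ProbabilityTheory.uniformOn, ProbabilityTheory.cond, lintegral_smul_measure, hs,
    lintegral_finset, Measure.count_apply_finset]
  simp only [Measure.count_singleton, mul_one, smul_eq_mul, Nat.card_Icc]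
  congr 1
  rw [Fin.sum_univ_eq_sum_range (fun n => φ (n + 2)) K, Finset.range_eq_Ico,
    Finset.sum_Ico_add' (fun n => φ n) 0 K 2]
  congr 1

/-! ### Selecting the best of several runs -/

/-- Independence of the runs turns the Markov bound into its `r`-th power. The errors share one
selection sample, so they get only a union bound; for each of them, Fubini applies because the
sample is independent of the candidate. -/
theorem measure_all_lt_or_exists_lt_le {Ω Z : Type*} [MeasurableSpace Ω] [MeasurableSpace Z]
    {μ : Measure Ω} [IsProbabilityMeasure μ] {ν : Measure Z} [IsProbabilityMeasure ν] {r : ℕ}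
    {D : Ω → ℝ≥0∞} (hD : Measurable D) {err : Ω × Z → ℝ≥0∞} (herr : Measurable err)
    {a b s t : ℝ≥0∞} (ha : ∫⁻ ω, D ω ∂μ ≤ a) (hb : ∀ ω, ∫⁻ z, err (ω, z) ∂ν ≤ b)
    (ht : t ≠ 0) (ht' : t ≠ ∞) (hs : s ≠ 0) (hs' : s ≠ ∞) :
    ((Measure.pi fun _ : Fin r => μ).prod ν)
        {p | (∀ j, t < D (p.1 j)) ∨ ∃ j, s < err (p.1 j, p.2)}
      ≤ (a / t) ^ r + r * (b / s) := by
  have h1 : μ {ω | t < D ω} ≤ a / t :=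
    (measure_mono fun ω (h : t < D ω) => h.le).trans
      ((meas_ge_le_lintegral_div hD.aemeasurable ht ht').trans (by gcongr))
  have hset : {p : (Fin r → Ω) × Z | (∀ j, t < D (p.1 j)) ∨ ∃ j, s < err (p.1 j, p.2)}
      = ((Set.univ.pi fun _ : Fin r => {ω | t < D ω}) ×ˢ Set.univ)
        ∪ ⋃ j, {p | s < err (p.1 j, p.2)} := by
    ext p; simp
  rw [hset]
  refine (measure_union_le _ _).trans (add_le_add ?_ ?_)
  · rw [Measure.prod_prod, Measure.pi_pi, measure_univ, mul_one]
    simp only [Finset.prod_const, Finset.card_univ, Fintype.card_fin]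
    gcongr
  · refine (measure_iUnion_fintype_le _ _).trans ?_
    have : ∀ j : Fin r, ((Measure.pi fun _ : Fin r => μ).prod ν)
        {p | s < err (p.1 j, p.2)} ≤ b / s := by
      intro j
      have hm : Measurable (fun p : (Fin r → Ω) × Z => err (p.1 j, p.2)) := by fun_prop
      refine (measure_mono fun (p : (Fin r → Ω) × Z) (h : s < err (p.1 j, p.2)) => h.le).trans
        ((meas_ge_le_lintegral_div hm.aemeasurable hs hs').trans ?_)
      gcongr
      rw [lintegral_prod _ hm.aemeasurable]
      exact (lintegral_mono (g := fun _ => b) fun ω : Fin r → Ω => hb (ω j)).trans (by simp)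
    exact (Finset.sum_le_sum fun j _ => this j).trans (by simp)

/-! ### Boxes -/

section Cube

variable {d : ℕ}

theorem mem_cube_iff {r : ℝ≥0∞} (hr : r ≠ ∞) {x : Vec d} :
    x ∈ cube d r ↔ ∀ i, |x i| ≤ r.toReal := by
  simp only [cube, Set.mem_ofPred_eq, ENNReal.ofReal_le_iff_le_toReal hr]

theorem mem_cube_ofReal_iff {a : ℝ} (ha : 0 ≤ a) {x : Vec d} :
    x ∈ cube d (ENNReal.ofReal a) ↔ ∀ i, |x i| ≤ a := by
  rw [mem_cube_iff ENNReal.ofReal_ne_top, ENNReal.toReal_ofReal ha]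

theorem cube_top : cube d ∞ = Set.univ := by ext; simp [cube]

theorem convex_cube (r : ℝ≥0∞) : Convex ℝ (cube d r) := by
  by_cases hr : r = ∞
  · rw [hr, cube_top]; exact convex_univ
  · intro x hx y hy a b ha hb hab
    rw [mem_cube_iff hr] at *
    intro i
    simp only [PiLp.add_apply, PiLp.smul_apply, smul_eq_mul]
    calc |a * x i + b * y i| ≤ |a * x i| + |b * y i| := abs_add_le _ _
      _ = a * |x i| + b * |y i| := by rw [abs_mul, abs_mul, abs_of_nonneg ha, abs_of_nonneg hb]
      _ ≤ a * r.toReal + b * r.toReal := by gcongr <;> simp_all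
      _ = r.toReal := by rw [← add_mul, hab, one_mul]

theorem measurableSet_cube (r : ℝ≥0∞) : MeasurableSet (cube d r) := by
  have : cube d r = ⋂ i, {x : Vec d | ENNReal.ofReal |x i| ≤ r} := by ext; simp [cube]
  rw [this]
  exact MeasurableSet.iInter fun i => measurableSet_le (by fun_prop) measurable_const

theorem add_mem_cube {r s : ℝ≥0∞} {x y : Vec d} (hx : x ∈ cube d r) (hy : y ∈ cube d s) :
    x + y ∈ cube d (r + s) := fun i =>
  (ENNReal.ofReal_le_ofReal (abs_add_le (x i) (y i))).trans
    ((ENNReal.ofReal_add_le).trans (add_le_add (hx i) (hy i)))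

theorem cube_mono {r s : ℝ≥0∞} (h : r ≤ s) : cube d r ⊆ cube d s := fun _ hx i => (hx i).trans h

theorem norm_le_of_mem_cube {a : ℝ} (ha : 0 ≤ a) {x : Vec d}
    (hx : x ∈ cube d (ENNReal.ofReal a)) : ‖x‖ ≤ √(d : ℝ) * a := by
  rw [mem_cube_ofReal_iff ha] at hx
  rw [EuclideanSpace.norm_eq, ← Real.sqrt_sq ha, ← Real.sqrt_mul (Nat.cast_nonneg d)]
  refine Real.sqrt_le_sqrt ?_
  calc ∑ i, ‖x i‖ ^ 2 ≤ ∑ _i : Fin d, a ^ 2 :=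
        Finset.sum_le_sum fun i _ => pow_le_pow_left₀ (norm_nonneg _) (hx i) 2
    _ = d * a ^ 2 := by simp

/-- A smaller box lies in the interior of a larger one. -/
theorem cube_mem_nhds {r s : ℝ≥0∞} (h : r < s) {x : Vec d} (hx : x ∈ cube d r) :
    cube d s ∈ 𝓝 x := by
  have : ∀ i, ∀ᶠ y : Vec d in 𝓝 x, ENNReal.ofReal |y i| < s := fun i => by
    have hc : Continuous fun y : Vec d => ENNReal.ofReal |y i| :=
      ENNReal.continuous_ofReal.comp (by fun_prop)
    exact hc.continuousAt.eventually_lt continuousAt_const ((hx i).trans_lt h)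
  filter_upwards [eventually_all.2 this] with y hy i using (hy i).le

/-- The nearest-point map onto a box. -/
def clamp (r : ℝ≥0∞) (x : Vec d) : Vec d :=
  if r = ∞ then x else WithLp.toLp 2 fun i => max (-r.toReal) (min r.toReal (x i))

theorem clamp_mem (r : ℝ≥0∞) (x : Vec d) : clamp r x ∈ cube d r := by
  by_cases hr : r = ∞
  · rw [hr, cube_top]; trivial
  · rw [mem_cube_iff hr]
    intro i
    have := ENNReal.toReal_nonneg (a := r)
    simp only [clamp, hr, if_false]
    rw [abs_le]
    exact ⟨le_max_left _ _, max_le (by linarith) (min_le_left _ _)⟩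

theorem clamp_of_mem {r : ℝ≥0∞} {x : Vec d} (hx : x ∈ cube d r) : clamp r x = x := by
  by_cases hr : r = ∞
  · simp [clamp, hr]
  · rw [mem_cube_iff hr] at hx
    ext i
    simp only [clamp, hr, if_false]
    rw [min_eq_right (abs_le.1 (hx i)).2, max_eq_right (abs_le.1 (hx i)).1]

theorem norm_clamp_sub_le (r : ℝ≥0∞) (x y : Vec d) : ‖clamp r x - clamp r y‖ ≤ ‖x - y‖ := by
  by_cases hr : r = ∞
  · simp [clamp, hr]
  · rw [EuclideanSpace.norm_eq, EuclideanSpace.norm_eq]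
    refine Real.sqrt_le_sqrt (Finset.sum_le_sum fun i _ =>
      pow_le_pow_left₀ (norm_nonneg _) ?_ 2)
    simp only [clamp, hr, if_false, PiLp.sub_apply, Real.norm_eq_abs]
    refine (abs_max_sub_max_le_max _ _ _ _).trans ?_
    rw [sub_self, abs_zero]
    refine max_le (abs_nonneg _) ((abs_min_sub_min_le_max _ _ _ _).trans ?_)
    simp

theorem measurable_clamp (r : ℝ≥0∞) : Measurable (clamp r : Vec d → Vec d) := by
  have : LipschitzWith 1 (clamp r : Vec d → Vec d) := LipschitzWith.of_dist_le_mul fun x y => by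
    simpa [dist_eq_norm] using norm_clamp_sub_le r x y
  exact this.continuous.measurable

end Cube

/-! ### The uniform law on a box -/

section Unif

variable {d : ℕ} {α : ℝ}

/-- The uniform law on `[-α/2, α/2]`. -/
def unifInterval (α : ℝ) : Measure ℝ := ProbabilityTheory.cond volume (Set.Icc (-(α / 2)) (α / 2))

theorem isProbabilityMeasure_unifInterval (hα : 0 < α) :
    IsProbabilityMeasure (unifInterval α) := by
  refine ProbabilityTheory.cond_isProbabilityMeasure_of_finite ?_ ?_
  · rw [Real.volume_Icc]; simp; linarith
  · rw [Real.volume_Icc]; exact ENNReal.ofReal_ne_top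

theorem integral_unifInterval (hα : 0 < α) (φ : ℝ → ℝ) :
    ∫ s, φ s ∂(unifInterval α) = α⁻¹ * ∫ s in (-(α / 2))..(α / 2), φ s := by
  rw [unifInterval, ProbabilityTheory.cond, integral_smul_measure, Real.volume_Icc,
    intervalIntegral.integral_of_le (by linarith), integral_Icc_eq_integral_Ioc]
  rw [ENNReal.toReal_inv, ENNReal.toReal_ofReal (by linarith), smul_eq_mul]
  congr 2
  ring

/-- The product form makes the coordinates independent, so that one of them can be integrated out
separately. -/
theorem unifCube_eq_map (hα : 0 < α) :
    unifCube d α = (Measure.pi fun _ : Fin d => unifInterval α).map (WithLp.toLp 2) := by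
  have := isProbabilityMeasure_unifInterval hα
  have hm : Measurable (WithLp.ofLp : Vec d → (Fin d → ℝ)) := by fun_prop
  have hm' : Measurable (WithLp.toLp 2 : (Fin d → ℝ) → Vec d) := by fun_prop
  have hvol : ∀ s : Set (Fin d → ℝ), MeasurableSet s →
      volume ((WithLp.ofLp : Vec d → (Fin d → ℝ)) ⁻¹' s) = volume s := fun s hs =>
    (PiLp.volume_preserving_ofLp (Fin d)).measure_preimage hs.nullMeasurableSet
  have hC : cube d (ENNReal.ofReal (α / 2))
      = (WithLp.ofLp : Vec d → (Fin d → ℝ)) ⁻¹'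
        (Set.univ.pi fun _ => Set.Icc (-(α / 2)) (α / 2)) := by
    ext x
    rw [mem_cube_ofReal_iff (by linarith)]
    simp only [abs_le, Set.mem_preimage, Set.mem_pi, Set.mem_univ, true_implies, Set.mem_Icc]
  have key : (Measure.pi fun _ : Fin d => unifInterval α) = (unifCube d α).map WithLp.ofLp := by
    refine Measure.pi_eq fun s hs => ?_
    rw [Measure.map_apply hm (MeasurableSet.univ_pi hs), unifCube,
      ProbabilityTheory.cond_apply (measurableSet_cube _), hC, ← Set.preimage_inter,
      hvol _ (MeasurableSet.univ_pi fun _ => measurableSet_Icc),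
      hvol _ ((MeasurableSet.univ_pi fun _ => measurableSet_Icc).inter (MeasurableSet.univ_pi hs)),
      ← Set.pi_inter_distrib, volume_pi_pi, volume_pi_pi]
    simp only [unifInterval, ProbabilityTheory.cond_apply measurableSet_Icc, Finset.prod_mul_distrib]
    congr 1
    simp [ENNReal.inv_pow]
  rw [key, Measure.map_map hm' hm]
  exact Measure.map_id.symm

theorem isProbabilityMeasure_unifCube (hα : 0 < α) : IsProbabilityMeasure (unifCube d α) := by
  have := isProbabilityMeasure_unifInterval hα
  rw [unifCube_eq_map hα]
  exact Measure.isProbabilityMeasure_map (by fun_prop)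

theorem ae_mem_cube_unifCube (d : ℕ) (α : ℝ) :
    ∀ᵐ u ∂(unifCube d α), u ∈ cube d (ENNReal.ofReal (α / 2)) :=
  ProbabilityTheory.ae_cond_mem (measurableSet_cube _)

theorem unifCube_absolutelyContinuous (d : ℕ) (α : ℝ) : unifCube d α ≪ volume :=
  ProbabilityTheory.cond_absolutelyContinuous

theorem integral_sq_coord_unifCube (hα : 0 < α) (i : Fin d) :
    ∫ u, u i ^ 2 ∂(unifCube d α) = α ^ 2 / 12 := by
  have := isProbabilityMeasure_unifInterval hα
  rw [unifCube_eq_map hα, integral_map (by fun_prop)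
    (by exact (Continuous.aestronglyMeasurable (by fun_prop)))]
  have h := integral_comp_eval (μ := fun _ : Fin d => unifInterval α) (i := i)
    (f := fun s : ℝ => s ^ 2) (by fun_prop)
  simp only [h, integral_unifInterval hα, integral_pow]
  field_simp
  ring

/-- Nonnegativity of the variance bounds the mean norm by the root of the mean square, and each
coordinate contributes `α² / 12`. -/
theorem integral_norm_unifCube_le (hα : 0 < α) :
    ∫ u, ‖u‖ ∂(unifCube d α) ≤ α * √((d : ℝ) / 12) := by
  have := isProbabilityMeasure_unifCube (d := d) hα
  have hb : MemLp (fun u : Vec d => ‖u‖) 2 (unifCube d α) := by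
    refine MemLp.of_bound (by fun_prop) (√(d : ℝ) * (α / 2)) ?_
    filter_upwards [ae_mem_cube_unifCube d α] with u hu
    simpa using norm_le_of_mem_cube (by linarith) hu
  have h1 : (∫ u, ‖u‖ ∂(unifCube d α)) ^ 2 ≤ ∫ u, ‖u‖ ^ 2 ∂(unifCube d α) := by
    have := ProbabilityTheory.variance_nonneg (fun u : Vec d => ‖u‖) (unifCube d α)
    rw [ProbabilityTheory.variance_eq_sub hb] at this
    simpa using this
  have hbi : ∀ i : Fin d, Integrable (fun u : Vec d => u i ^ 2) (unifCube d α) := fun i => by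
    refine Integrable.of_bound (by fun_prop) ((α / 2) ^ 2) ?_
    filter_upwards [ae_mem_cube_unifCube d α] with u hu
    rw [mem_cube_ofReal_iff (by linarith)] at hu
    rw [norm_pow]
    exact pow_le_pow_left₀ (norm_nonneg _) (hu i) 2
  have h2 : ∫ u, ‖u‖ ^ 2 ∂(unifCube d α) = d * (α ^ 2 / 12) := by
    simp only [EuclideanSpace.real_norm_sq_eq]
    rw [integral_finsetSum _ fun i _ => hbi i]
    simp [integral_sq_coord_unifCube hα]
  rw [h2] at h1
  refine (Real.le_sqrt_of_sq_le h1).trans (le_of_eq ?_)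
  rw [show (d : ℝ) * (α ^ 2 / 12) = α ^ 2 * (d / 12) by ring, Real.sqrt_mul (sq_nonneg _),
    Real.sqrt_sq hα.le]

end Unif

/-! ### Smoothing of a Lipschitz function -/

section Smoothing

variable {d : ℕ}

/-- `w + u` with its `i`-th coordinate replaced by `w i + s`. -/
def replaceCoord (w u : Vec d) (i : Fin d) (s : ℝ) : Vec d :=
  WithLp.toLp 2 (Function.update (fun j => w j + u j) i (w i + s))

theorem replaceCoord_eq_add (w u : Vec d) (i : Fin d) (s : ℝ) :
    replaceCoord w u i s = w + WithLp.toLp 2 (Function.update u.ofLp i s) := by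
  ext j
  by_cases h : j = i
  · subst h; simp [replaceCoord]
  · simp [replaceCoord, h]

theorem replaceCoord_sub_replaceCoord (w u : Vec d) (i : Fin d) (s t : ℝ) :
    replaceCoord w u i s - replaceCoord w u i t = EuclideanSpace.single i (s - t) := by
  ext j
  by_cases h : j = i
  · subst h; simp [replaceCoord]
  · simp [replaceCoord, h]

theorem norm_replaceCoord_sub (w u : Vec d) (i : Fin d) (s t : ℝ) :
    ‖replaceCoord w u i s - replaceCoord w u i t‖ = |s - t| := by
  rw [replaceCoord_sub_replaceCoord]; simp

theorem replaceCoord_sub_left (w w' u : Vec d) (i : Fin d) (s : ℝ) :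
    replaceCoord w u i s - replaceCoord w' u i s = w - w' := by
  simp [replaceCoord_eq_add]

theorem continuous_replaceCoord (i : Fin d) :
    Continuous fun q : (Vec d × Vec d) × ℝ => replaceCoord q.1.1 q.1.2 i q.2 := by
  unfold replaceCoord
  refine (PiLp.continuous_toLp 2 _).comp (Continuous.update ?_ i ?_) <;> fun_prop

theorem replaceCoord_mem_cube {r : ℝ≥0∞} {α : ℝ} (hα : 0 < α) {w u : Vec d} (hw : w ∈ cube d r)
    (hu : u ∈ cube d (ENNReal.ofReal (α / 2))) (i : Fin d) {s : ℝ} (hs : |s| ≤ α / 2) :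
    replaceCoord w u i s ∈ cube d (r + ENNReal.ofReal (α / 2)) := by
  rw [replaceCoord_eq_add]
  refine add_mem_cube hw ?_
  rw [mem_cube_ofReal_iff (by linarith)] at *
  intro j
  by_cases h : j = i
  · subst h; simpa using hs
  · simpa [h] using hu j

theorem finiteDiff_apply {p : ℕ} (F : Vec d → Vec p → ℝ) (α : ℝ) (w u : Vec d) (ξ : Vec p)
    (i : Fin d) : finiteDiff F α w u ξ i
      = F (replaceCoord w u i (α / 2)) ξ - F (replaceCoord w u i (-(α / 2))) ξ := by
  simp [finiteDiff, replaceCoord, sub_eq_add_neg]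

/-- The expected central finite differences, divided by `α`. -/
def smoothGrad (f : Vec d → ℝ) (α : ℝ) (w : Vec d) : Vec d :=
  WithLp.toLp 2 fun i => ∫ u, α⁻¹ * (f (replaceCoord w u i (α / 2))
    - f (replaceCoord w u i (-(α / 2)))) ∂(unifCube d α)

variable {f : Vec d → ℝ} {c α : ℝ}

theorem continuous_of_lip (hf : ∀ x y, |f x - f y| ≤ c * ‖x - y‖) : Continuous f := by
  have : LipschitzWith c.toNNReal f := LipschitzWith.of_dist_le_mul fun x y => by
    rw [Real.dist_eq, dist_eq_norm]
    exact (hf x y).trans (by gcongr; exact Real.le_coe_toNNReal _)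
  exact this.continuous

theorem integrable_comp_add (hα : 0 < α) (hf : Continuous f)
    (w : Vec d) : Integrable (fun u => f (w + u)) (unifCube d α) := by
  have := isProbabilityMeasure_unifCube (d := d) hα
  obtain ⟨C, hC⟩ := (isCompact_closedBall w (√(d : ℝ) * (α / 2))).exists_bound_of_continuousOn
    hf.continuousOn
  refine Integrable.of_bound (by fun_prop) C ?_
  filter_upwards [ae_mem_cube_unifCube d α] with u hu
  exact hC _ (by simpa using norm_le_of_mem_cube (by linarith) hu)

/-- By Rademacher's theorem the function is differentiable almost everywhere. The box law is
absolutely continuous, so one may differentiate under the integral, with the Lipschitz constant as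
dominating function. -/
theorem hasFDerivAt_integral_comp_add (hα : 0 < α) (hc : 0 ≤ c)
    (hf : ∀ x y, |f x - f y| ≤ c * ‖x - y‖)
    (w : Vec d) : Integrable (fun u => fderiv ℝ f (w + u)) (unifCube d α) ∧
      HasFDerivAt (fun w => ∫ u, f (w + u) ∂(unifCube d α))
      (∫ u, fderiv ℝ f (w + u) ∂(unifCube d α)) w := by
  have := isProbabilityMeasure_unifCube (d := d) hα
  have hfc := continuous_of_lip hf
  have hlip : LipschitzWith c.toNNReal f := LipschitzWith.of_dist_le_mul fun x y => by
    rw [Real.dist_eq, dist_eq_norm, Real.coe_toNNReal _ hc]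
    exact hf x y
  refine hasFDerivAt_integral_of_dominated_loc_of_lip (bound := fun _ => c) (s := Set.univ)
    univ_mem (Eventually.of_forall fun x => by fun_prop) (integrable_comp_add hα hfc w)
    ((measurable_fderiv ℝ f).comp (measurable_const_add w)).aestronglyMeasurable ?_
    (integrable_const _) ?_
  · refine Eventually.of_forall fun u => LipschitzWith.lipschitzOnWith
      (LipschitzWith.of_dist_le_mul fun x y => ?_)
    rw [Real.dist_eq, dist_eq_norm]
    simpa [abs_of_nonneg hc] using hf (x + u) (y + u)
  · have h1 : ∀ᵐ u ∂(volume : Measure (Vec d)), DifferentiableAt ℝ f (w + u) :=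
      (measurePreserving_add_left volume w).quasiMeasurePreserving.ae hlip.ae_differentiableAt
    filter_upwards [unifCube_absolutelyContinuous d α h1] with u hu
    have h2 := hu.hasFDerivAt.comp w ((hasFDerivAt_id w).add_const u)
    simpa [Function.comp_def] using h2

/-- The average over a sliding window changes only through its two endpoints. This is where central
differences come from. -/
theorem hasDerivAt_integral_shift (hα : 0 < α) {φ : ℝ → ℝ} (hφ : Continuous φ) :
    HasDerivAt (fun t => ∫ s, φ (s + t) ∂(unifInterval α))
      (α⁻¹ * (φ (α / 2) - φ (-(α / 2)))) 0 := by
  have h1 : (fun t => ∫ s, φ (s + t) ∂(unifInterval α))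
      = fun t => α⁻¹ * ((∫ s in (0 : ℝ)..(α / 2 + t), φ s)
        - ∫ s in (0 : ℝ)..(-(α / 2) + t), φ s) := by
    funext t
    rw [integral_unifInterval hα, intervalIntegral.integral_comp_add_right,
      intervalIntegral.integral_interval_sub_left (hφ.intervalIntegrable _ _)
        (hφ.intervalIntegrable _ _)]
  rw [h1]
  have h2 : ∀ a : ℝ, HasDerivAt (fun t => ∫ s in (0 : ℝ)..(a + t), φ s) (φ a) 0 := fun a => by
    have h3 := (hφ.integral_hasStrictDerivAt 0 (a + 0)).hasDerivAt.comp_const_add a 0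
    simpa using h3
  exact ((h2 _).sub (h2 _)).const_mul _

theorem integral_unifCube_eq_integral_update (hα : 0 < α) {φ : Vec d → ℝ}
    (hφ : Continuous φ) (i : Fin d) :
    ∫ u, φ u ∂(unifCube d α) = ∫ x, ∫ s, φ (WithLp.toLp 2 (Function.update x i s))
      ∂(unifInterval α) ∂(Measure.pi fun _ : Fin d => unifInterval α) := by
  have := isProbabilityMeasure_unifInterval hα
  have hprob := isProbabilityMeasure_unifCube (d := d) hα
  have hint : Integrable φ (unifCube d α) := by simpa using integrable_comp_add hα hφ 0
  have hmp := measurePreserving_update (fun _ : Fin d => unifInterval α) i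
  have hmp' : MeasurePreserving (WithLp.toLp 2 : (Fin d → ℝ) → Vec d)
      (Measure.pi fun _ : Fin d => unifInterval α) (unifCube d α) :=
    ⟨by fun_prop, (unifCube_eq_map hα).symm⟩
  have hcomp := hmp'.comp hmp
  rw [← hcomp.map_eq, integral_map hcomp.measurable.aemeasurable hφ.aestronglyMeasurable]
  exact integral_prod _ (hcomp.integrable_comp_of_integrable hint)

/-- Differentiability is already known, so only the partial derivatives remain. For the `i`-th one,
averaging over `u i` first leaves a sliding-window average in one variable, whose derivative is a
difference quotient. -/
theorem hasGradientAt_smoothing (hα : 0 < α) (hc : 0 ≤ c) (hf : ∀ x y, |f x - f y| ≤ c * ‖x - y‖)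
    (w : Vec d) :
    HasGradientAt (fun w => ∫ u, f (w + u) ∂(unifCube d α)) (smoothGrad f α w) w := by
  have hprob := isProbabilityMeasure_unifCube (d := d) hα
  have := isProbabilityMeasure_unifInterval hα
  have hfc := continuous_of_lip hf
  have hD := (hasFDerivAt_integral_comp_add hα hc hf w).2
  rw [hasGradientAt_iff_hasFDerivAt]
  set D := ∫ u, fderiv ℝ f (w + u) ∂(unifCube d α)
  have hcoord : ∀ i, D (EuclideanSpace.single i 1) = smoothGrad f α w i := by
    intro i
    have h0 : HasDerivAt (fun t : ℝ => w + t • EuclideanSpace.single i (1 : ℝ))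
        (EuclideanSpace.single i 1) 0 := by
      simpa using ((hasDerivAt_id (0 : ℝ)).smul_const (EuclideanSpace.single i (1 : ℝ))).const_add w
    have hD' : HasFDerivAt (fun w => ∫ u, f (w + u) ∂(unifCube d α)) D
        (w + (0 : ℝ) • EuclideanSpace.single i (1 : ℝ)) := by simpa using hD
    have h1 := hD'.comp_hasDerivAt (0 : ℝ) h0
    set φ : (Fin d → ℝ) → ℝ → ℝ := fun x s => f (replaceCoord w (WithLp.toLp 2 x) i s) with hφ
    have hφc : Continuous (Function.uncurry φ) :=
      hfc.comp ((continuous_replaceCoord i).comp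
        ((continuous_const.prodMk ((PiLp.continuous_toLp 2 _).comp continuous_fst)).prodMk
          continuous_snd))
    have hφ1 : ∀ x, Continuous (φ x) := fun x => hφc.comp (by fun_prop : Continuous fun s => (x, s))
    have hφl : ∀ x s t, |φ x s - φ x t| ≤ c * |s - t| := fun x s t => by
      simpa [hφ, norm_replaceCoord_sub] using
        hf (replaceCoord w (WithLp.toLp 2 x) i s) (replaceCoord w (WithLp.toLp 2 x) i t)
    have hbd : ∀ x t, Integrable (fun s => φ x (s + t)) (unifInterval α) := fun x t => by
      refine Integrable.of_bound
        ((hφ1 x).comp (continuous_add_const t)).aestronglyMeasurable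
        (|φ x t| + c * (α / 2)) ?_
      filter_upwards [ProbabilityTheory.ae_cond_mem measurableSet_Icc] with s hs
      have h3 := hφl x (s + t) t
      have h4 : |s + t - t| ≤ α / 2 := by rw [add_sub_cancel_right, abs_le]; exact hs
      have h5 := abs_sub_abs_le_abs_sub (φ x (s + t)) (φ x t)
      have h6 : c * |s + t - t| ≤ c * (α / 2) := by gcongr
      rw [Real.norm_eq_abs]
      linarith
    have hmeas : ∀ t, AEStronglyMeasurable (fun x => ∫ s, φ x (s + t) ∂(unifInterval α))
        (Measure.pi fun _ : Fin d => unifInterval α) := fun t => by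
      have : Continuous fun q : (Fin d → ℝ) × ℝ => φ q.1 (q.2 + t) :=
        hφc.comp (by fun_prop : Continuous fun q : (Fin d → ℝ) × ℝ => (q.1, q.2 + t))
      exact this.stronglyMeasurable.integral_prod_right.aestronglyMeasurable
    have hψl : ∀ x t t', |∫ s, φ x (s + t) ∂(unifInterval α) - ∫ s, φ x (s + t') ∂(unifInterval α)|
        ≤ c * |t - t'| := fun x t t' => by
      rw [← integral_sub (hbd x t) (hbd x t'), ← Real.norm_eq_abs]
      refine (norm_integral_le_of_norm_le_const (C := c * |t - t'|)
        (Eventually.of_forall fun s => ?_)).trans (by simp)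
      simpa using hφl x (s + t) (s + t')
    -- Moving `w` along the `i`-th axis only shifts the variable of the inner integral.
    have h2 : (fun t : ℝ => ∫ u, f (w + t • EuclideanSpace.single i (1 : ℝ) + u) ∂(unifCube d α))
        = fun t => ∫ x, ∫ s, φ x (s + t) ∂(unifInterval α)
          ∂(Measure.pi fun _ : Fin d => unifInterval α) := by
      funext t
      rw [integral_unifCube_eq_integral_update hα (by fun_prop) i]
      congr with x
      congr with s
      simp only [hφ]
      congr 1
      ext j
      by_cases h : j = i
      · subst h; simp [replaceCoord]; ring
      · simp [replaceCoord, h]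
    have hφ0 : HasDerivAt (fun t : ℝ => ∫ x, ∫ s, φ x (s + t) ∂(unifInterval α)
          ∂(Measure.pi fun _ : Fin d => unifInterval α))
        (∫ x, α⁻¹ * (φ x (α / 2) - φ x (-(α / 2)))
          ∂(Measure.pi fun _ : Fin d => unifInterval α)) 0 := by
      refine (hasDerivAt_integral_of_dominated_loc_of_lip (bound := fun _ => c) (s := Set.univ)
        univ_mem (Eventually.of_forall hmeas) ?_ ?_ ?_ (integrable_const _)
        (Eventually.of_forall fun x => hasDerivAt_integral_shift hα (hφ1 x))).2
      · have hi := integrable_comp_add (d := d) hα hfc w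
        have hmp' : MeasurePreserving (WithLp.toLp 2 : (Fin d → ℝ) → Vec d)
            (Measure.pi fun _ : Fin d => unifInterval α) (unifCube d α) :=
          ⟨by fun_prop, (unifCube_eq_map hα).symm⟩
        have hmp := hmp'.comp (measurePreserving_update (fun _ : Fin d => unifInterval α) i)
        have h3 := (hmp.integrable_comp_of_integrable hi).integral_prod_left
        refine h3.congr (Eventually.of_forall fun x => ?_)
        simp [hφ, replaceCoord_eq_add]
      · refine Continuous.aestronglyMeasurable ?_
        have hs : ∀ s, Continuous fun x => φ x s := fun s =>
          hφc.comp (by fun_prop : Continuous fun x : Fin d → ℝ => (x, s))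
        exact ((hs _).sub (hs _)).const_mul _
      · refine Eventually.of_forall fun x => LipschitzWith.lipschitzOnWith
          (LipschitzWith.of_dist_le_mul fun t t' => ?_)
        rw [Real.dist_eq, Real.dist_eq]
        simpa [abs_of_nonneg hc] using hψl x t t'
    rw [← h2] at hφ0
    rw [h1.unique hφ0, smoothGrad]
    simp only
    rw [unifCube_eq_map hα, integral_map (by fun_prop)]
    refine Continuous.aestronglyMeasurable ?_
    have hs : ∀ s, Continuous fun u : Vec d => f (replaceCoord w u i s) := fun s =>
      hfc.comp ((continuous_replaceCoord i).comp
        (by fun_prop : Continuous fun u : Vec d => ((w, u), s)))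
    exact ((hs _).sub (hs _)).const_mul _
  suffices h : InnerProductSpace.toDual ℝ (Vec d) (smoothGrad f α w) = D by rw [h]; exact hD
  refine ContinuousLinearMap.ext fun v => ?_
  rw [InnerProductSpace.toDual_apply_apply]
  have hv : v = ∑ i, v i • EuclideanSpace.single i (1 : ℝ) := by
    ext j; simp [Finset.sum_apply, Pi.single_apply]
  conv_rhs => rw [hv, map_sum]
  simp only [map_smul, hcoord, smul_eq_mul]
  simp [PiLp.inner_apply]

/-- Each component is an average of differences of two translates of `f`, divided by `α`, hence
Lipschitz with constant `2c / α`. Passing to the Euclidean norm costs `√d`. -/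
theorem smoothGrad_sub_le (hα : 0 < α) (hc : 0 ≤ c) (hf : ∀ x y, |f x - f y| ≤ c * ‖x - y‖)
    (w w' : Vec d) :
    ‖smoothGrad f α w - smoothGrad f α w'‖ ≤ 2 * (√(d : ℝ) * c / α) * ‖w - w'‖ := by
  have hprob := isProbabilityMeasure_unifCube (d := d) hα
  have hfc := continuous_of_lip hf
  have hs : ∀ w (i : Fin d) s, Continuous fun u : Vec d => f (replaceCoord w u i s) :=
    fun w i s => hfc.comp ((continuous_replaceCoord i).comp
      (by fun_prop : Continuous fun u : Vec d => ((w, u), s)))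
  have hint : ∀ w (i : Fin d), Integrable (fun u => α⁻¹ * (f (replaceCoord w u i (α / 2))
      - f (replaceCoord w u i (-(α / 2))))) (unifCube d α) := fun w i => by
    refine Integrable.of_bound
      ((((hs w i _).sub (hs w i _)).const_mul _).aestronglyMeasurable) (α⁻¹ * (c * α)) ?_
    refine Eventually.of_forall fun u => ?_
    have := hf (replaceCoord w u i (α / 2)) (replaceCoord w u i (-(α / 2)))
    rw [norm_replaceCoord_sub, show α / 2 - -(α / 2) = α by ring, abs_of_pos hα] at this
    rw [norm_mul, Real.norm_of_nonneg (by positivity), Real.norm_eq_abs]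
    gcongr
  have hi : ∀ i, |smoothGrad f α w i - smoothGrad f α w' i| ≤ 2 * c / α * ‖w - w'‖ := fun i => by
    simp only [smoothGrad]
    rw [← integral_sub (hint w i) (hint w' i), ← Real.norm_eq_abs]
    refine (norm_integral_le_of_norm_le_const (C := 2 * c / α * ‖w - w'‖)
      (Eventually.of_forall fun u => ?_)).trans (by simp)
    have h1 := hf (replaceCoord w u i (α / 2)) (replaceCoord w' u i (α / 2))
    have h2 := hf (replaceCoord w u i (-(α / 2))) (replaceCoord w' u i (-(α / 2)))
    rw [replaceCoord_sub_left] at h1 h2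
    rw [← mul_sub, norm_mul, Real.norm_of_nonneg (by positivity), Real.norm_eq_abs,
      inv_mul_le_iff₀ hα]
    calc _ = |(f (replaceCoord w u i (α / 2)) - f (replaceCoord w' u i (α / 2)))
          - (f (replaceCoord w u i (-(α / 2))) - f (replaceCoord w' u i (-(α / 2))))| := by
          congr 1; ring
      _ ≤ c * ‖w - w'‖ + c * ‖w - w'‖ := (abs_sub _ _).trans (add_le_add h1 h2)
      _ = _ := by field_simp; ring
  rw [EuclideanSpace.norm_eq]
  have hn : 0 ≤ 2 * c / α * ‖w - w'‖ := by positivity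
  calc √(∑ i, ‖(smoothGrad f α w - smoothGrad f α w') i‖ ^ 2)
      ≤ √(d * (2 * c / α * ‖w - w'‖) ^ 2) := by
        refine Real.sqrt_le_sqrt ((Finset.sum_le_sum fun i _ =>
          pow_le_pow_left₀ (norm_nonneg _) (hi i) 2).trans (by simp))
    _ = √(d : ℝ) * (2 * c / α * ‖w - w'‖) := by
        rw [Real.sqrt_mul (Nat.cast_nonneg d), Real.sqrt_sq hn]
    _ = _ := by ring

end Smoothing

/-! ### Consequences of the margin condition -/

namespace Problem

variable {d p : ℕ} {pb : Problem d p} {a α : ℝ}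

/-- Strictness of the margin leaves room to move `w`, even from the boundary of the `β`-box.
Identities between `f` and its extension therefore hold on a neighbourhood and pass to derivatives.
-/
theorem Margin.eventually_add_mem (hm : pb.Margin a) {w : Vec d} (hw : w ∈ cube d pb.β) :
    ∀ᶠ x in 𝓝 w, ∀ u ∈ cube d (ENNReal.ofReal a), x + u ∈ cube d pb.κ := by
  rcases hm with h | ⟨-, h⟩
  · have h1 : pb.β < pb.κ - ENNReal.ofReal a := lt_tsub_iff_right.2 h
    filter_upwards [cube_mem_nhds h1 hw] with x hx u hu
    have := add_mem_cube hx hu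
    rwa [tsub_add_cancel_of_le (le_of_add_le_right h.le)] at this
  · simp [h, cube_top]

theorem Margin.cube_mem_nhds (hm : pb.Margin a) {w u : Vec d} (hw : w ∈ cube d pb.β)
    (hu : u ∈ cube d (ENNReal.ofReal a)) : cube d pb.κ ∈ 𝓝 (w + u) := by
  rcases hm with h | ⟨-, h⟩
  · exact SPA.cube_mem_nhds h (add_mem_cube hw hu)
  · simp [h, cube_top]

theorem Margin.cube_subset (hm : pb.Margin a) :
    cube d (pb.β + ENNReal.ofReal a) ⊆ cube d pb.κ := by
  rcases hm with h | ⟨-, h⟩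
  · exact cube_mono h.le
  · simp [h, cube_top]

theorem Margin.κ_pos (hm : pb.Margin a) : 0 < pb.κ := by
  rcases hm with h | ⟨-, h⟩
  · exact bot_lt_of_lt h
  · simp [h]

theorem Margin.mono {b : ℝ} (hm : pb.Margin b) (hab : a ≤ b) : pb.Margin a := by
  rcases hm with h | h
  · exact Or.inl (lt_of_le_of_lt (by gcongr) h)
  · exact Or.inr h

/-! ### Extension of the loss beyond the box -/

variable (pb) in
/-- The loss, extended to all of `ℝᵈ` by clamping. -/
def Fext (w : Vec d) (ξ : Vec p) : ℝ := pb.F (clamp pb.κ w) ξ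

variable (pb) in
/-- The expected loss, extended to all of `ℝᵈ` by clamping. -/
def fext (w : Vec d) : ℝ := pb.f (clamp pb.κ w)

theorem Fext_of_mem {w : Vec d} (hw : w ∈ cube d pb.κ) (ξ : Vec p) : pb.Fext w ξ = pb.F w ξ := by
  rw [Fext, clamp_of_mem hw]

theorem fext_of_mem {w : Vec d} (hw : w ∈ cube d pb.κ) : pb.fext w = pb.f w := by
  rw [fext, clamp_of_mem hw]

variable (pb)

theorem measurable_Fext : Measurable (Function.uncurry pb.Fext) := by
  have h : Measurable fun q : Vec d × Vec p => (⟨(clamp pb.κ q.1, q.2), clamp_mem _ _, trivial⟩ :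
      (cube d pb.κ ×ˢ (Set.univ : Set (Vec p)) : Set (Vec d × Vec p))) :=
    (((measurable_clamp _).comp measurable_fst).prodMk measurable_snd).subtype_mk
  exact pb.measurable_F.comp h

theorem integrable_Fext (w : Vec d) : Integrable (pb.Fext w) pb.law :=
  pb.integrable_F _ (clamp_mem _ _)

variable {pb}

theorem lip_nonneg (hd : 0 < d) (hκ : 0 < pb.κ) : ∀ᵐ ξ ∂pb.law, 0 ≤ pb.lip ξ := by
  -- Capping by `1` gives a finite positive length even for `κ = ∞`. The Lipschitz bound between `0`
  -- and a vector of this length forces `lip ξ ≥ 0`.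
  set t := (min pb.κ 1).toReal with ht
  have hmin : min pb.κ 1 ≠ ∞ := ne_top_of_le_ne_top ENNReal.one_ne_top (min_le_right _ _)
  have ht0 : 0 < t := ENNReal.toReal_pos (lt_min hκ one_pos).ne' hmin
  have hmem : EuclideanSpace.single (⟨0, hd⟩ : Fin d) t ∈ cube d pb.κ := fun i => by
    by_cases h : i = ⟨0, hd⟩
    · subst h
      simp only [PiLp.single_apply, if_true]
      rw [abs_of_pos ht0, ht, ENNReal.ofReal_toReal hmin]
      exact min_le_left _ _
    · simp [h]
  have h0 : (0 : Vec d) ∈ cube d pb.κ := fun i => by simp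
  filter_upwards [pb.lipschitz_F] with ξ hξ
  have h1 := (abs_nonneg _).trans (hξ _ hmem _ h0)
  simp only [sub_zero, PiLp.norm_single, Real.norm_of_nonneg ht0.le] at h1
  exact nonneg_of_mul_nonneg_left h1 ht0

/-- Clamping is nonexpansive, and nonnegativity of `lip ξ` lets this be inserted into the bound. -/
theorem Fext_lipschitz (hd : 0 < d) (hκ : 0 < pb.κ) :
    ∀ᵐ ξ ∂pb.law, ∀ x y, |pb.Fext x ξ - pb.Fext y ξ| ≤ pb.lip ξ * ‖x - y‖ := by
  filter_upwards [pb.lipschitz_F, lip_nonneg hd hκ] with ξ hξ h0 x y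
  exact (hξ _ (clamp_mem _ _) _ (clamp_mem _ _)).trans (by gcongr; exact norm_clamp_sub_le _ _ _)

theorem integrable_lip (hL : 0 < pb.L₀) : Integrable pb.lip pb.law := by
  by_contra h
  -- The integral of a nonintegrable function is `0` by convention, against `0 < L₀`.
  rw [L₀, integral_undef h] at hL
  exact hL.false

theorem Q_pos (hL : 0 < pb.L₀) : 0 < pb.Q := by
  have := pb.law_prob
  refine (integral_nonneg fun ξ => sq_nonneg (pb.lip ξ)).lt_of_ne' fun h => ?_
  rw [integral_eq_zero_iff_of_nonneg (fun ξ => sq_nonneg (pb.lip ξ)) pb.sq_integrable_lip] at h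
  have h1 : pb.lip =ᵐ[pb.law] 0 := h.mono fun ξ hξ => by simpa using hξ
  have : pb.L₀ = 0 := by rw [L₀, integral_congr_ae h1]; simp
  exact hL.ne' this

theorem fext_lipschitz (hd : 0 < d) (hκ : 0 < pb.κ) (hL : 0 < pb.L₀) (x y : Vec d) :
    |pb.fext x - pb.fext y| ≤ pb.L₀ * ‖x - y‖ := by
  have e : pb.fext x - pb.fext y = ∫ ξ, (pb.Fext x ξ - pb.Fext y ξ) ∂pb.law :=
    (integral_sub (pb.integrable_Fext x) (pb.integrable_Fext y)).symm
  rw [e, ← Real.norm_eq_abs, L₀, ← integral_mul_const]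
  exact norm_integral_le_of_norm_le ((integrable_lip hL).mul_const _)
    ((Fext_lipschitz hd hκ).mono fun ξ h => h x y)

theorem fSmooth_eq_of_forall {w : Vec d}
    (h : ∀ u ∈ cube d (ENNReal.ofReal (α / 2)), w + u ∈ cube d pb.κ) :
    pb.fSmooth α w = ∫ u, pb.fext (w + u) ∂(unifCube d α) :=
  integral_congr_ae ((ae_mem_cube_unifCube d α).mono fun u hu => (fext_of_mem (h u hu)).symm)

theorem hasGradientAt_fSmooth (hd : 0 < d) (hL : 0 < pb.L₀) (hα : 0 < α)
    (hm : pb.Margin (α / 2)) {w : Vec d} (hw : w ∈ cube d pb.β) :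
    HasGradientAt (pb.fSmooth α) (smoothGrad pb.fext α w) w :=
  (hasGradientAt_smoothing hα hL.le (fext_lipschitz hd hm.κ_pos hL) w).congr_of_eventuallyEq
    ((hm.eventually_add_mem hw).mono fun _ hx => fSmooth_eq_of_forall hx)

theorem abs_fSmooth_sub_le (hd : 0 < d) (hL : 0 < pb.L₀) (hα : 0 < α)
    (hm : pb.Margin (α / 2)) {w : Vec d} (hw : w ∈ cube d pb.β) :
    |pb.fSmooth α w - pb.f w| ≤ pb.L₀ * (α * √((d : ℝ) / 12)) := by
  have := isProbabilityMeasure_unifCube (d := d) hα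
  have hlip := fext_lipschitz hd hm.κ_pos hL
  have hmem := (hm.eventually_add_mem hw).self_of_nhds
  have hwκ : w ∈ cube d pb.κ := by simpa using hmem 0 (fun i => by simp)
  have hn : Integrable (fun u : Vec d => ‖u‖) (unifCube d α) := by
    simpa using integrable_comp_add (d := d) hα continuous_norm 0
  have e : pb.fSmooth α w - pb.f w
      = ∫ u, (pb.fext (w + u) - pb.fext w) ∂(unifCube d α) := by
    rw [integral_sub (integrable_comp_add hα (continuous_of_lip hlip) w) (integrable_const _),
      fSmooth_eq_of_forall hmem]
    simp [fext_of_mem hwκ]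
  rw [e, ← Real.norm_eq_abs]
  refine (norm_integral_le_of_norm_le (hn.const_mul pb.L₀)
    (Eventually.of_forall fun u => ?_)).trans ?_
  · simpa using hlip (w + u) w
  · rw [integral_const_mul]
    gcongr
    exact integral_norm_unifCube_le hα

end Problem

/-! ### The stochastic gradients are unbiased with bounded second moment -/

section Oracles

variable {d p : ℕ} {pb : Problem d p} {α : ℝ}

theorem isProbabilityMeasure_sampleLaw (hα : 0 < α) :
    IsProbabilityMeasure (sampleLaw pb α) := by
  have := isProbabilityMeasure_unifCube (d := d) hα
  have := pb.law_prob
  rw [sampleLaw]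
  infer_instance

/-- A globally measurable function that agrees with the oracle on the relevant points. -/
def Oracle.extend (O : Oracle d p) (pb : Problem d p) (α : ℝ) (w : Vec d) (z : Vec d × Vec p) :
    Vec d :=
  match O with
  | .zeroth => α⁻¹ • finiteDiff pb.Fext α w z.1 z.2
  | .first G => (cube d (pb.β + ENNReal.ofReal (α / 2)) ×ˢ (Set.univ : Set (Vec p))).indicator
      (fun q => G q.1 q.2) (w + z.1, z.2)

theorem Oracle.extend_eq_call (O : Oracle d p) (hα : 0 < α) (hm : pb.Margin (α / 2)) {w : Vec d}
    (hw : w ∈ cube d pb.β) {z : Vec d × Vec p} (hz : z.1 ∈ cube d (ENNReal.ofReal (α / 2))) :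
    O.extend pb α w z = O.call pb α w z := by
  cases O with
  | zeroth =>
    simp only [Oracle.extend, Oracle.call]
    congr 1
    ext i
    have h : ∀ s : ℝ, |s| ≤ α / 2 → replaceCoord w z.1 i s ∈ cube d pb.κ := fun s hs =>
      hm.cube_subset (replaceCoord_mem_cube hα hw hz i hs)
    rw [finiteDiff_apply, finiteDiff_apply, Problem.Fext_of_mem (h _ _),
      Problem.Fext_of_mem (h _ _)]
    · rw [abs_neg, abs_of_pos (by linarith)]
    · rw [abs_of_pos (by linarith)]
  | first G =>
    simp only [Oracle.extend, Oracle.call]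
    exact Set.indicator_of_mem (Set.mk_mem_prod (add_mem_cube hw hz) (Set.mem_univ _)) _

theorem Oracle.measurable_extend (O : Oracle d p) (hO : O.Valid pb α) :
    Measurable (Function.uncurry (O.extend pb α)) := by
  cases O with
  | zeroth =>
    have h : ∀ (i : Fin d) (s : ℝ), Measurable fun q : Vec d × (Vec d × Vec p) =>
        pb.Fext (replaceCoord q.1 q.2.1 i s) q.2.2 := fun i s =>
      pb.measurable_Fext.comp (((continuous_replaceCoord i).measurable.comp
        (by fun_prop : Measurable fun q : Vec d × (Vec d × Vec p) => ((q.1, q.2.1), s))).prodMk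
          (by fun_prop))
    have h2 : Measurable fun q : Vec d × (Vec d × Vec p) =>
        finiteDiff pb.Fext α q.1 q.2.1 q.2.2 := by
      refine (by fun_prop : Measurable (WithLp.toLp 2 : (Fin d → ℝ) → Vec d)).comp
        (measurable_pi_lambda _ fun i => ?_)
      have := (h i (α / 2)).sub (h i (-(α / 2)))
      convert this using 2 with q
      exact finiteDiff_apply pb.Fext α q.1 q.2.1 q.2.2 i
    exact h2.const_smul α⁻¹
  | first G =>
    have hs : MeasurableSet (cube d (pb.β + ENNReal.ofReal (α / 2)) ×ˢ
        (Set.univ : Set (Vec p))) := (measurableSet_cube _).prod MeasurableSet.univ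
    have h := measurable_of_restrict_of_restrict_compl hs
      (f := (cube d (pb.β + ENNReal.ofReal (α / 2)) ×ˢ (Set.univ : Set (Vec p))).indicator
        (fun q => G q.1 q.2)) (by
          refine (congrArg Measurable (funext fun x => ?_)).mpr hO.1
          exact Set.indicator_of_mem x.2 _)
        (by
          refine (congrArg Measurable (funext fun x => ?_)).mpr (measurable_const (a := 0))
          exact Set.indicator_of_notMem x.2 _)
    exact h.comp (by fun_prop : Measurable fun q : Vec d × (Vec d × Vec p) =>
      (q.1 + q.2.1, q.2.2))

theorem ae_sampleLaw_of_ae_law {P : Vec p → Prop} (h : ∀ᵐ ξ ∂pb.law, P ξ) :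
    ∀ᵐ z ∂(sampleLaw pb α), P z.2 := by
  have := pb.law_prob
  exact Measure.quasiMeasurePreserving_snd.ae h

theorem ae_sampleLaw_mem_cube (pb : Problem d p) (α : ℝ) :
    ∀ᵐ z ∂(sampleLaw pb α), z.1 ∈ cube d (ENNReal.ofReal (α / 2)) := by
  have := pb.law_prob
  exact Measure.quasiMeasurePreserving_fst.ae (ae_mem_cube_unifCube d α)

theorem integrable_comp_snd (hα : 0 < α) {φ : Vec p → ℝ} (hφ : Integrable φ pb.law) :
    Integrable (fun z => φ z.2) (sampleLaw pb α) ∧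
      ∫ z, φ z.2 ∂(sampleLaw pb α) = ∫ ξ, φ ξ ∂pb.law := by
  have := isProbabilityMeasure_unifCube (d := d) hα
  have := pb.law_prob
  refine ⟨hφ.comp_snd _, ?_⟩
  rw [sampleLaw, integral_fun_snd]
  simp

theorem integrable_Fext_add (hd : 0 < d) (hL : 0 < pb.L₀) (hα : 0 < α) (hκ : 0 < pb.κ)
    (w : Vec d) : Integrable (fun z => pb.Fext (w + z.1) z.2) (sampleLaw pb α) := by
  have hmeas : Measurable fun z : Vec d × Vec p => pb.Fext (w + z.1) z.2 :=
    pb.measurable_Fext.comp (by fun_prop : Measurable fun z : Vec d × Vec p => (w + z.1, z.2))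
  refine Integrable.mono' (g := fun z => |pb.Fext w z.2| + pb.lip z.2 * (√(d : ℝ) * (α / 2)))
    (((integrable_comp_snd hα (pb.integrable_Fext w)).1.abs).add
      ((integrable_comp_snd hα (Problem.integrable_lip hL)).1.mul_const _))
    hmeas.aestronglyMeasurable ?_
  filter_upwards [ae_sampleLaw_mem_cube pb α,
    ae_sampleLaw_of_ae_law (Problem.Fext_lipschitz hd hκ),
    ae_sampleLaw_of_ae_law (Problem.lip_nonneg hd hκ)] with z hz hlip h0
  have h1 := hlip (w + z.1) w
  rw [add_sub_cancel_left] at h1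
  have h2 : pb.lip z.2 * ‖z.1‖ ≤ pb.lip z.2 * (√(d : ℝ) * (α / 2)) := by
    gcongr; exact norm_le_of_mem_cube (by linarith) hz
  have h3 := abs_sub_abs_le_abs_sub (pb.Fext (w + z.1) z.2) (pb.Fext w z.2)
  rw [Real.norm_eq_abs]
  linarith

theorem integral_Fext_add (hd : 0 < d) (hL : 0 < pb.L₀) (hα : 0 < α) (hκ : 0 < pb.κ)
    (w : Vec d) : ∫ z, pb.Fext (w + z.1) z.2 ∂(sampleLaw pb α)
      = ∫ u, pb.fext (w + u) ∂(unifCube d α) := by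
  have := isProbabilityMeasure_unifCube (d := d) hα
  have := pb.law_prob
  have h := integrable_Fext_add hd hL hα hκ w
  rw [sampleLaw] at h ⊢
  exact integral_prod _ h

/-- Second-moment bounds from a pointwise one. -/
theorem memLp_of_sq_le (hα : 0 < α) {g : Vec d × Vec p → Vec d} (hg : Measurable g) {q : ℝ}
    (h : ∀ᵐ z ∂(sampleLaw pb α), ‖g z‖ ^ 2 ≤ q * pb.lip z.2 ^ 2) :
    MemLp g 2 (sampleLaw pb α) ∧ ∫ z, ‖g z‖ ^ 2 ∂(sampleLaw pb α) ≤ q * pb.Q := by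
  have hi := integrable_comp_snd (α := α) hα pb.sq_integrable_lip
  have hint : Integrable (fun z => ‖g z‖ ^ 2) (sampleLaw pb α) :=
    (hi.1.const_mul q).mono' (hg.norm.pow_const 2).aestronglyMeasurable (by
      filter_upwards [h] with z hz
      rwa [Real.norm_of_nonneg (sq_nonneg _)])
  refine ⟨(memLp_two_iff_integrable_sq_norm hg.aestronglyMeasurable).2 hint, ?_⟩
  refine (integral_mono_ae hint (hi.1.const_mul q) h).trans ?_
  rw [integral_const_mul, hi.2, Problem.Q]

/-- The point `w + u` is interior to the `κ`-box, where `F` and its extension coincide locally and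
thus share the derivative. -/
theorem ae_hasFDerivAt_Fext {G : Vec d → Vec p → Vec d}
    (hm : pb.Margin (α / 2)) (hO : (Oracle.first G).Valid pb α) {w : Vec d}
    (hw : w ∈ cube d pb.β) :
    ∀ᵐ z ∂(sampleLaw pb α), HasFDerivAt (fun x => pb.Fext (x + z.1) z.2)
      (InnerProductSpace.toDual ℝ _ ((Oracle.first G).extend pb α w z)) w := by
  filter_upwards [ae_sampleLaw_mem_cube pb α, hO.2 w hw] with z hz hG
  have e : (Oracle.first G).extend pb α w z = G (w + z.1) z.2 := by
    simp only [Oracle.extend]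
    exact Set.indicator_of_mem (Set.mk_mem_prod (add_mem_cube hw hz) (Set.mem_univ _)) _
  have h1 : HasFDerivAt (fun x => pb.Fext x z.2)
      (InnerProductSpace.toDual ℝ _ (G (w + z.1) z.2)) (w + z.1) :=
    hG.hasFDerivAt.congr_of_eventuallyEq
      (mem_of_superset (hm.cube_mem_nhds hw hz) fun x hx => Problem.Fext_of_mem hx _)
  have h2 := h1.comp w ((hasFDerivAt_id w).add_const z.1)
  rw [e]
  simpa [Function.comp_def] using h2

/-- The two points of a finite difference are at distance `α`, so after division each of the `d`
components is at most `lip ξ`. A gradient is bounded by `lip ξ` as a whole; hence `υ = d` and `υ =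
1`. -/
theorem sq_norm_extend_le (O : Oracle d p) (hd : 0 < d) (hα : 0 < α)
    (hm : pb.Margin (α / 2)) (hO : O.Valid pb α) {w : Vec d} (hw : w ∈ cube d pb.β) :
    ∀ᵐ z ∂(sampleLaw pb α), ‖O.extend pb α w z‖ ^ 2 ≤ O.υ * pb.lip z.2 ^ 2 := by
  cases O with
  | zeroth =>
    filter_upwards [ae_sampleLaw_of_ae_law (Problem.Fext_lipschitz hd hm.κ_pos)] with z hz
    have hi : ∀ i, ‖(Oracle.zeroth.extend pb α w z) i‖ ≤ pb.lip z.2 := fun i => by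
      have h := hz (replaceCoord w z.1 i (α / 2)) (replaceCoord w z.1 i (-(α / 2)))
      rw [norm_replaceCoord_sub, show α / 2 - -(α / 2) = α by ring, abs_of_pos hα] at h
      simp only [Oracle.extend, PiLp.smul_apply, finiteDiff_apply, smul_eq_mul]
      rw [norm_mul, Real.norm_of_nonneg (by positivity), Real.norm_eq_abs, inv_mul_le_iff₀ hα]
      linarith
    rw [EuclideanSpace.norm_sq_eq]
    exact (Finset.sum_le_sum fun i _ => pow_le_pow_left₀ (norm_nonneg _) (hi i) 2).trans
      (by simp [Oracle.υ])
  | first G =>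
    filter_upwards [ae_sampleLaw_of_ae_law (Problem.Fext_lipschitz hd hm.κ_pos),
      ae_sampleLaw_of_ae_law (Problem.lip_nonneg hd hm.κ_pos),
      ae_hasFDerivAt_Fext hm hO hw] with z hz h0 hD
    have h1 := hD.le_of_lip' h0 (Eventually.of_forall fun x => by
      simpa using hz (x + z.1) (w + z.1))
    rw [LinearIsometryEquiv.norm_map] at h1
    simpa [Oracle.υ] using pow_le_pow_left₀ (norm_nonneg _) h1 2

/-- For finite differences this is Fubini. In the first-order case, differentiating the joint
expectation under the integral gives a second expression for the derivative of the smoothed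
function, and derivatives are unique. -/
theorem integral_extend (O : Oracle d p) (hd : 0 < d) (hL : 0 < pb.L₀) (hα : 0 < α)
    (hm : pb.Margin (α / 2)) (hO : O.Valid pb α) {w : Vec d} (hw : w ∈ cube d pb.β) :
    ∫ z, O.extend pb α w z ∂(sampleLaw pb α) = smoothGrad pb.fext α w := by
  have hprobu := isProbabilityMeasure_unifCube (d := d) hα
  have hprob := pb.law_prob
  have hprobs := isProbabilityMeasure_sampleLaw (pb := pb) hα
  have hg : Measurable (O.extend pb α w) :=
    (O.measurable_extend hO).of_uncurry_left
  have hint : Integrable (O.extend pb α w) (sampleLaw pb α) :=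
    (memLp_of_sq_le hα hg (sq_norm_extend_le O hd hα hm hO hw)).1.integrable one_le_two
  cases O with
  | zeroth =>
    ext i
    have h1 : ∫ z, (Oracle.zeroth.extend pb α w z) i ∂(sampleLaw pb α)
        = (∫ z, Oracle.zeroth.extend pb α w z ∂(sampleLaw pb α)) i :=
      ContinuousLinearMap.integral_comp_comm (EuclideanSpace.proj (𝕜 := ℝ) i : Vec d →L[ℝ] ℝ) hint
    have h2 : Integrable (fun z => (Oracle.zeroth.extend pb α w z) i) (sampleLaw pb α) :=
      (EuclideanSpace.proj (𝕜 := ℝ) i).integrable_comp hint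
    rw [← h1, smoothGrad]
    simp only [Oracle.extend, PiLp.smul_apply, finiteDiff_apply, smul_eq_mul] at h2 ⊢
    rw [sampleLaw] at h2 ⊢
    rw [integral_prod _ h2]
    refine integral_congr_ae (Eventually.of_forall fun u => ?_)
    simp only
    rw [integral_const_mul, integral_sub (pb.integrable_Fext _) (pb.integrable_Fext _)]
    rfl
  | first G =>
    set g := (Oracle.first G).extend pb α w
    have hlip := ae_sampleLaw_of_ae_law (α := α) (Problem.Fext_lipschitz hd hm.κ_pos)
    have hlip0 := ae_sampleLaw_of_ae_law (α := α) (Problem.lip_nonneg hd hm.κ_pos)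
    have hD := hasFDerivAt_integral_of_dominated_loc_of_lip (μ := sampleLaw pb α)
      (F := fun x z => pb.Fext (x + z.1) z.2) (bound := fun z => pb.lip z.2) (s := Set.univ)
      (x₀ := w) univ_mem
      (Eventually.of_forall fun x => (integrable_Fext_add hd hL hα hm.κ_pos x).1)
      (integrable_Fext_add hd hL hα hm.κ_pos w)
      (((InnerProductSpace.toDual ℝ (Vec d)).continuous.measurable.comp hg).aestronglyMeasurable)
      (by
        filter_upwards [hlip, hlip0] with z hz h0
        refine LipschitzWith.lipschitzOnWith (LipschitzWith.of_dist_le_mul fun x y => ?_)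
        rw [Real.dist_eq, dist_eq_norm]
        simpa [abs_of_nonneg h0] using hz (x + z.1) (y + z.1))
      (integrable_comp_snd hα (Problem.integrable_lip hL)).1
      (ae_hasFDerivAt_Fext hm hO hw)
    have h1 := hasGradientAt_smoothing (c := pb.L₀) hα hL.le
      (Problem.fext_lipschitz hd hm.κ_pos hL) w
    have h2 := hD.2
    simp only [integral_Fext_add hd hL hα hm.κ_pos] at h2
    have h3 := h2.unique h1.hasFDerivAt
    refine ext_inner_right ℝ fun v => ?_
    have h4 := congrArg (fun D => D v) h3
    simp only [InnerProductSpace.toDual_apply_apply] at h4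
    rw [← h4, ContinuousLinearMap.integral_apply hD.1]
    simp only [Function.comp_apply, InnerProductSpace.toDual_apply_apply]
    rw [real_inner_comm, ← integral_inner hint]
    simp only [real_inner_comm]

theorem isGradientModel_extend (O : Oracle d p) (hd : 0 < d) (hL : 0 < pb.L₀) (hα : 0 < α)
    (hm : pb.Margin (α / 2)) (hO : O.Valid pb α) :
    IsGradientModel (sampleLaw pb α) (cube d pb.β) (pb.fSmooth α) (O.extend pb α)
      (smoothGrad pb.fext α) (√(d : ℝ) * pb.L₀ / α) (O.υ * pb.Q) where
  measurable_oracle := O.measurable_extend hO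
  hasGradientAt _ hw := Problem.hasGradientAt_fSmooth hd hL hα hm hw
  lipschitz := smoothGrad_sub_le hα hL.le (Problem.fext_lipschitz hd hm.κ_pos hL)
  memLp _ hw := (memLp_of_sq_le hα (O.measurable_extend hO).of_uncurry_left
    (sq_norm_extend_le O hd hα hm hO hw)).1
  integral_eq _ hw := integral_extend O hd hL hα hm hO hw
  sq_le _ hw := (memLp_of_sq_le hα (O.measurable_extend hO).of_uncurry_left
    (sq_norm_extend_le O hd hα hm hO hw)).2

end Oracles

/-! ### Distance to a translated cone -/

section Distance

variable {d : ℕ}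

/-- The distance from `0` to `a + N` is the distance from `-a` to `N`, which is 1-Lipschitz in `a`;
this also covers empty `N`. -/
theorem distZero_singleton_add_le (a b : Vec d) (N : Set (Vec d)) :
    distZero ({a} + N) ≤ distZero ({b} + N) + ENNReal.ofReal ‖a - b‖ := by
  have key : ∀ a : Vec d, distZero ({a} + N) = Metric.infEDist (-a) N := fun a => by
    have h := Metric.infEDist_vadd a (-a) N
    rw [vadd_eq_add, add_neg_cancel] at h
    rw [distZero, ← h, ← Set.singleton_vadd, vadd_eq_add]
  rw [key, key]
  refine (Metric.infEDist_le_infEDist_add_edist (y := -b)).trans ?_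
  rw [edist_dist, dist_eq_norm, ← norm_neg]
  gcongr
  rw [neg_sub_neg, neg_sub]

theorem distZero_le_of_mem {A : Set (Vec d)} {x : Vec d} (hx : x ∈ A) :
    distZero A ≤ ENNReal.ofReal ‖x‖ := by
  refine (Metric.infEDist_le_edist_of_mem hx).trans (le_of_eq ?_)
  rw [edist_dist, dist_eq_norm, zero_sub, norm_neg]

theorem distZero_add_le_of_mem_closure {A N : Set (Vec d)} {a : Vec d} (ha : a ∈ closure A) :
    distZero (A + N) ≤ distZero ({a} + N) := by
  have h : {a} + N ⊆ closure (A + N) := by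
    rintro _ ⟨x, hx, n, hn, rfl⟩
    rw [Set.mem_singleton_iff] at hx
    subst hx
    exact map_mem_closure (f := fun y => y + n) (continuous_add_const n) ha
      fun y hy => Set.add_mem_add hy hn
  rw [distZero, distZero, ← Metric.infEDist_closure (s := A + N)]
  exact Metric.infEDist_anti h

end Distance

/-! ### The Clarke subdifferential -/

section Clarke

variable {d : ℕ} {f g : Vec d → ℝ} {x : Vec d}

/-- Fixing the base point at `x` restricts the limsup to a smaller filter, along which the quotient
converges to the directional derivative. -/
theorem mem_clarkeSubdiff_of_hasFDerivAt {D : Vec d →L[ℝ] ℝ} (h : HasFDerivAt f D x) :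
    (InnerProductSpace.toDual ℝ (Vec d)).symm D ∈ clarkeSubdiff f x := by
  intro v
  rw [InnerProductSpace.toDual_symm_apply]
  have h1 : HasDerivAt (fun t : ℝ => f (x + t • v)) (D v) 0 := by
    have h0 : HasDerivAt (fun t : ℝ => x + t • v) v 0 := by
      simpa using ((hasDerivAt_id (0 : ℝ)).smul_const v).const_add x
    have h' : HasFDerivAt f D (x + (0 : ℝ) • v) := by simpa using h
    exact h'.comp_hasDerivAt 0 h0
  have h2 : Tendsto (fun t : ℝ => (((f (x + t • v) - f x) / t : ℝ) : EReal)) (𝓝[>] 0)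
      (𝓝 ((D v : ℝ) : EReal)) := by
    refine (continuous_coe_real_ereal.tendsto _).comp ?_
    have h3 := h1.tendsto_slope_zero_right
    simpa [div_eq_inv_mul] using h3
  rw [← h2.limsup_eq, clarkeDirDeriv]
  have h4 : map (fun t : ℝ => (x, t)) (𝓝[>] 0) ≤ 𝓝 x ×ˢ 𝓝[>] (0 : ℝ) :=
    (tendsto_const_nhds.prodMk tendsto_id :
      Tendsto (fun t : ℝ => (x, t)) (𝓝[>] 0) (𝓝 x ×ˢ 𝓝[>] (0 : ℝ)))
  exact limsup_le_limsup_of_le h4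
    (f := map (fun t : ℝ => (x, t)) (𝓝[>] 0))
    (u := fun q : Vec d × ℝ => (((f (q.1 + q.2 • v) - f q.1) / q.2 : ℝ) : EReal))

theorem clarkeSubdiff_congr (h : f =ᶠ[𝓝 x] g) : clarkeSubdiff f x = clarkeSubdiff g x := by
  have hdir : ∀ v, clarkeDirDeriv f x v = clarkeDirDeriv g x v := fun v => by
    refine limsup_congr ?_
    have h1 : Tendsto (fun q : Vec d × ℝ => q.1) (𝓝 x ×ˢ 𝓝[>] (0 : ℝ)) (𝓝 x) := tendsto_fst
    have h2 : Tendsto (fun q : Vec d × ℝ => q.1 + q.2 • v) (𝓝 x ×ˢ 𝓝[>] (0 : ℝ)) (𝓝 x) := by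
      have hc : Continuous fun q : Vec d × ℝ => q.1 + q.2 • v := by fun_prop
      have := hc.tendsto (x, 0)
      simp only [zero_smul, add_zero, nhds_prod_eq] at this
      exact this.mono_left (prod_mono le_rfl nhdsWithin_le_nhds)
    filter_upwards [h1.eventually h, h2.eventually h] with q hq1 hq2
    rw [hq1, hq2]
  simp only [clarkeSubdiff, hdir]

/-- The gradient of the smoothed function is an average of Clarke subgradients at nearby points. -/
theorem smoothGrad_mem_closure_clarkeEpsSubdiff {p : ℕ} {pb : Problem d p} {α : ℝ} (hd : 0 < d)
    (hL : 0 < pb.L₀) (hα : 0 < α) (hm : pb.Margin (α / 2)) {w : Vec d} (hw : w ∈ cube d pb.β) :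
    smoothGrad pb.fext α w ∈ closure (clarkeEpsSubdiff (√(d : ℝ) * (α / 2)) pb.f w) := by
  have := isProbabilityMeasure_unifCube (d := d) hα
  have hlip := Problem.fext_lipschitz hd hm.κ_pos hL
  obtain ⟨hint, hD⟩ := hasFDerivAt_integral_comp_add hα hL.le hlip w
  have hD' := hasGradientAt_smoothing hα hL.le hlip w
  set J := (InnerProductSpace.toDual ℝ (Vec d)).symm with hJ
  have hint' : Integrable (fun u => J (fderiv ℝ pb.fext (w + u))) (unifCube d α) := by
    refine hint.norm.mono' (J.continuous.comp_aestronglyMeasurable hint.1)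
      (Eventually.of_forall fun u => ?_)
    rw [LinearIsometryEquiv.norm_map]
  have e : smoothGrad pb.fext α w = ∫ u, J (fderiv ℝ pb.fext (w + u)) ∂(unifCube d α) := by
    refine ext_inner_right ℝ fun v => ?_
    have h4 := congrArg (fun D => D v) (hD'.hasFDerivAt.unique hD)
    simp only [InnerProductSpace.toDual_apply_apply] at h4
    rw [h4, ContinuousLinearMap.integral_apply hint, real_inner_comm, ← integral_inner hint']
    congr with u
    rw [real_inner_comm, hJ, InnerProductSpace.toDual_symm_apply]
  rw [e]
  -- The mean of a random element of a convex set is placed here only in its closure.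
  refine Convex.integral_mem (convex_convexHull ℝ _).closure isClosed_closure ?_ hint'
  have hL' : LipschitzWith pb.L₀.toNNReal pb.fext := LipschitzWith.of_dist_le_mul fun x y => by
    rw [Real.dist_eq, dist_eq_norm, Real.coe_toNNReal _ hL.le]
    exact hlip x y
  have h1 : ∀ᵐ u ∂(volume : Measure (Vec d)), DifferentiableAt ℝ pb.fext (w + u) :=
    (measurePreserving_add_left volume w).quasiMeasurePreserving.ae hL'.ae_differentiableAt
  filter_upwards [unifCube_absolutelyContinuous d α h1, ae_mem_cube_unifCube d α] with u hu hmem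
  refine subset_closure (subset_convexHull ℝ _ (Set.mem_biUnion (x := w + u) ?_ ?_))
  · simpa using norm_le_of_mem_cube (by linarith) hmem
  · rw [← clarkeSubdiff_congr (f := pb.fext) (mem_of_superset (hm.cube_mem_nhds hw hmem)
      fun x hx => Problem.fext_of_mem hx)]
    exact mem_clarkeSubdiff_of_hasFDerivAt (DifferentiableAt.hasFDerivAt hu)

end Clarke

/-! ### Arithmetic of the parameters -/

section Parameters

variable {q ρ c φ γ ε : ℝ}

theorem neg_log_mul_pos (hc : c ∈ Set.Ioo (0 : ℝ) 1) (hγ : γ ∈ Set.Ioo (0 : ℝ) 1) :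
    0 < -Real.log (c * γ) := by
  have h1 : 0 < c * γ := mul_pos hc.1 hγ.1
  have h2 : c * γ < 1 := by nlinarith [hc.1, hc.2, hγ.1, hγ.2]
  linarith [Real.log_neg h1 h2]

theorem numRuns_pos (hc : c ∈ Set.Ioo (0 : ℝ) 1) (hγ : γ ∈ Set.Ioo (0 : ℝ) 1) :
    0 < numRuns c γ := Nat.ceil_pos.2 (neg_log_mul_pos hc hγ)

theorem ψ_pos (hc : c ∈ Set.Ioo (0 : ℝ) 1) (hγ : γ ∈ Set.Ioo (0 : ℝ) 1) : 0 < ψ c γ := by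
  have h1 : (0 : ℝ) < numRuns c γ := Nat.cast_pos.2 (numRuns_pos hc hγ)
  have h2 : 0 < 1 - c := by linarith [hc.2]
  exact div_pos h1 (mul_pos h2 hγ.1)

theorem numSel_pos (hc : c ∈ Set.Ioo (0 : ℝ) 1) (hγ : γ ∈ Set.Ioo (0 : ℝ) 1) (hφ : 1 < φ)
    (hq : 0 < q) (hε : 0 < ε) : 0 < numSel q c φ γ ε := by
  have := ψ_pos hc hγ
  exact Nat.ceil_pos.2 (by positivity)

/-- The selection error uses up at most the fraction `1 / φ` of the tolerance. -/
theorem selection_error_le (hc : c ∈ Set.Ioo (0 : ℝ) 1) (hγ : γ ∈ Set.Ioo (0 : ℝ) 1) (hφ : 1 < φ)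
    (hq : 0 < q) (hε : 0 < ε) : 6 * ψ c γ * (q / numSel q c φ γ ε) ≤ ε ^ 2 / φ := by
  have hψ := ψ_pos hc hγ
  have hT : (0 : ℝ) < numSel q c φ γ ε := Nat.cast_pos.2 (numSel_pos hc hγ hφ hq hε)
  have h1 : 6 * φ * ψ c γ * (q / ε ^ 2) ≤ numSel q c φ γ ε := Nat.le_ceil _
  have h2 : 6 * φ * ψ c γ * q ≤ numSel q c φ γ ε * ε ^ 2 := by
    rw [← div_le_iff₀ (by positivity)]
    linarith [mul_div_assoc (6 * φ * ψ c γ) q (ε ^ 2)]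
  rw [le_div_iff₀ (by linarith), ← mul_div_assoc, div_mul_eq_mul_div, div_le_iff₀ hT]
  linarith

theorem εPrime_sq (hc : c ∈ Set.Ioo (0 : ℝ) 1) (hγ : γ ∈ Set.Ioo (0 : ℝ) 1) (hφ : 1 < φ)
    (hq : 0 < q) (hε : 0 < ε) :
    εPrime q c φ γ ε ^ 2 = (ε ^ 2 - 6 * ψ c γ * (q / numSel q c φ γ ε)) / (4 * Real.exp 1) := by
  rw [εPrime, Real.sq_sqrt]
  have h1 := selection_error_le hc hγ hφ hq hε
  have h2 : ε ^ 2 / φ ≤ ε ^ 2 := div_le_self (sq_nonneg _) hφ.le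
  have := Real.exp_pos 1
  exact div_nonneg (by linarith) (by positivity)

/-- Selection uses at most the share `1 / φ` of `ε²`, so `ε'²` keeps a fixed positive share. This
makes `K` and `M` comparable to the values with `ε` in place of `ε'`. -/
theorem le_εPrime_sq (hc : c ∈ Set.Ioo (0 : ℝ) 1) (hγ : γ ∈ Set.Ioo (0 : ℝ) 1) (hφ : 1 < φ)
    (hq : 0 < q) (hε : 0 < ε) :
    (1 - 1 / φ) / (4 * Real.exp 1) * ε ^ 2 ≤ εPrime q c φ γ ε ^ 2 := by
  rw [εPrime_sq hc hγ hφ hq hε, div_mul_eq_mul_div]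
  have := Real.exp_pos 1
  gcongr
  have := selection_error_le hc hγ hφ hq hε
  rw [sub_mul, one_mul, one_div_mul_eq_div]
  linarith

theorem one_sub_one_div_pos (hφ : 1 < φ) : 0 < (1 - 1 / φ) / (4 * Real.exp 1) := by
  have h := Real.exp_pos 1
  have : 1 / φ < 1 := by rw [div_lt_one (by linarith)]; exact hφ
  exact div_pos (by linarith) (by positivity)

theorem εPrime_sq_pos (hc : c ∈ Set.Ioo (0 : ℝ) 1) (hγ : γ ∈ Set.Ioo (0 : ℝ) 1) (hφ : 1 < φ)
    (hq : 0 < q) (hε : 0 < ε) : 0 < εPrime q c φ γ ε ^ 2 :=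
  lt_of_lt_of_le (mul_pos (one_sub_one_div_pos hφ) (by positivity)) (le_εPrime_sq hc hγ hφ hq hε)

theorem C₁_pos (hρ : 1 < ρ) : 0 < C₁ ρ := by
  have : 0 < ρ - 1 := by linarith
  unfold C₁; positivity

theorem C₂_pos (hρ : 1 < ρ) : 0 < C₂ ρ := by
  have : 0 < ρ - 1 := by linarith
  unfold C₂; positivity

/-- With the prescribed numbers of iterations and samples, the mean squared residual of a run is at
most `ε'²`. -/
theorem mean_residual_bound {ℓ Δ e : ℝ} {K M : ℕ} (hρ : 1 < ρ) (hℓ : 0 < ℓ) (hΔ : 0 < Δ)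
    (hq : 0 < q) (he : 0 < e) (hK0 : 0 < K) (hM0 : 0 < M) (hK : C₁ ρ * (4 * ℓ * Δ / e) ≤ K)
    (hM : C₂ ρ * (2 * q / e) ≤ M) :
    ((6 * ρ * ℓ + ℓ * (16 + 12 * ρ) / (3 * (ρ - 1))) * Δ
        + (2 + (8 + 6 * ρ) / (3 * (ρ - 1))) * (K * (q / M))) ≤ K * e := by
  have hρ1 : 0 < ρ - 1 := by linarith
  have hKp : (0 : ℝ) < K := Nat.cast_pos.2 hK0
  have hMp : (0 : ℝ) < M := Nat.cast_pos.2 hM0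
  have h1 : 6 * ρ * ℓ + ℓ * (16 + 12 * ρ) / (3 * (ρ - 1)) ≤ 2 * ℓ * C₁ ρ := by
    have : 2 * ℓ * C₁ ρ - (6 * ρ * ℓ + ℓ * (16 + 12 * ρ) / (3 * (ρ - 1)))
        = ℓ * (24 * ρ - 4) / (3 * (ρ - 1)) := by
      unfold C₁; field_simp; ring
    have h2 : 0 ≤ ℓ * (24 * ρ - 4) / (3 * (ρ - 1)) :=
      div_nonneg (mul_nonneg hℓ.le (by linarith)) (by linarith)
    linarith
  have h2 : 2 + (8 + 6 * ρ) / (3 * (ρ - 1)) ≤ C₂ ρ := by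
    have : C₂ ρ - (2 + (8 + 6 * ρ) / (3 * (ρ - 1))) = 1 + (12 * ρ - 2) / (3 * (ρ - 1)) := by
      unfold C₂; field_simp; ring
    have h2 : 0 ≤ (12 * ρ - 2) / (3 * (ρ - 1)) := div_nonneg (by linarith) (by linarith)
    linarith
  -- The budget `K e` is split evenly: `K` makes the descent term at most one half of it, and `M`
  -- does so for the noise term in `h4`.
  have h3 : 2 * ℓ * C₁ ρ * Δ ≤ K * e / 2 := by
    have : C₁ ρ * (4 * ℓ * Δ / e) * e = 4 * ℓ * C₁ ρ * Δ := by field_simp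
    nlinarith
  have h4 : C₂ ρ * (K * (q / M)) ≤ K * e / 2 := by
    have h5 : C₂ ρ * (2 * q / e) * e = 2 * C₂ ρ * q := by field_simp
    have h6 : C₂ ρ * q ≤ M * e / 2 := by nlinarith
    have h7 : C₂ ρ * (K * (q / M)) = K * (C₂ ρ * q) / M := by field_simp
    rw [h7, div_le_iff₀ hMp]
    nlinarith
  have h8 : 0 ≤ K * (q / M) := by positivity
  nlinarith [mul_le_mul_of_nonneg_right h1 hΔ.le, mul_le_mul_of_nonneg_right h2 h8]

/-- The first term is `exp(-r) ≤ cγ` by the choice of `r`; the second is `r / ψ = (1 - c)γ` by the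
choice of `ψ`. -/
theorem failure_probability_le {e b : ℝ} (hc : c ∈ Set.Ioo (0 : ℝ) 1)
    (hγ : γ ∈ Set.Ioo (0 : ℝ) 1) (he : 0 < e) (hb : 0 < b) :
    (ENNReal.ofReal e / ENNReal.ofReal (Real.exp 1 * e)) ^ numRuns c γ
      + numRuns c γ * (ENNReal.ofReal b / ENNReal.ofReal (ψ c γ * b)) ≤ ENNReal.ofReal γ := by
  have hψ := ψ_pos hc hγ
  have hr0 := numRuns_pos hc hγ
  have ht0 : 0 < Real.exp 1 * e := by positivity
  have hs0 : 0 < ψ c γ * b := by positivity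
  rw [← ENNReal.ofReal_div_of_pos ht0, ← ENNReal.ofReal_div_of_pos hs0,
    ← ENNReal.ofReal_pow (by positivity), ← ENNReal.ofReal_natCast,
    ← ENNReal.ofReal_mul (by positivity), ← ENNReal.ofReal_add (by positivity) (by positivity)]
  refine ENNReal.ofReal_le_ofReal ?_
  have e1 : e / (Real.exp 1 * e) = Real.exp (-1) := by
    rw [Real.exp_neg]; field_simp
  have e2 : (numRuns c γ : ℝ) * (b / (ψ c γ * b)) = (1 - c) * γ := by
    have hc1 : (1 - c) ≠ 0 := by linarith [hc.2]
    have hr' : (numRuns c γ : ℝ) ≠ 0 := by positivity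
    have hγ0 := hγ.1.ne'
    rw [ψ]
    field_simp
  have e3 : Real.exp (-1) ^ numRuns c γ ≤ c * γ := by
    have h1 : -Real.log (c * γ) ≤ numRuns c γ := Nat.le_ceil _
    rw [← Real.exp_nat_mul, ← Real.le_log_iff_exp_le (mul_pos hc.1 hγ.1)]
    linarith
  rw [e1, e2]
  linarith

end Parameters

/-! ### The method -/

section Method

variable {d p : ℕ} {pb : Problem d p} {O : Oracle d p} {proj : Vec d → Vec d} {x₁ : Vec d}
  {cfg : Config}

theorem batch_eq_batchMean {m : ℕ} {α : ℝ} (hα : 0 < α) (hm : pb.Margin (α / 2)) {w : Vec d}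
    (hw : w ∈ cube d pb.β) {z : Fin m → Vec d × Vec p}
    (hz : ∀ i, (z i).1 ∈ cube d (ENNReal.ofReal (α / 2))) :
    O.batch pb α w z = batchMean (O.extend pb α) w z := by
  simp only [Oracle.batch, batchMean, O.extend_eq_call hα hm hw (hz _)]

/-- The iterates stay feasible, so with all samples in the box the oracle and its measurable
extension are evaluated only where they agree. -/
theorem iterates_point_eq (hα : 0 < cfg.α) (hm : pb.Margin (cfg.α / 2))
    (hx₁ : x₁ ∈ pb.feasible) (hproj : pb.IsProjection proj)
    {z : Fin cfg.K → Fin cfg.M → Vec d × Vec p}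
    (hz : ∀ k i, (z k i).1 ∈ cube d (ENNReal.ofReal (cfg.α / 2))) (n : ℕ) :
    (iterates pb O proj x₁ cfg z n).point
      = sgdPoint (O.extend pb cfg.α) proj cfg.η x₁ z n := by
  induction n with
  | zero => rfl
  | succ n ih =>
    rw [iterates, sgdPoint]
    split_ifs with h
    · have hw := sgdPoint_mem (g := O.extend pb cfg.α) (η := cfg.η) hx₁
        (fun x => (hproj.2 x).1) z n
      rw [step]
      simp only [ih]
      rw [batch_eq_batchMean hα hm hw.2 (hz _)]
    · exact ih

theorem isProbabilityMeasure_runLaw (hα : 0 < cfg.α) (hK : 0 < cfg.K) :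
    IsProbabilityMeasure (runLaw pb cfg) := by
  have := isProbabilityMeasure_sampleLaw (pb := pb) hα
  have : IsProbabilityMeasure (ProbabilityTheory.uniformOn (Set.Icc 2 (cfg.K + 1))) :=
    ProbabilityTheory.isProbabilityMeasure_uniformOn (Set.finite_Icc _ _) ⟨2, by simp; omega⟩
  rw [runLaw]
  infer_instance

theorem ae_pi_forall {ι X : Type*} [Fintype ι] [MeasurableSpace X] {μ : Measure X}
    [IsProbabilityMeasure μ] {P : X → Prop} (h : ∀ᵐ x ∂μ, P x) :
    ∀ᵐ y ∂(Measure.pi fun _ : ι => μ), ∀ i, P (y i) :=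
  ae_all_iff.2 fun i => (Measure.quasiMeasurePreserving_eval (fun _ : ι => μ) i).ae h

theorem ae_seedLaw (hα : 0 < cfg.α) (hK : 0 < cfg.K) :
    ∀ᵐ ω ∂(seedLaw pb cfg), (∀ j, (ω.1 j).1 ∈ Set.Icc 2 (cfg.K + 1) ∧
      ∀ k i, ((ω.1 j).2 k i).1 ∈ cube d (ENNReal.ofReal (cfg.α / 2))) ∧
      ∀ i, (ω.2 i).1 ∈ cube d (ENNReal.ofReal (cfg.α / 2)) := by
  have := isProbabilityMeasure_sampleLaw (pb := pb) hα
  have := isProbabilityMeasure_runLaw (pb := pb) (cfg := cfg) hα hK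
  have hrun : ∀ᵐ ω ∂(runLaw pb cfg), ω.1 ∈ Set.Icc 2 (cfg.K + 1) ∧
      ∀ k i, (ω.2 k i).1 ∈ cube d (ENNReal.ofReal (cfg.α / 2)) := by
    have h1 : ∀ᵐ R ∂(ProbabilityTheory.uniformOn (Set.Icc 2 (cfg.K + 1))),
        R ∈ Set.Icc 2 (cfg.K + 1) := ProbabilityTheory.ae_cond_mem (measurableSet_Icc)
    have h2 : ∀ᵐ z ∂(Measure.pi fun _ : Fin cfg.K => Measure.pi fun _ : Fin cfg.M =>
        sampleLaw pb cfg.α), ∀ k i, (z k i).1 ∈ cube d (ENNReal.ofReal (cfg.α / 2)) := by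
      exact ae_pi_forall (ae_pi_forall (ae_sampleLaw_mem_cube pb cfg.α))
    exact (Measure.quasiMeasurePreserving_fst.ae h1).and (Measure.quasiMeasurePreserving_snd.ae h2)
  exact (Measure.quasiMeasurePreserving_fst.ae (ae_pi_forall hrun)).and
    (Measure.quasiMeasurePreserving_snd.ae (ae_pi_forall (ae_sampleLaw_mem_cube pb cfg.α)))

/-- The squared residual at the output of a run. -/
def runResidual (pb : Problem d p) (O : Oracle d p) (proj : Vec d → Vec d) (x₁ : Vec d)
    (cfg : Config) (ω : RunSeed d p cfg) : ℝ≥0∞ :=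
  -- The `else` branch only makes the function total: the law of `R` gives it probability zero when
  -- `K > 0`.
  if h : ω.1 - 2 < cfg.K then ENNReal.ofReal (‖residual (O.extend pb cfg.α)
    (smoothGrad pb.fext cfg.α) proj cfg.η x₁ ω.2 ⟨ω.1 - 2, h⟩‖ ^ 2) else 0

theorem measurable_runResidual {ℓ q : ℝ}
    (H : IsGradientModel (sampleLaw pb cfg.α) (cube d pb.β) (pb.fSmooth cfg.α)
      (O.extend pb cfg.α) (smoothGrad pb.fext cfg.α) ℓ q) (hp : Measurable proj) :
    Measurable (runResidual pb O proj x₁ cfg) := by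
  refine measurable_from_prod_countable_right fun R => ?_
  simp only [runResidual]
  split_ifs with h
  · have h1 := measurable_residual (x₁ := x₁) (η := cfg.η) (M := cfg.M) H.measurable_oracle
      H.continuous_grad.measurable hp ⟨R - 2, h⟩
    exact (h1.norm.pow_const 2).ennreal_ofReal
  · exact measurable_const

theorem lintegral_runResidual_le {ℓ q ρ Δ e : ℝ} (hα : 0 < cfg.α)
    (H : IsGradientModel (sampleLaw pb cfg.α) (cube d pb.β) (pb.fSmooth cfg.α)
      (O.extend pb cfg.α) (smoothGrad pb.fext cfg.α) ℓ q) (hx₁ : x₁ ∈ pb.feasible)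
    (hproj : pb.IsProjection proj) (hρ : 1 < ρ) (hℓ : 0 < ℓ) (hq : 0 < q) (hM0 : 0 < cfg.M)
    (hK0 : 0 < cfg.K) (he : 0 < e)
    (hη : cfg.η = (3 * ρ * ℓ)⁻¹) (hΔ0 : 0 < Δ)
    (hΔ : ∀ w ∈ pb.feasible, pb.fSmooth cfg.α x₁ - pb.fSmooth cfg.α w ≤ Δ)
    (hK : C₁ ρ * (4 * ℓ * Δ / e) ≤ cfg.K) (hM : C₂ ρ * (2 * q / e) ≤ cfg.M) :
    ∫⁻ ω, runResidual pb O proj x₁ cfg ω ∂(runLaw pb cfg) ≤ ENNReal.ofReal e := by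
  have := isProbabilityMeasure_sampleLaw (pb := pb) hα
  have hmeas := measurable_runResidual (x₁ := x₁) H hproj.1
  rw [runLaw, lintegral_prod _ hmeas.aemeasurable, lintegral_uniformOn_Icc]
  have hsum := H.sum_lintegral_sq_residual_le (K := cfg.K) (M := cfg.M) (convex_cube _)
    (fun x hx => hx.2) hx₁ hproj.2 hproj.1 hρ hℓ hq.le hM0 hη hΔ
  have hterm : ∀ n : Fin cfg.K, ∀ z, runResidual pb O proj x₁ cfg ((n : ℕ) + 2, z)
      = ENNReal.ofReal (‖residual (O.extend pb cfg.α) (smoothGrad pb.fext cfg.α) proj cfg.η x₁ z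
        n‖ ^ 2) := fun n z => by
    simp [runResidual]
  simp only [hterm]
  have hKp : (cfg.K : ℝ≥0∞) ≠ 0 := by simpa using hK0.ne'
  rw [← ENNReal.div_eq_inv_mul]
  refine ENNReal.div_le_of_le_mul (hsum.trans ?_)
  rw [mul_comm (ENNReal.ofReal e), ← ENNReal.ofReal_natCast, ← ENNReal.ofReal_mul (by positivity)]
  exact ENNReal.ofReal_le_ofReal (mean_residual_bound hρ hℓ hΔ0 hq he hK0 hM0 hK hM)

/-- At the output of a run, the distance from stationarity is at most the residual. -/
theorem distZero_output_le {ρ ℓ : ℝ} (hρ : 1 < ρ) (hℓ : 0 < ℓ) (hη : cfg.η = (3 * ρ * ℓ)⁻¹)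
    (hproj : pb.IsProjection proj)
    {ω : RunSeed d p cfg} (hR : ω.1 ∈ Set.Icc 2 (cfg.K + 1)) {t : ℝ} (ht : 0 ≤ t)
    (h : runResidual pb O proj x₁ cfg ω ≤ ENNReal.ofReal t) :
    distZero ({smoothGrad pb.fext cfg.α
        (sgdPoint (O.extend pb cfg.α) proj cfg.η x₁ ω.2 (ω.1 - 1))}
      + normalCone (sgdPoint (O.extend pb cfg.α) proj cfg.η x₁ ω.2 (ω.1 - 1)) pb.feasible)
      ≤ ENNReal.ofReal √t := by
  have hn : ω.1 - 2 < cfg.K := by have := hR.1; have := hR.2; omega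
  have hηp : 0 < cfg.η := by rw [hη]; positivity
  set n : Fin cfg.K := ⟨ω.1 - 2, hn⟩ with hndef
  have hn1 : ω.1 - 1 = n + 1 := by simp only [hndef]; have := hR.1; omega
  rw [runResidual, dif_pos hn, ENNReal.ofReal_le_ofReal_iff ht] at h
  rw [hn1]
  have hmem : residual (O.extend pb cfg.α) (smoothGrad pb.fext cfg.α) proj cfg.η x₁ ω.2 n
      ∈ {smoothGrad pb.fext cfg.α
        (sgdPoint (O.extend pb cfg.α) proj cfg.η x₁ ω.2 (n + 1))}
      + normalCone (sgdPoint (O.extend pb cfg.α) proj cfg.η x₁ ω.2 (n + 1)) pb.feasible := by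
    rw [residual, sub_sub]
    refine Set.mem_add.2 ⟨_, rfl, _, ?_, (sub_eq_add_neg _ _).symm⟩
    set x := sgdPoint (O.extend pb cfg.α) proj cfg.η x₁ ω.2 n
    set b := batchMean (O.extend pb cfg.α) x (ω.2 n) with hb
    have e : -(b + cfg.η⁻¹ • (sgdPoint (O.extend pb cfg.α) proj cfg.η x₁ ω.2 (n + 1) - x))
        = cfg.η⁻¹ • ((x - cfg.η • b)
          - sgdPoint (O.extend pb cfg.α) proj cfg.η x₁ ω.2 (n + 1)) := by
      simp only [smul_sub, smul_smul, inv_mul_cancel₀ hηp.ne', one_smul]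
      abel
    rw [e, sgdPoint_succ]
    exact smul_sub_mem_normalCone (hproj.2 _).1 (hproj.2 _).2 (inv_nonneg.2 hηp.le)
  exact (distZero_le_of_mem hmem).trans (ENNReal.ofReal_le_ofReal (Real.le_sqrt_of_sq_le h))

theorem measurable_sq_norm_sub {X : Type*} [MeasurableSpace X] {a b : X → Vec d}
    (ha : Measurable a) (hb : Measurable b) :
    Measurable fun x => ENNReal.ofReal (‖a x - b x‖ ^ 2) :=
  ((ha.sub hb).norm.pow_const 2).ennreal_ofReal

theorem measurable_batchMean_comp {X Z : Type*} [MeasurableSpace X] [MeasurableSpace Z] {m : ℕ}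
    {g : Vec d → Z → Vec d} (hg : Measurable (Function.uncurry g)) {a : X → Vec d}
    {b : X → Fin m → Z} (ha : Measurable a) (hb : Measurable b) :
    Measurable fun x => batchMean g (a x) (b x) :=
  (measurable_batchMean hg).comp (ha.prodMk hb)

/-- The output of a run, in terms of the globally measurable oracle. -/
def runPoint (pb : Problem d p) (O : Oracle d p) (proj : Vec d → Vec d) (x₁ : Vec d)
    (cfg : Config) (ω : RunSeed d p cfg) : Vec d :=
  sgdPoint (O.extend pb cfg.α) proj cfg.η x₁ ω.2 (ω.1 - 1)

/-- The squared error of a batch mean at the output of a run. -/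
def runError (pb : Problem d p) (O : Oracle d p) (proj : Vec d → Vec d) (x₁ : Vec d)
    (cfg : Config) (m : ℕ) (q : RunSeed d p cfg × (Fin m → Vec d × Vec p)) : ℝ≥0∞ :=
  ENNReal.ofReal (‖batchMean (O.extend pb cfg.α) (runPoint pb O proj x₁ cfg q.1) q.2
    - smoothGrad pb.fext cfg.α (runPoint pb O proj x₁ cfg q.1)‖ ^ 2)

theorem runPoint_mem (hx₁ : x₁ ∈ pb.feasible) (hproj : pb.IsProjection proj)
    (ω : RunSeed d p cfg) : runPoint pb O proj x₁ cfg ω ∈ pb.feasible :=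
  sgdPoint_mem hx₁ (fun x => (hproj.2 x).1) _ _

theorem measurable_runPoint {ℓ q : ℝ}
    (H : IsGradientModel (sampleLaw pb cfg.α) (cube d pb.β) (pb.fSmooth cfg.α)
      (O.extend pb cfg.α) (smoothGrad pb.fext cfg.α) ℓ q) (hp : Measurable proj) :
    Measurable (runPoint pb O proj x₁ cfg) := by
  refine measurable_from_prod_countable_right fun R => ?_
  exact measurable_sgdPoint (x₁ := x₁) (η := cfg.η) (M := cfg.M) (K := cfg.K) H.measurable_oracle
      hp (R - 1)

theorem measurable_runError {ℓ q : ℝ} {m : ℕ}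
    (H : IsGradientModel (sampleLaw pb cfg.α) (cube d pb.β) (pb.fSmooth cfg.α)
      (O.extend pb cfg.α) (smoothGrad pb.fext cfg.α) ℓ q) (hp : Measurable proj) :
    Measurable (runError pb O proj x₁ cfg m) := by
  have h1 : Measurable fun q : RunSeed d p cfg × (Fin m → Vec d × Vec p) =>
      runPoint pb O proj x₁ cfg q.1 := (measurable_runPoint H hp).comp measurable_fst
  have h3 : Measurable fun q : RunSeed d p cfg × (Fin m → Vec d × Vec p) =>
      smoothGrad pb.fext cfg.α (runPoint pb O proj x₁ cfg q.1) :=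
    H.continuous_grad.measurable.comp h1
  have h2 : Measurable fun q : RunSeed d p cfg × (Fin m → Vec d × Vec p) =>
      batchMean (O.extend pb cfg.α) (runPoint pb O proj x₁ cfg q.1) q.2 :=
    measurable_batchMean_comp H.measurable_oracle h1 measurable_snd
  exact measurable_sq_norm_sub h2 h3

theorem lintegral_runError_le {ℓ q : ℝ} {m : ℕ} (hα : 0 < cfg.α)
    (H : IsGradientModel (sampleLaw pb cfg.α) (cube d pb.β) (pb.fSmooth cfg.α)
      (O.extend pb cfg.α) (smoothGrad pb.fext cfg.α) ℓ q) (hx₁ : x₁ ∈ pb.feasible)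
    (hproj : pb.IsProjection proj) (hm : 0 < m) (ω : RunSeed d p cfg) :
    ∫⁻ z, runError pb O proj x₁ cfg m (ω, z) ∂(Measure.pi fun _ : Fin m => sampleLaw pb cfg.α)
      ≤ ENNReal.ofReal (q / m) := by
  have := isProbabilityMeasure_sampleLaw (pb := pb) hα
  have hmem := (runPoint_mem (O := O) hx₁ hproj ω).2
  simp only [runError]
  generalize runPoint pb O proj x₁ cfg ω = w at hmem
  exact H.lintegral_sq_batchMean_sub_le hm hmem

/-- Outside a null set and the two failure events, every permissible choice is good. -/
theorem distZero_chosen_le {ρ ℓ s t ε : ℝ} (hα : 0 < cfg.α) (hm : pb.Margin (cfg.α / 2))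
    (hx₁ : x₁ ∈ pb.feasible) (hproj : pb.IsProjection proj) (hρ : 1 < ρ) (hℓ : 0 < ℓ)
    (hη : cfg.η = (3 * ρ * ℓ)⁻¹) (hs0 : 0 ≤ s) (ht0 : 0 ≤ t) (hε : 0 ≤ ε)
    (hst : 6 * s + 4 * t ≤ ε ^ 2) {ω : Seed d p cfg}
    (hR : ∀ j, (ω.1 j).1 ∈ Set.Icc 2 (cfg.K + 1) ∧
      ∀ k i, ((ω.1 j).2 k i).1 ∈ cube d (ENNReal.ofReal (cfg.α / 2)))
    (hsel : ∀ i, (ω.2 i).1 ∈ cube d (ENNReal.ofReal (cfg.α / 2))) {j₀ : Fin cfg.r}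
    (hj₀ : runResidual pb O proj x₁ cfg (ω.1 j₀) ≤ ENNReal.ofReal t)
    (herr : ∀ j, runError pb O proj x₁ cfg cfg.T (ω.1 j, ω.2) ≤ ENNReal.ofReal s)
    {j : Fin cfg.r} (hj : IsChosen pb O proj x₁ cfg ω j) :
    output pb O proj x₁ cfg ω j ∈ pb.feasible ∧
      distZero ({smoothGrad pb.fext cfg.α (output pb O proj x₁ cfg ω j)}
        + normalCone (output pb O proj x₁ cfg ω j) pb.feasible) ≤ ENNReal.ofReal ε := by
  set pt : Fin cfg.r → Vec d := fun j => runPoint pb O proj x₁ cfg (ω.1 j) with hpt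
  set b : Fin cfg.r → Vec d := fun j => batchMean (O.extend pb cfg.α) (pt j) ω.2 with hb
  set grad := smoothGrad pb.fext cfg.α
  have hmem : ∀ j, pt j ∈ pb.feasible := fun j => runPoint_mem hx₁ hproj _
  have hout : ∀ j, output pb O proj x₁ cfg ω j = pt j := fun j =>
    iterates_point_eq hα hm hx₁ hproj (hR j).2 _
  have herr' : ∀ j, ‖b j - grad (pt j)‖ ≤ √s := fun j =>
    Real.le_sqrt_of_sq_le ((ENNReal.ofReal_le_ofReal_iff hs0).1 (herr j))
  have hscore : ∀ j, score pb O proj x₁ cfg ω j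
      = distZero ({b j} + normalCone (pt j) pb.feasible) := fun j => by
    rw [score, hout, batch_eq_batchMean hα hm (hmem _).2 hsel]
  rw [hout]
  refine ⟨hmem _, ?_⟩
  have h1 := hj j₀
  rw [hscore, hscore] at h1
  have h2 : distZero ({grad (pt j₀)} + normalCone (pt j₀) pb.feasible) ≤ ENNReal.ofReal √t :=
    distZero_output_le hρ hℓ hη hproj (hR j₀).1 ht0 hj₀
  calc distZero ({grad (pt j)} + normalCone (pt j) pb.feasible)
      ≤ distZero ({b j} + normalCone (pt j) pb.feasible) + ENNReal.ofReal √s := by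
        refine (distZero_singleton_add_le _ (b j) _).trans ?_
        gcongr
        rw [norm_sub_rev]
        exact herr' j
    _ ≤ (distZero ({grad (pt j₀)} + normalCone (pt j₀) pb.feasible)
          + ENNReal.ofReal √s) + ENNReal.ofReal √s := by
        gcongr
        refine h1.trans ((distZero_singleton_add_le _ (grad (pt j₀)) _).trans ?_)
        gcongr
        exact herr' j₀
    _ ≤ (ENNReal.ofReal √t + ENNReal.ofReal √s) + ENNReal.ofReal √s := by gcongr
    _ = ENNReal.ofReal (√t + √s + √s) := by
        rw [← ENNReal.ofReal_add (by positivity) (by positivity),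
          ← ENNReal.ofReal_add (by positivity) (by positivity)]
    -- From `4√(st) ≤ 2s + 2t` it follows that `(√t + 2√s)² ≤ 3t + 6s`, within the allowed `4t +
    -- 6s`.
    _ ≤ ENNReal.ofReal ε := by
        refine ENNReal.ofReal_le_ofReal (le_of_sq_le_sq ?_ hε)
        have hss := Real.sq_sqrt hs0
        have hts := Real.sq_sqrt ht0
        nlinarith [sq_nonneg (√s - √t), sq_nonneg (√s)]

/-- With probability at least `1 - γ`, every permissible choice is `ε`-stationary for the smoothed
function. -/
theorem exists_measurableSet_chosen_distZero_le (hd : 0 < d) (hL : 0 < pb.L₀)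
    (hx₁ : x₁ ∈ pb.feasible) (hproj : pb.IsProjection proj) {ρ c φ Δ γ ε : ℝ} (hρ : 1 < ρ)
    (hc : c ∈ Set.Ioo (0 : ℝ) 1) (hφ : 1 < φ) (hΔ0 : 0 < Δ) (hγ : γ ∈ Set.Ioo (0 : ℝ) 1)
    (hε : 0 < ε) (hα : 0 < cfg.α) (hm : pb.Margin (cfg.α / 2)) (hO : O.Valid pb cfg.α)
    (hΔ : ∀ w ∈ pb.feasible, pb.fSmooth cfg.α x₁ - pb.fSmooth cfg.α w ≤ Δ)
    (hη : cfg.η = stepSize pb ρ cfg.α) (hr : cfg.r = numRuns c γ)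
    (hT : cfg.T = numSel (O.υ * pb.Q) c φ γ ε)
    (hM : cfg.M = batchSize (O.υ * pb.Q) ρ c φ γ ε)
    (hK : C₁ ρ * (4 * (√(d : ℝ) * pb.L₀ / cfg.α) * Δ / εPrime (O.υ * pb.Q) c φ γ ε ^ 2)
      ≤ cfg.K) :
    ∃ A : Set (Seed d p cfg), MeasurableSet A ∧ ENNReal.ofReal (1 - γ) ≤ seedLaw pb cfg A ∧
      ∀ ω ∈ A, ∀ j, IsChosen pb O proj x₁ cfg ω j →
        output pb O proj x₁ cfg ω j ∈ pb.feasible ∧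
        distZero ({smoothGrad pb.fext cfg.α (output pb O proj x₁ cfg ω j)}
          + normalCone (output pb O proj x₁ cfg ω j) pb.feasible) ≤ ENNReal.ofReal ε := by
  have hd' : (0 : ℝ) < d := Nat.cast_pos.2 hd
  have hυ : 0 < O.υ := by cases O <;> simp [Oracle.υ, hd]
  have hq : 0 < O.υ * pb.Q := mul_pos hυ (Problem.Q_pos hL)
  set q := O.υ * pb.Q with hqdef
  set ℓ := √(d : ℝ) * pb.L₀ / cfg.α with hℓdef
  have hℓ : 0 < ℓ := by positivity
  have he := εPrime_sq_pos hc hγ hφ hq hε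
  have hesq := εPrime_sq hc hγ hφ hq hε
  set e := εPrime q c φ γ ε ^ 2 with hedef
  have hψ := ψ_pos hc hγ
  have hη' : cfg.η = (3 * ρ * ℓ)⁻¹ := by
    rw [hη, stepSize, hℓdef]; field_simp
  have hM' : C₂ ρ * (2 * q / e) ≤ cfg.M := by rw [hM]; exact Nat.le_ceil _
  have hM0 : 0 < cfg.M := by
    have := C₂_pos hρ
    exact Nat.cast_pos.1 (lt_of_lt_of_le (by positivity) hM')
  have hK0 : 0 < cfg.K := by
    have := C₁_pos hρ
    exact Nat.cast_pos.1 (lt_of_lt_of_le (by positivity) hK)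
  have hT0 : 0 < cfg.T := by rw [hT]; exact numSel_pos hc hγ hφ hq hε
  have hTp : (0 : ℝ) < cfg.T := Nat.cast_pos.2 hT0
  have hr0 : 0 < cfg.r := by rw [hr]; exact numRuns_pos hc hγ
  have hprobS := isProbabilityMeasure_sampleLaw (pb := pb) hα
  have hprobR := isProbabilityMeasure_runLaw (pb := pb) (cfg := cfg) hα hK0
  have hprob : IsProbabilityMeasure (seedLaw pb cfg) := by rw [seedLaw]; infer_instance
  have H := isGradientModel_extend O hd hL hα hm hO
  set g := O.extend pb cfg.α with hg
  set grad := smoothGrad pb.fext cfg.α with hgrad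
  -- The thresholds `s` and `t` are `ψ` and `exp(1)` times the mean bounds `q / T` and `e`, so
  -- Markov's inequality gives `1 / ψ` and `exp(-1)`.
  set s := ψ c γ * (q / cfg.T) with hs
  have hs0 : 0 < s := by positivity
  set t := Real.exp 1 * e with ht
  have ht0 : 0 < t := by positivity
  have hqT : 0 < q / cfg.T := by positivity
  set bad : Set (Seed d p cfg) := {ω |
    (∀ j, ENNReal.ofReal t < runResidual pb O proj x₁ cfg (ω.1 j))
    ∨ ∃ j, ENNReal.ofReal s < runError pb O proj x₁ cfg cfg.T (ω.1 j, ω.2)} with hbaddef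
  have hbad : seedLaw pb cfg bad ≤ ENNReal.ofReal γ := by
    have h1 := measure_all_lt_or_exists_lt_le (r := cfg.r) (μ := runLaw pb cfg)
      (ν := Measure.pi fun _ : Fin cfg.T => sampleLaw pb cfg.α)
      (measurable_runResidual (x₁ := x₁) H hproj.1) (measurable_runError (x₁ := x₁) H hproj.1)
      (lintegral_runResidual_le hα H hx₁ hproj hρ hℓ hq hM0 hK0 he hη' hΔ0 hΔ hK hM')
      (lintegral_runError_le hα H hx₁ hproj hT0)
      (t := ENNReal.ofReal t) (s := ENNReal.ofReal s) (by simpa using ht0) ENNReal.ofReal_ne_top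
      (by simpa using hs0) ENNReal.ofReal_ne_top
    refine h1.trans ?_
    rw [hr]
    exact failure_probability_le hc hγ he hqT
  let N : Set (Seed d p cfg) := {ω | ¬ ((∀ j, (ω.1 j).1 ∈ Set.Icc 2 (cfg.K + 1) ∧
      ∀ k i, ((ω.1 j).2 k i).1 ∈ cube d (ENNReal.ofReal (cfg.α / 2))) ∧
      ∀ i, (ω.2 i).1 ∈ cube d (ENNReal.ofReal (cfg.α / 2)))}
  have hN : seedLaw pb cfg N = 0 := ae_seedLaw hα hK0
  -- The measurable hull of the failure set has the same measure, so its complement serves as the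
  -- event whatever the measurability of that set.
  refine ⟨(toMeasurable (seedLaw pb cfg) (bad ∪ N))ᶜ, (measurableSet_toMeasurable _ _).compl,
    ?_, ?_⟩
  · rw [prob_compl_eq_one_sub (measurableSet_toMeasurable _ _), measure_toMeasurable,
      ENNReal.ofReal_sub _ hγ.1.le, ENNReal.ofReal_one]
    gcongr
    exact (measure_union_le _ _).trans (by rw [hN, add_zero]; exact hbad)
  intro ω hω j hj
  have hω' : ω ∉ bad ∪ N := fun h => hω (subset_toMeasurable _ _ h)
  rw [Set.mem_union, not_or] at hω'
  have hgood := not_not.1 hω'.2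
  have hnb := not_or.1 hω'.1
  obtain ⟨j₀, hj₀⟩ := not_forall.1 hnb.1
  -- The definition of `ε'` is this identity solved for `ε'²`.
  have hfin : 6 * s + 4 * t = ε ^ 2 := by
    rw [ht, hesq, hs, hT]
    have := Real.exp_pos 1
    field_simp
    ring
  exact distZero_chosen_le hα hm hx₁ hproj hρ hℓ hη' hs0.le ht0.le hε.le hfin.le hgood.1 hgood.2
    (not_lt.1 hj₀) (fun j => not_lt.1 fun h => hnb.2 ⟨j, h⟩) hj

end Method

/-! ### Complexity -/

section Complexity

variable {d p : ℕ} {pb : Problem d p} {O : Oracle d p} {proj : Vec d → Vec d} {x₁ : Vec d}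
  {cfg : Config}

/-- The cap by `K` makes the cost bounds valid for every seed, also for indices outside the range of
`R`. -/
theorem iterates_counts (z : Fin cfg.K → Fin cfg.M → Vec d × Vec p) (n : ℕ) :
    (iterates pb O proj x₁ cfg z n).gradCalls = min n cfg.K * cfg.M ∧
      (iterates pb O proj x₁ cfg z n).projections = min n cfg.K := by
  induction n with
  | zero => simp [iterates]
  | succ n ih =>
    rw [iterates]
    split_ifs with h
    · simp only [step, ih.1, ih.2]
      rw [min_eq_left h.le, min_eq_left (Nat.succ_le_of_lt h)]
      exact ⟨(Nat.succ_mul _ _).symm, rfl⟩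
    · rw [ih.1, ih.2, min_eq_right (by omega), min_eq_right (by omega)]
      exact ⟨rfl, rfl⟩

theorem totalGradCalls_le (ω : Seed d p cfg) :
    totalGradCalls pb O proj x₁ cfg ω ≤ cfg.r * (cfg.K * cfg.M + cfg.T) := by
  refine (Finset.sum_le_sum (g := fun _ => cfg.K * cfg.M + cfg.T) fun j _ => ?_).trans (by simp)
  rw [run, (iterates_counts _ _).1]
  gcongr
  exact min_le_right _ _

theorem totalProjections_le (ω : Seed d p cfg) :
    totalProjections pb O proj x₁ cfg ω ≤ cfg.r * cfg.K := by
  refine (Finset.sum_le_sum (g := fun _ => cfg.K) fun j _ => ?_).trans (by simp)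
  rw [run, (iterates_counts _ _).2]
  exact min_le_right _ _

theorem numRuns_le {c γ : ℝ} (hc : c ∈ Set.Ioo (0 : ℝ) 1) (hγ : γ ∈ Set.Ioo (0 : ℝ) 1) :
    (numRuns c γ : ℝ) ≤ (1 + Real.log (1 / c)) * (1 + Real.log (1 / γ)) := by
  have h1 := Nat.ceil_lt_add_one (neg_log_mul_pos hc hγ).le
  rw [← numRuns, Real.log_mul hc.1.ne' hγ.1.ne'] at h1
  rw [one_div, one_div, Real.log_inv, Real.log_inv]
  nlinarith [Real.log_neg hc.1 hc.2, Real.log_neg hγ.1 hγ.2]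

/-- One factor `Λ` comes from the number of runs and another from `ψ` inside `T`; hence `Λ²`. -/
theorem cost_le {r K M T a b m t Λ γ ε ε' : ℝ} (hK0 : 0 ≤ K) (hM0 : 0 ≤ M)
    (hT0 : 0 ≤ T) (ha : 0 ≤ a) (hb : 0 ≤ b) (hm : 0 ≤ m) (ht : 0 ≤ t) (hΛ : 1 ≤ Λ) (hγ : 0 < γ)
    (hε : 0 < ε) (hε' : 0 < ε') (hr : r ≤ a * Λ) (hK : K ≤ b * (1 / (ε * ε' ^ 2)))
    (hM : M ≤ m * (1 / ε' ^ 2)) (hT : T ≤ t * Λ * (1 / (γ * ε' ^ 2))) :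
    r * (K * M + T) ≤ (a * (b * m + t) + a * b) * Λ ^ 2
        * (1 / (ε * ε' ^ 4) + 1 / (γ * ε' ^ 2)) ∧
      r * K ≤ (a * (b * m + t) + a * b) * Λ ^ 2 * (1 / (ε * ε' ^ 2)) := by
  have hΛ0 : 0 ≤ Λ := by linarith
  have hΛ2 : Λ ≤ Λ ^ 2 := by nlinarith
  constructor
  · have hX0 : 0 ≤ 1 / (ε * ε' ^ 4) := by positivity
    have hW0 : 0 ≤ 1 / (γ * ε' ^ 2) := by positivity
    have hXe : 1 / (ε * ε' ^ 2) * (1 / ε' ^ 2) = 1 / (ε * ε' ^ 4) := by field_simp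
    generalize 1 / (γ * ε' ^ 2) = W at *
    generalize 1 / (ε * ε' ^ 4) = X at *
    have h1 : K * M ≤ b * m * Λ * X := by
      calc K * M ≤ (b * (1 / (ε * ε' ^ 2))) * (m * (1 / ε' ^ 2)) := by gcongr
        _ = b * m * 1 * X := by rw [← hXe]; ring
        _ ≤ b * m * Λ * X := by gcongr
    calc r * (K * M + T) ≤ a * Λ * (b * m * Λ * X + t * Λ * W) := by gcongr
      _ = a * Λ ^ 2 * (b * m * X + t * W) := by ring
      _ ≤ a * Λ ^ 2 * ((b * m + t) * (X + W)) := by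
          gcongr
          have h1 : 0 ≤ b * m * W := by positivity
          have h2 : 0 ≤ t * X := by positivity
          linarith
      _ = a * (b * m + t) * Λ ^ 2 * (X + W) := by ring
      _ ≤ _ := by
          gcongr
          exact le_add_of_nonneg_right (by positivity)
  · calc r * K ≤ a * Λ * (b * (1 / (ε * ε' ^ 2))) := by gcongr
      _ = a * b * Λ * (1 / (ε * ε' ^ 2)) := by ring
      _ ≤ (a * (b * m + t) + a * b) * Λ ^ 2 * (1 / (ε * ε' ^ 2)) := by
          gcongr
          exact le_add_of_nonneg_left (by positivity)

/-- Each count is a ceiling, and its `+ 1` is absorbed because the accuracies are at most `εmax` and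
`γ < 1`. Replacing `υQ` by `dQ` makes the constants common to both oracles. -/
theorem hasComplexity_of_params (hd : 0 < d) (hL : 0 < pb.L₀) {ρ c φ : ℝ} (hρ : 1 < ρ)
    (hc : c ∈ Set.Ioo (0 : ℝ) 1) (hφ : 1 < φ) {cfg : Oracle d p → ℝ → ℝ → ℝ → ℝ → Config} {a : ℝ}
    (ha : 0 ≤ a) (hr : ∀ O Δ γ ε ε', (cfg O Δ γ ε ε').r = numRuns c γ)
    (hT : ∀ O Δ γ ε ε', (cfg O Δ γ ε ε').T = numSel (O.υ * pb.Q) c φ γ ε')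
    (hM : ∀ O Δ γ ε ε', (cfg O Δ γ ε ε').M = batchSize (O.υ * pb.Q) ρ c φ γ ε')
    (hK : ∀ O Δ γ ε ε',
      (cfg O Δ γ ε ε').K = ⌈a * (Δ / (ε * εPrime (O.υ * pb.Q) c φ γ ε' ^ 2))⌉₊) :
    HasComplexity pb proj x₁ cfg := by
  intro Δmax εmax hΔmax hεmax
  have hQ := Problem.Q_pos hL
  have hd' : (1 : ℝ) ≤ d := Nat.one_le_cast.2 hd
  set qmax := d * pb.Q with hqmax
  have hqmax0 : 0 < qmax := by positivity
  set k₀ := (1 - 1 / φ) / (4 * Real.exp 1) with hk₀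
  have hk₀p : 0 < k₀ := one_sub_one_div_pos hφ
  have hC₂ := C₂_pos hρ
  have hc1 : 0 < 1 - c := by linarith [hc.2]
  set cr := 1 + Real.log (1 / c) with hcr
  have hcr0 : 0 < cr := by
    have : 0 < Real.log (1 / c) := by
      rw [one_div, Real.log_inv]; linarith [Real.log_neg hc.1 hc.2]
    linarith
  set cK := a * Δmax / k₀ + εmax ^ 3 with hcK
  set cM := C₂ ρ * (2 * qmax) / k₀ + εmax ^ 2 with hcM
  set cT := 6 * φ * cr * qmax / (1 - c) + εmax ^ 2 with hcT
  have hcK0 : 0 < cK := by positivity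
  have hcM0 : 0 < cM := by positivity
  have hcT0 : 0 < cT := by positivity
  refine ⟨cr * (cK * cM + cT) + cr * cK, 2, fun O Δ γ ε ε' hΔ hγ hε hε' => ?_⟩
  have hυ : 0 < O.υ := by cases O <;> simp [Oracle.υ, hd]
  have hυd : O.υ ≤ d := by cases O <;> simp [Oracle.υ, hd']
  have hq : 0 < O.υ * pb.Q := mul_pos hυ hQ
  have hqle : O.υ * pb.Q ≤ qmax := by rw [hqmax]; gcongr
  set q := O.υ * pb.Q
  have he := le_εPrime_sq hc hγ hφ hq hε'.1
  have hep := εPrime_sq_pos hc hγ hφ hq hε'.1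
  set e := εPrime q c φ γ ε' ^ 2 with hedef
  have hε0 := hε.1
  have hε'0 := hε'.1
  have hγ0 := hγ.1
  have hΔ0 := hΔ.1
  set Λ := 1 + Real.log (1 / γ) with hΛ
  have hΛ1 : 1 ≤ Λ := by
    have : 0 < Real.log (1 / γ) := by
      rw [one_div, Real.log_inv]; linarith [Real.log_neg hγ.1 hγ.2]
    linarith
  have hrb : ((cfg O Δ γ ε ε').r : ℝ) ≤ cr * Λ := by rw [hr]; exact numRuns_le hc hγ
  have hKb : ((cfg O Δ γ ε ε').K : ℝ) ≤ cK * (1 / (ε * ε' ^ 2)) := by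
    rw [hK]
    refine (Nat.ceil_lt_add_one (by positivity)).le.trans ?_
    rw [hcK, add_mul]
    refine add_le_add ?_ ?_
    · calc a * (Δ / (ε * e)) ≤ a * (Δmax / (ε * (k₀ * ε' ^ 2))) := by
            gcongr; exact hΔ.2
        _ = _ := by field_simp
    · rw [mul_one_div, le_div_iff₀ (by positivity), one_mul]
      calc ε * ε' ^ 2 ≤ εmax * εmax ^ 2 := by
            gcongr
            · exact hε.2
            · exact hε'.2
        _ = εmax ^ 3 := by ring
  have hMb : ((cfg O Δ γ ε ε').M : ℝ) ≤ cM * (1 / ε' ^ 2) := by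
    rw [hM, batchSize, ← hedef]
    refine (Nat.ceil_lt_add_one (by positivity)).le.trans ?_
    rw [hcM, add_mul]
    refine add_le_add ?_ ?_
    · calc C₂ ρ * (2 * q / e) ≤ C₂ ρ * (2 * qmax / (k₀ * ε' ^ 2)) := by gcongr
        _ = _ := by field_simp
    · rw [mul_one_div, le_div_iff₀ (by positivity), one_mul]
      gcongr
      exact hε'.2
  have hTb : ((cfg O Δ γ ε ε').T : ℝ) ≤ cT * Λ * (1 / (γ * ε' ^ 2)) := by
    have hψ0 := ψ_pos hc hγ
    have hψ : ψ c γ ≤ cr * Λ / ((1 - c) * γ) := by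
      rw [ψ]; gcongr; exact numRuns_le hc hγ
    rw [hT, numSel]
    refine (Nat.ceil_lt_add_one (by positivity)).le.trans ?_
    rw [hcT, add_mul, add_mul]
    refine add_le_add ?_ ?_
    · calc 6 * φ * ψ c γ * (q / ε' ^ 2)
          ≤ 6 * φ * (cr * Λ / ((1 - c) * γ)) * (qmax / ε' ^ 2) := by gcongr
        _ = _ := by field_simp
    · rw [mul_one_div, le_div_iff₀ (by positivity), one_mul]
      calc γ * ε' ^ 2 ≤ 1 * εmax ^ 2 := by
            gcongr
            · exact hγ.2.le
            · exact hε'.2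
        _ ≤ εmax ^ 2 * Λ := by nlinarith [sq_nonneg εmax]
  obtain ⟨h1, h2⟩ := cost_le (Nat.cast_nonneg _) (Nat.cast_nonneg _) (Nat.cast_nonneg _) hcr0.le
    hcK0.le hcM0.le hcT0.le hΛ1 hγ0 hε0 hε'0 hrb hKb hMb hTb
  refine Eventually.of_forall fun ω => ⟨le_trans ?_ h1, le_trans ?_ h2⟩
  · exact_mod_cast totalGradCalls_le ω
  · exact_mod_cast totalProjections_le ω

end Complexity

/-! ### Smoothing parameters in the two cases -/

theorem α₁₂_pos {d p : ℕ} (hd : 0 < d) {pb : Problem d p} (hL : 0 < pb.L₀) {ε : ℝ} (hε : 0 < ε) :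
    0 < α₁₂ pb ε := by
  have : (0 : ℝ) < d := Nat.cast_pos.2 hd
  rw [α₁₂]; positivity

theorem α₃₄_pos {d : ℕ} (hd : 0 < d) {ε : ℝ} (hε : 0 < ε) : 0 < α₃₄ d ε := by
  have : (0 : ℝ) < d := Nat.cast_pos.2 hd
  rw [α₃₄]; positivity

/-- Since `√d · √(d / 12) = d / (2√3)`, the constant `√(4 / 3)` in the iteration count of Case A is
`4 / (2√3)`. -/
theorem four_mul_smoothness_α₁₂ {d p : ℕ} (hd : 0 < d) {pb : Problem d p} (hL : 0 < pb.L₀) {ε : ℝ}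
    (hε : 0 < ε) :
    4 * (√(d : ℝ) * pb.L₀ / α₁₂ pb ε) = √(4 / 3) * (d * pb.L₀ ^ 2 / ε) := by
  have hd' : (0 : ℝ) < d := Nat.cast_pos.2 hd
  have h1 : √((d : ℝ) / 12) = √(d : ℝ) / (2 * √3) := by
    rw [Real.sqrt_div hd'.le, show (12 : ℝ) = 2 ^ 2 * 3 by norm_num,
      Real.sqrt_mul (by norm_num), Real.sqrt_sq (by norm_num)]
  have h2 : √((4 : ℝ) / 3) = 2 / √3 := by
    rw [Real.sqrt_div (by norm_num), show (4 : ℝ) = 2 ^ 2 by norm_num,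
      Real.sqrt_sq (by norm_num)]
  have h3 := Real.sq_sqrt hd'.le
  rw [α₁₂, h1, h2]
  field_simp
  rw [h3]
  ring

end

end SPA

/-! ### The two cases -/

theorem corollary3 {d p : ℕ} (hd : 0 < d) (pb : SPA.Problem d p) (hL : 0 < pb.L₀)
    (x₁ : SPA.Vec d) (hx₁ : x₁ ∈ pb.feasible)
    (proj : SPA.Vec d → SPA.Vec d) (hproj : pb.IsProjection proj)
    (ρ c φ : ℝ) (hρ : 1 < ρ) (hc : c ∈ Set.Ioo (0 : ℝ) 1) (hφ : 1 < φ) :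
    -- the chosen point is an (ε₁, ε₂)-stationary point with probability at least 1 - γ
    (∀ (O : SPA.Oracle d p) (Δ γ ε₁ ε₂ : ℝ), 0 < Δ → γ ∈ Set.Ioo (0 : ℝ) 1 → 0 < ε₁ → 0 < ε₂ →
      pb.Margin (SPA.α₁₂ pb ε₁ / 2) → O.Valid pb (SPA.α₁₂ pb ε₁) →
      (∀ w ∈ pb.feasible,
        pb.fSmooth (SPA.α₁₂ pb ε₁) x₁ - pb.fSmooth (SPA.α₁₂ pb ε₁) w ≤ Δ) →
      SPA.ChosenWithProb pb O proj x₁ (SPA.config₁₂ pb O ρ c φ Δ γ ε₁ ε₂) γ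
        (pb.IsStationary₁₂ (SPA.α₁₂ pb ε₁) ε₁ ε₂)) ∧
    SPA.HasComplexity pb proj x₁ (fun O Δ γ ε₁ ε₂ => SPA.config₁₂ pb O ρ c φ Δ γ ε₁ ε₂) ∧
    -- the chosen point is an (ε₃, ε₄)-stationary point with probability at least 1 - γ
    (∀ (O : SPA.Oracle d p) (Δ γ ε₃ ε₄ : ℝ), 0 < Δ → γ ∈ Set.Ioo (0 : ℝ) 1 → 0 < ε₃ → 0 < ε₄ →
      pb.Margin ε₃ → O.Valid pb (SPA.α₃₄ d ε₃) →
      (∀ w ∈ pb.feasible, pb.fSmooth (SPA.α₃₄ d ε₃) x₁ - pb.fSmooth (SPA.α₃₄ d ε₃) w ≤ Δ) →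
      SPA.ChosenWithProb pb O proj x₁ (SPA.config₃₄ pb O ρ c φ Δ γ ε₃ ε₄) γ
        (pb.IsStationary₃₄ (SPA.α₃₄ d ε₃) ε₃ ε₄)) ∧
    SPA.HasComplexity pb proj x₁ (fun O Δ γ ε₃ ε₄ => SPA.config₃₄ pb O ρ c φ Δ γ ε₃ ε₄) := by
  have hC₁ := SPA.C₁_pos hρ
  have hd' : (0 : ℝ) < d := Nat.cast_pos.2 hd
  have hd1 : (1 : ℝ) ≤ √(d : ℝ) := Real.one_le_sqrt.2 (Nat.one_le_cast.2 hd)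
  refine ⟨?_, ?_, ?_, ?_⟩
  · intro O Δ γ ε₁ ε₂ hΔ0 hγ hε₁ hε₂ hm hO hΔ
    have hα := SPA.α₁₂_pos hd hL hε₁
    obtain ⟨A, hA, hPA, h⟩ := SPA.exists_measurableSet_chosen_distZero_le
      (cfg := SPA.config₁₂ pb O ρ c φ Δ γ ε₁ ε₂) hd hL hx₁ hproj hρ hc hφ hΔ0 hγ hε₂ hα hm hO hΔ
      rfl rfl rfl rfl (by
        refine le_trans (le_of_eq ?_) (Nat.le_ceil _)
        rw [SPA.config₁₂, SPA.four_mul_smoothness_α₁₂ hd hL hε₁]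
        field_simp)
    refine ⟨A, hA, hPA, fun ω hω j hj => ?_⟩
    obtain ⟨h1, h2⟩ := h ω hω j hj
    refine ⟨fun x hx => ?_, _, SPA.Problem.hasGradientAt_fSmooth hd hL hα hm h1.2, h2⟩
    refine (SPA.Problem.abs_fSmooth_sub_le hd hL hα hm hx).trans (le_of_eq ?_)
    rw [SPA.α₁₂]
    field_simp
  · exact SPA.hasComplexity_of_params hd hL hρ hc hφ
      (a := SPA.C₁ ρ * √(4 / 3) * (d * pb.L₀ ^ 2)) (by positivity)
      (fun _ _ _ _ _ => rfl) (fun _ _ _ _ _ => rfl) (fun _ _ _ _ _ => rfl)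
      (fun O Δ γ ε ε' => by
        refine congrArg Nat.ceil ?_
        ring)
  · intro O Δ γ ε₃ ε₄ hΔ0 hγ hε₃ hε₄ hm hO hΔ
    have hα := SPA.α₃₄_pos hd hε₃
    -- Here `α / 2 = ε₃ / √d` and `d ≥ 1`, so a margin of `ε₃` suffices for sampling.
    have hle : SPA.α₃₄ d ε₃ / 2 ≤ ε₃ := by
      rw [SPA.α₃₄, div_div, div_le_iff₀ (by positivity)]
      nlinarith
    have hm' := hm.mono hle
    obtain ⟨A, hA, hPA, h⟩ := SPA.exists_measurableSet_chosen_distZero_le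
      (cfg := SPA.config₃₄ pb O ρ c φ Δ γ ε₃ ε₄) hd hL hx₁ hproj hρ hc hφ hΔ0 hγ hε₄ hα hm' hO hΔ
      rfl rfl rfl rfl (by
        refine le_trans (le_of_eq ?_) (Nat.le_ceil _)
        have h3 := Real.sq_sqrt hd'.le
        rw [SPA.config₃₄, SPA.α₃₄]
        field_simp
        rw [h3]
        ring)
    refine ⟨A, hA, hPA, fun ω hω j hj => ?_⟩
    obtain ⟨h1, h2⟩ := h ω hω j hj
    refine ⟨le_of_eq ?_, ?_⟩
    · rw [SPA.α₃₄]
      field_simp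
    -- Replacing the smoothed gradient by the larger `ε`-subdifferential cannot increase the
    -- distance, although the gradient is known to lie only in its closure.
    · exact (SPA.distZero_add_le_of_mem_closure
        (SPA.smoothGrad_mem_closure_clarkeEpsSubdiff hd hL hα hm' h1.2)).trans h2
  · exact SPA.hasComplexity_of_params hd hL hρ hc hφ
      (a := SPA.C₁ ρ * (2 * d * pb.L₀)) (by positivity)
      (fun _ _ _ _ _ => rfl) (fun _ _ _ _ _ => rfl) (fun _ _ _ _ _ => rfl)
      (fun O Δ γ ε ε' => by
        refine congrArg Nat.ceil ?_
        ring)
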